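/- Let $G=(V,E)$ be a proper interval graph with $n=|V|$, given by an interval representation: closed intervals $I_v\subset\mathbb R$ ($v\in V$), none properly contained in another, such that distinct $u,v$ are adjacent if and only if $I_u\cap I_v\neq\emptyset$. Let $C\ge 1$ be an integer and let $W(v)\in\mathbb Z_{\ge 0}$ be vertex weights. A *split coloring* of $(G,W)$ with $\lambda$ colors consists of finitely many copies of the vertices, with non-negative integer weights such that for every $v$ the weights of the copies of $v$ add up to $W(v)$ (a vertex of weight $0$ may have no copy), and an assignment of one of $\lambda$ colors to every copy, such that every monochromatic component has total weight at most $C$. Here two distinct copies are adjacent if they are copies of the same vertex or of adjacent vertices of $G$, and the monochromatic components are the connected components of the subgraphs induced by the single color classes. On a unit-cost random access machine that accesses the interval endpoints through comparisons and uses machine words of $O(\log(n+C+\sum_v W(v)))$ bits, the splittable weighted component coloring problem can be solved in $O(n^2)$ time, in the following sense. 1. There is an algorithm that, whenever $W(v)\le C$ for all $v$, outputs in $O(n^2)$ time a split coloring of $(G,W)$ with the least possible number of colors (the number of colors, and the vertex, weight and color of every copy). 2. There is an algorithm that, for unrestricted weights, computes in $O(n^2)$ time the least number of colors of a split coloring of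 $(G,W)$. The constants do not depend on $G$, the representation, $W$ or $C$. (For $n=0$ the bound $O(n^2)$ is read as $O(1)$.) -/

import Mathlib

open scoped BigOperators

namespace SplitColor

/-! ## Proper interval graphs -/

/-- The closed real intervals `[lft v, rgt v]` form an interval representation of `G` in which no
interval is properly contained in another. -/
structure IsProperIntervalRep {V : Type*} (G : SimpleGraph V) (lft rgt : V → ℝ) : Prop where
  le : ∀ v, lft v ≤ rgt v
  adj_iff : ∀ u v, G.Adj u v ↔
    u ≠ v ∧ (Set.Icc (lft u) (rgt u) ∩ Set.Icc (lft v) (rgt v)).Nonempty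
  proper : ∀ u v, ¬ Set.Icc (lft u) (rgt u) ⊂ Set.Icc (lft v) (rgt v)

/-! ## Weight-split graphs and component colorings -/

/-- The graph of copies: every `x : U` is a copy of the vertex `owner x`. Two different copies
are adjacent if they are copies of the same vertex or of adjacent vertices. -/
def copyGraph {V U : Type*} (G : SimpleGraph V) (owner : U → V) : SimpleGraph U where
  Adj x y := x ≠ y ∧ (owner x = owner y ∨ G.Adj (owner x) (owner y))
  symm := ⟨fun _ _ h => ⟨h.1.symm, h.2.imp Eq.symm (fun h' => h'.symm)⟩⟩
  loopless := ⟨fun _ h => h.1 rfl⟩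

open Classical in
/-- Every chromon, i.e. every connected component of the subgraph induced by a single color
class, has total weight at most `C`. -/
def IsComponentColoring {U : Type*} [Fintype U] (H : SimpleGraph U) (w : U → ℕ) (C : ℕ)
    {l : ℕ} (color : U → Fin l) : Prop :=
  ∀ (i : Fin l) (K : (H.induce {x | color x = i}).ConnectedComponent),
    (∑ x : {x | color x = i} with
      (H.induce {x | color x = i}).connectedComponentMk x = K, w x.1) ≤ C

/-- An `[l, C]`-split coloring of the weighted graph `(G, W)`: a weight-split graph (the weight
of each vertex is distributed over its copies) together with an `[l, C]`-coloring of it.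
A vertex of weight `0` may have no copy at all. -/
structure SplitColoring {V : Type*} [DecidableEq V] (G : SimpleGraph V) (W : V → ℕ)
    (C l : ℕ) where
  /-- number of copies -/
  card : ℕ
  owner : Fin card → V
  weight : Fin card → ℕ
  color : Fin card → Fin l
  sum_weight : ∀ v, (∑ j with owner j = v, weight j) = W v
  isColoring : IsComponentColoring (copyGraph G owner) weight C color

/-- `(G, W)` is `[l, C]`-split colorable. -/
def SplitColorable {V : Type*} [DecidableEq V] (G : SimpleGraph V) (W : V → ℕ) (C l : ℕ) :
    Prop :=
  Nonempty (SplitColoring G W C l)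

/-! ## Random access machine programs with unit cost -/

/-- Arithmetic and comparison operations on machine words. -/
inductive BinOp
  | add | sub | mul | div | mod | le | eq

def BinOp.eval : BinOp → ℤ → ℤ → ℤ
  | .add, a, b => a + b
  | .sub, a, b => a - b
  | .mul, a, b => a * b
  | .div, a, b => a / b
  | .mod, a, b => a % b
  | .le, a, b => if a ≤ b then 1 else 0
  | .eq, a, b => if a = b then 1 else 0

/-- The two ends of an interval. -/
inductive Side
  | left | right

/-- Expressions. `get a i` reads cell `i` of array `a`; `endLe σ i τ j` compares the `σ`-endpoint
of interval number `i` with the `τ`-endpoint of interval number `j` (the only access that a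
program has to the interval representation). -/
inductive AExp
  | const (z : ℤ)
  | var (x : ℕ)
  | get (a : ℕ) (i : AExp)
  | bin (op : BinOp) (e f : AExp)
  | endLe (σ : Side) (i : AExp) (τ : Side) (j : AExp)

/-- The number of elementary operations in an expression. -/
def AExp.size : AExp → ℕ
  | .const _ => 1
  | .var _ => 1
  | .get _ i => i.size + 1
  | .bin _ e f => e.size + f.size + 1
  | .endLe _ i _ j => i.size + j.size + 1

/-- Commands. `store a i e` writes `e` into cell `i` of array `a`. In a condition every value
other than `0` counts as true. -/
inductive Cmd
  | skip
  | assign (x : ℕ) (e : AExp)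
  | store (a : ℕ) (i e : AExp)
  | seq (p q : Cmd)
  | ite (e : AExp) (p q : Cmd)
  | while (e : AExp) (p : Cmd)

/-- Memory: variables and arrays, both named by numbers (a program mentions finitely many). -/
@[ext]
structure State where
  var : ℕ → ℤ
  arr : ℕ → ℤ → ℤ

def State.setVar (s : State) (x : ℕ) (z : ℤ) : State :=
  { s with var := Function.update s.var x z }

def State.setArr (s : State) (a : ℕ) (i z : ℤ) : State :=
  { s with arr := Function.update s.arr a (Function.update (s.arr a) i z) }

/-- The interval endpoints, addressed by machine integers (`0` outside the range). -/
noncomputable def endpoint {n : ℕ} (lft rgt : Fin n → ℝ) (σ : Side) (i : ℤ) : ℝ :=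
  if h : 0 ≤ i ∧ i.toNat < n then
    match σ with
    | .left => lft ⟨i.toNat, h.2⟩
    | .right => rgt ⟨i.toNat, h.2⟩
  else 0

/-- Value of an expression, given the endpoints `E` and the memory `s`. -/
noncomputable def AExp.eval (E : Side → ℤ → ℝ) (s : State) : AExp → ℤ
  | .const z => z
  | .var x => s.var x
  | .get a i => s.arr a (i.eval E s)
  | .bin op e f => op.eval (e.eval E s) (f.eval E s)
  | .endLe σ i τ j => if E σ (i.eval E s) ≤ E τ (j.eval E s) then 1 else 0

/-- `Exec E B p s T s'`: started in memory `s`, the program `p` halts in memory `s'` after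
exactly `T` elementary steps, and every number that it writes, and every address that it writes
to, has absolute value at most `B` (so it fits into a machine word). -/
inductive Exec (E : Side → ℤ → ℝ) (B : ℤ) : Cmd → State → ℕ → State → Prop
  | skip (s : State) : Exec E B .skip s 1 s
  | assign (x : ℕ) (e : AExp) (s : State) (he : |e.eval E s| ≤ B) :
      Exec E B (.assign x e) s (e.size + 1) (s.setVar x (e.eval E s))
  | store (a : ℕ) (i e : AExp) (s : State) (hi : |i.eval E s| ≤ B) (he : |e.eval E s| ≤ B) :
      Exec E B (.store a i e) s (i.size + e.size + 1) (s.setArr a (i.eval E s) (e.eval E s))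
  | seq {p q : Cmd} {s s' s'' : State} {T T' : ℕ}
      (hp : Exec E B p s T s') (hq : Exec E B q s' T' s'') :
      Exec E B (.seq p q) s (T + T') s''
  | ite_true {e : AExp} {p q : Cmd} {s s' : State} {T : ℕ} (he : e.eval E s ≠ 0)
      (hp : Exec E B p s T s') : Exec E B (.ite e p q) s (e.size + 1 + T) s'
  | ite_false {e : AExp} {p q : Cmd} {s s' : State} {T : ℕ} (he : e.eval E s = 0)
      (hq : Exec E B q s T s') : Exec E B (.ite e p q) s (e.size + 1 + T) s'
  | while_true {e : AExp} {p : Cmd} {s s' s'' : State} {T T' : ℕ} (he : e.eval E s ≠ 0)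
      (hp : Exec E B p s T s') (hw : Exec E B (.while e p) s' T' s'') :
      Exec E B (.while e p) s (e.size + 1 + T + T') s''
  | while_false {e : AExp} {p : Cmd} {s : State} (he : e.eval E s = 0) :
      Exec E B (.while e p) s (e.size + 1) s

/-! ## Input and output -/

/-- Initial memory: variable `0` holds the number of vertices, variable `1` the bound `C`,
array `0` the weights; everything else is `0`. -/
def initState {n : ℕ} (W : Fin n → ℕ) (C : ℕ) : State where
  var x := if x = 0 then (n : ℤ) else if x = 1 then (C : ℤ) else 0
  arr a i := if h : a = 0 ∧ 0 ≤ i ∧ i.toNat < n then (W ⟨i.toNat, h.2.2⟩ : ℤ) else 0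

/-- Word size: numbers of `O(log (n + C + ∑ W))` bits. -/
def wordBound {n : ℕ} (W : Fin n → ℕ) (C c : ℕ) : ℤ :=
  (((n + C + ∑ v, W v + 2) ^ c : ℕ) : ℤ)

/-- The memory `s` holds the split coloring `K`: variable `0` the number of colors, variable `1`
the number of copies, and arrays `1`, `2`, `3` the vertex, the weight and the color of every
copy. -/
def Holds {n : ℕ} {G : SimpleGraph (Fin n)} {W : Fin n → ℕ} {C l : ℕ} (s : State)
    (K : SplitColoring G W C l) : Prop :=
  s.var 0 = l ∧ s.var 1 = K.card ∧
    ∀ j : Fin K.card, s.arr 1 (j : ℕ) = (K.owner j : ℕ) ∧ s.arr 2 (j : ℕ) = K.weight j ∧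
      s.arr 3 (j : ℕ) = (K.color j : ℕ)

/-- On every proper interval graph on vertices `0, …, n - 1` with an interval representation,
every `C ≥ 1` and all weights that satisfy `Adm`, the program `P`, run with words of
`O(log (n + C + ∑ W))` bits, halts after `O(n ^ 2)` steps with a result that satisfies `Post`. -/
def SolvesInQuadraticTime (P : Cmd) (Adm : ∀ {n : ℕ}, (Fin n → ℕ) → ℕ → Prop)
    (Post : ∀ {n : ℕ}, SimpleGraph (Fin n) → (Fin n → ℕ) → ℕ → State → Prop) : Prop :=
  ∃ c : ℕ, ∀ (n : ℕ) (G : SimpleGraph (Fin n)) (lft rgt : Fin n → ℝ) (W : Fin n → ℕ) (C : ℕ),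
    IsProperIntervalRep G lft rgt → 1 ≤ C → Adm W C →
      ∃ (T : ℕ) (s : State),
        Exec (endpoint lft rgt) (wordBound W C c) P (initState W C) T s ∧
        T ≤ c * (n ^ 2 + 1) ∧ Post G W C s

end SplitColor

/-! Order the vertices by left endpoint and give vertex `v` a segment of `W v` consecutive unit
positions, `N` in all. No interval properly contains another, so the right endpoints follow the same
order, and position `x` conflicts exactly with the later positions before a bound `conflictEnd x`
that is monotone in `x`. A split coloring turns into a `BlockColoring` of the positions, whose
blocks are chains of conflicts within one color.

An exchange argument (`BlockColoring.exists_contiguous`) makes every block an interval, so only the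
cut points `c 0 ≤ c 1 ≤ ...` matter. With `d + 1` colors the pigeonhole principle forces
`conflictEnd (c j - 1) ≤ c (j + d)` (`BlockColoring.exists_isCutSequence`). Conversely, the blocks
of such a sequence may be colored cyclically (`IsCutSequence.splitColoring`). Hence `d + 1` colors
suffice exactly if there is an `IsCutSequence` with parameter `d`.

Let `ω` be the weight of the heaviest clique. At least `⌈ω / C⌉` colors are needed, since inside a
clique each color has only one block. One color more always suffices: cut at the multiples of `C`.
It remains to test `d + 1 = ⌈ω / C⌉`. All cuts in the segment `(P i, P (i + 1)]` have to reach the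
same point `G i` within `d` steps, so the admissible ones among them are those from some threshold
on. Let `b i` be the least admissible cut beyond `P i`. Going from right to left, it is found by
pulling `G i` back `d` steps of length at most `C` through the thresholds already known
(`PullBack`). Every cut of a cut sequence is admissible (`IsThreshold.le_cut`), so `b i ≤ P i + C`
is necessary for all `i`. If it holds, cutting greedily at the farthest admissible point works
(`IsThreshold.isCutSequence_greedyCut`).

Ranks and sums come from comparing all pairs of vertices. Pulling one target back costs constant
time per segment, because one division handles all steps inside a segment. Two consecutive greedy
blocks together exceed `C` unless the end is reached, so for weights at most `C` there are at most
`2 * n` nonempty blocks, each listed in linear time. Every pass is therefore quadratic. -/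

namespace SplitColor

/-! ## Block colorings of a linear order -/

/-- The positions `0, …, N - 1` are colored by `χ` and partitioned into blocks, the block of `x`
being named by the pair `(χ x, β x)`. Position `x` conflicts with the later positions before
`nb x`; blocks have at most `C` positions, blocks of one color do not interleave, and
positions of the same color in different blocks do not conflict. -/
structure BlockColoring {ι : Type*} [DecidableEq ι] (N C : ℕ) (nb : ℕ → ℕ) (χ : ℕ → ι)
    (β : ℕ → ℤ) : Prop where
  mono : ∀ x y, x < y → y < N → χ x = χ y → β x ≤ β y
  sep : ∀ x y, x < y → y < N → χ x = χ y → β x ≠ β y → nb x ≤ y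
  card_le : ∀ a k, ((Finset.range N).filter (fun x => χ x = a ∧ β x = k)).card ≤ C

/-- No block has a gap before position `p`. -/
def ContiguousBelow {ι : Type*} (N p : ℕ) (χ : ℕ → ι) (β : ℕ → ℤ) : Prop :=
  ∀ x y z, x < y → y < z → z < N → y < p → χ x = χ z → β x = β z → χ y = χ x ∧ β y = β x

section Exchange

variable {ι : Type*} [DecidableEq ι] {N C : ℕ} {nb : ℕ → ℕ} {χ : ℕ → ι} {β : ℕ → ℤ}

/-- Cutting a block at a gap that no conflict crosses. -/
theorem BlockColoring.split_block (hnb : Monotone nb) (h : BlockColoring N C nb χ β) {p z : ℕ}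
    (hp : ContiguousBelow N (p + 1) χ β) (hz : p + 1 < z) (hzN : z < N) (hc : χ p = χ z)
    (hb : β p = β z) (hne : ∀ x, p < x → x < z → χ x ≠ χ p) (hsep : nb p ≤ z) :
    ∃ β', BlockColoring N C nb χ β' ∧ ContiguousBelow N (p + 2) χ β' := by
  have hm := h.mono
  have hs := h.sep
  -- All later blocks of the color are renumbered as well, so the new name `β p + 1` is free and the
  -- order of names is kept.
  refine ⟨fun x => if z ≤ x ∧ χ x = χ p then β x + 1 else β x, ⟨?_, ?_, ?_⟩, ?_⟩
  · intro x y hxy hy hxc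
    have := hm x y hxy hy hxc
    grind
  · intro x y hxy hy hxc hne'
    have h1 := hs x y hxy hy hxc
    by_cases hx : x ≤ p
    · have := hnb hx
      grind
    · grind
  · intro a k
    by_cases ha : a = χ p
    · subst ha
      by_cases hk : k ≤ β p
      · refine le_trans (Finset.card_le_card ?_) (h.card_le (χ p) k)
        intro x
        simp only [Finset.mem_filter, Finset.mem_range]
        have := hm z x
        grind
      · refine le_trans (Finset.card_le_card ?_) (h.card_le (χ p) (k - 1))
        intro x
        simp only [Finset.mem_filter, Finset.mem_range]
        have := hm x p
        grind
    · refine le_trans (Finset.card_le_card ?_) (h.card_le a k)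
      intro x
      simp only [Finset.mem_filter, Finset.mem_range]
      grind
  · intro x y w hxy hyw hw hyp hxc hxb
    have := hp x y w
    have := hp x y p
    have := hp x p w
    have := hm x p
    have := hm z w
    grind

/-- A later position of the current block trades places with an intruder whose block goes on. -/
theorem BlockColoring.swap_positions (hnb : Monotone nb) (h : BlockColoring N C nb χ β)
    {p z w : ℕ} (hp : ContiguousBelow N (p + 1) χ β) (hz : p + 1 < z) (hc : χ p = χ z)
    (hb : β p = β z) (hne : ∀ x, p < x → x < z → χ x ≠ χ p)
    (hzw : z < w) (hwN : w < N) (hwc : χ w = χ (p + 1)) (hwb : β w = β (p + 1)) :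
    ∃ (χ' : ℕ → ι) (β' : ℕ → ℤ), BlockColoring N C nb χ' β' ∧ ContiguousBelow N (p + 2) χ' β' := by
  have hm := h.mono
  have hs := h.sep
  have hq : χ (p + 1) ≠ χ p := hne _ (by omega) hz
  have hsw : ∀ x, Equiv.swap (p + 1) z x = if x = p + 1 then z else if x = z then p + 1 else x :=
    fun x => Equiv.swap_apply_def _ _ _
  -- The two moved positions stay within the spans of their new blocks: `p + 1` lies between `p` and
  -- `z`, and `z` lies between `p + 1` and `w`. Hence order and separation survive, and block sizes
  -- do not change.
  refine ⟨χ ∘ Equiv.swap (p + 1) z, β ∘ Equiv.swap (p + 1) z, ⟨?_, ?_, ?_⟩, ?_⟩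
  · intro x y hxy hy
    simp only [Function.comp_apply, hsw]
    intro hxc
    have := hm x y hxy hy
    have := hm p y
    have := hm x z
    have := hm z y
    have := hm (p + 1) y
    have := hm (p + 1) x
    have := hm x w
    grind
  · intro x y hxy hy
    simp only [Function.comp_apply, hsw]
    intro hxc hxb
    have := hs x y hxy hy
    have := hs x p
    have := hs z y
    have := hs w y
    have := hs x (p + 1)
    have := hm (p + 1) x
    have := hm x w
    have := hm (p + 1) y
    have := hm y w
    have h1 : nb (p + 1) ≤ nb z := hnb (by omega)
    have h2 : nb z ≤ nb w := hnb (by omega)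
    grind
  · intro a k
    refine le_trans (Finset.card_le_card_of_injOn (Equiv.swap (p + 1) z) ?_
      (Equiv.injective _).injOn) (h.card_le a k)
    intro x
    simp only [Finset.coe_filter, Finset.mem_range, Set.mem_ofPred_eq, Function.comp_apply]
    rintro ⟨hx, h1, h2⟩
    refine ⟨?_, h1, h2⟩
    rw [hsw]
    grind
  · intro x y v hxy hyv hv hyp
    simp only [Function.comp_apply, hsw]
    intro hxc hxb
    have := hp x y v
    have := hp x y p
    have := hp x y z
    have := hp x y (p + 1)
    have := hp x p v
    have := hp x p (p + 1)
    grind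

/-- The intruder's block ends before the current block goes on: the two colors are interchanged
from there on, and the current block swallows an initial part of the intruder's block. -/
theorem BlockColoring.swap_colors (hnb : Monotone nb) (h : BlockColoring N C nb χ β)
    {p z : ℕ} (hp : ContiguousBelow N (p + 1) χ β) (hz : p + 1 < z) (hzN : z < N)
    (hc : χ p = χ z)
    (hb : β p = β z) (hne : ∀ x, p < x → x < z → χ x ≠ χ p) (hadj : z < nb p)
    (hend : ∀ w, z < w → w < N → χ w = χ (p + 1) → β w ≠ β (p + 1)) :
    ∃ (χ' : ℕ → ι) (β' : ℕ → ℤ), BlockColoring N C nb χ' β' ∧ ContiguousBelow N (p + 2) χ' β' := by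
  have hm := h.mono
  have hs := h.sep
  have hq : χ (p + 1) ≠ χ p := hne _ (by omega) hz
  -- the head of the current block, its tail, and the intruder's block
  set A₁ := (Finset.range (p + 1)).filter (fun x => χ x = χ p ∧ β x = β p) with hA₁
  set A₂ := (Finset.Ico z N).filter (fun x => χ x = χ p ∧ β x = β p) with hA₂
  have hA : A₁.card + A₂.card ≤ C := by
    rw [← Finset.card_union_of_disjoint]
    · refine le_trans (Finset.card_le_card ?_) (h.card_le (χ p) (β p))
      intro x
      simp only [hA₁, hA₂, Finset.mem_union, Finset.mem_filter, Finset.mem_range, Finset.mem_Ico]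
      grind
    · rw [Finset.disjoint_left]
      intro x
      simp only [hA₁, hA₂, Finset.mem_filter, Finset.mem_range, Finset.mem_Ico]
      omega
  have hA₂1 : 1 ≤ A₂.card := Finset.card_pos.mpr ⟨z, by simp [hA₂, hzN, hc, hb]⟩
  -- Since `z < nb p ≤ nb (p + 1)`, all these positions conflict with `p + 1`, so same-colored ones
  -- share its block.
  have hfar : ∀ x, p < x → x < z → χ x = χ (p + 1) → β x = β (p + 1) := by
    intro x h1 h2 h3
    by_contra h4
    have h5 : p + 1 < x := by
      rcases Nat.lt_or_ge (p + 1) x with h | h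
      · exact h
      · exact absurd (by rw [show x = p + 1 by omega]) h4
    have := hs (p + 1) x h5 (by omega) h3.symm (Ne.symm h4)
    have := hnb (show p ≤ p + 1 by omega)
    omega
  -- The intruder's block starts at `p + 1`: reaching back before `p` it would have a gap at `p`.
  have hfirst : ∀ x, x ≤ p → χ x = χ (p + 1) → β x < β (p + 1) := by
    intro x h1 h2
    have h3 := hm x (p + 1) (by omega) (by omega) h2
    rcases h3.lt_or_eq with h4 | h4
    · exact h4
    · have h5 := hp x p (p + 1)
      grind
  set m : ℕ → ℕ := fun t => ((Finset.Ico (p + 1) t).filter (fun x => χ x = χ (p + 1))).card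
    with hmdef
  -- The head takes over intruder positions up to `t`: until it has `C` positions or the intruder's
  -- block is used up. At least `p + 1` fits because the tail is nonempty.
  obtain ⟨t, ht1, ht2, ht3, ht4⟩ : ∃ t, p + 2 ≤ t ∧ t ≤ z ∧ A₁.card + m t ≤ C ∧
      (t = z ∨ A₁.card + m t = C) := by
    have key : ∀ e, p + 2 + e ≤ z → ∃ t, p + 2 ≤ t ∧ t ≤ z ∧ A₁.card + m t ≤ C ∧
        (t = p + 2 + e ∨ A₁.card + m t = C) := by
      intro e
      induction e with
      | zero =>
        intro he
        refine ⟨p + 2, le_rfl, he, ?_, Or.inl rfl⟩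
        have : m (p + 2) ≤ 1 := by
          refine le_trans (Finset.card_filter_le _ _) ?_
          simp
        omega
      | succ e ih =>
        intro he
        obtain ⟨t, h1, h2, h3, h4⟩ := ih (by omega)
        by_cases h5 : A₁.card + m t = C
        · exact ⟨t, h1, h2, h3, Or.inr h5⟩
        · have h6 : t = p + 2 + e := by omega
          refine ⟨p + 2 + (e + 1), by omega, he, ?_, Or.inl rfl⟩
          have h7 : m (t + 1) ≤ m t + 1 := by
            simp only [hmdef]
            rw [← Finset.insert_Ico_right_eq_Ico_add_one (by omega : p + 1 ≤ t)]
            rw [Finset.filter_insert]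
            split_ifs
            · exact Finset.card_insert_le _ _
            · omega
          subst h6
          have : p + 2 + e + 1 = p + 2 + (e + 1) := by ring
          rw [this] at h7
          omega
    obtain ⟨t, h1, h2, h3, h4⟩ := key (z - (p + 2)) (by omega)
    exact ⟨t, h1, h2, h3, by omega⟩
  set Bt := (Finset.Ico t z).filter (fun x => χ x = χ (p + 1)) with hBt
  have hB : m t + Bt.card ≤ C := by
    simp only [hmdef]
    rw [← Finset.card_union_of_disjoint]
    · refine le_trans (Finset.card_le_card ?_) (h.card_le (χ (p + 1)) (β (p + 1)))
      intro x
      simp only [hBt, Finset.mem_union, Finset.mem_filter, Finset.mem_range, Finset.mem_Ico]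
      grind
    · rw [Finset.disjoint_left]
      intro x
      simp only [hBt, Finset.mem_filter, Finset.mem_Ico]
      omega
  -- The rest of the intruder's block must absorb the tail. If the head was filled up, then `A₂.card
  -- ≤ C - A₁.card = m t`, and `m t + Bt.card ≤ C`.
  have hBA : Bt.card + A₂.card ≤ C := by
    rcases ht4 with h1 | h1
    · have : Bt.card = 0 := by simp [hBt, h1]
      omega
    · omega
  -- From `z` on the names are shifted along with the colors, so that the tail continues under the
  -- name `β (p + 1)` and the later blocks of the intruder's color follow `β p`. Names are integers
  -- because the shift may be negative.
  refine ⟨fun x => if x ≤ p then χ x else if x < z then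
      (if x < t ∧ χ x = χ (p + 1) then χ p else χ x) else
      (if χ x = χ p then χ (p + 1) else if χ x = χ (p + 1) then χ p else χ x),
    fun x => if x ≤ p then β x else if x < z then
      (if x < t ∧ χ x = χ (p + 1) then β p else β x) else
      (if χ x = χ p then β x + (β (p + 1) - β p) else if χ x = χ (p + 1) then
        β x + (β p - β (p + 1)) else β x), ⟨?_, ?_, ?_⟩, ?_⟩
  · intro x y hxy hy
    have := hm x y hxy hy
    have := hm x p
    have := hm z y
    have := hm (p + 1) y
    have := hm x (p + 1)
    have := hfar x
    have := hfar y
    have := hfirst x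
    have := hne x
    have := hne y
    grind
  · intro x y hxy hy
    have := hs x y hxy hy
    have := hs x p
    have := hs x (p + 1)
    have := hs (p + 1) y
    have := hs z y
    have := hfar x
    have := hfar y
    have := hfirst x
    have := hne x
    have := hne y
    have := hend y
    have h1 : x ≤ p + 1 → nb x ≤ nb (p + 1) := fun h => hnb h
    have h2 : x ≤ z → nb x ≤ nb z := fun h => hnb h
    grind
  · intro c k
    by_cases hcp : c = χ p
    · subst hcp
      -- Below `β p` the blocks are old ones of this color, `β p` names the enlarged head, and above
      -- it come shifted blocks of the intruder's color.
      rcases lt_trichotomy k (β p) with hk | hk | hk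
      · refine le_trans (Finset.card_le_card ?_) (h.card_le (χ p) k)
        intro x
        simp only [Finset.mem_filter, Finset.mem_range]
        have := hm (p + 1) x
        have := hne x
        grind
      · refine le_trans (le_trans (Finset.card_le_card ?_) (Finset.card_union_le A₁
          ((Finset.Ico (p + 1) t).filter (fun x => χ x = χ (p + 1))))) ht3
        intro x
        simp only [hA₁, Finset.mem_union, Finset.mem_filter, Finset.mem_range, Finset.mem_Ico]
        have := hne x
        have := hend x
        grind
      · refine le_trans (Finset.card_le_card ?_) (h.card_le (χ (p + 1)) (k + (β (p + 1) - β p)))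
        intro x
        simp only [Finset.mem_filter, Finset.mem_range]
        have := hm x p
        have := hne x
        grind
    by_cases hcq : c = χ (p + 1)
    · subst hcq
      rcases lt_trichotomy k (β (p + 1)) with hk | hk | hk
      · refine le_trans (Finset.card_le_card ?_) (h.card_le (χ (p + 1)) k)
        intro x
        simp only [Finset.mem_filter, Finset.mem_range]
        have := hm z x
        grind
      · refine le_trans (le_trans (Finset.card_le_card ?_) (Finset.card_union_le Bt A₂)) hBA
        intro x
        simp only [hBt, hA₂, Finset.mem_union, Finset.mem_filter, Finset.mem_range, Finset.mem_Ico]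
        have := hfirst x
        have := hne x
        grind
      · refine le_trans (Finset.card_le_card ?_) (h.card_le (χ p) (k - (β (p + 1) - β p)))
        intro x
        simp only [Finset.mem_filter, Finset.mem_range]
        have := hfirst x
        have := hfar x
        have := hne x
        grind
    · refine le_trans (Finset.card_le_card ?_) (h.card_le c k)
      intro x
      simp only [Finset.mem_filter, Finset.mem_range]
      grind
  · intro x y v hxy hyv hv hyp
    have := hp x y v
    have := hp x y p
    have := hp x p v
    have := hm x p
    have := hm z v
    have := hm (p + 1) v
    have := hfirst x
    have := hne v
    have := hend v
    have := hfar v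
    grind

/-- If the block of `p` resumes at a first later position `z` after an intruder `p + 1`, there are
three repairs. Either no conflict crosses the gap and the block can be cut, or `z` and `p + 1`
conflict-wise belong together, and then it matters whether the intruder's block continues beyond `z`
(swap two positions) or not (swap two colors). -/
theorem BlockColoring.exists_contiguousBelow_succ (hnb : Monotone nb)
    (h : BlockColoring N C nb χ β) {p : ℕ} (hp : ContiguousBelow N (p + 1) χ β) :
    ∃ (χ' : ℕ → ι) (β' : ℕ → ℤ), BlockColoring N C nb χ' β' ∧ ContiguousBelow N (p + 2) χ' β' := by
  by_cases hz : ∃ z, p + 1 < z ∧ z < N ∧ χ p = χ z ∧ β p = β z ∧ χ (p + 1) ≠ χ p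
  swap
  · refine ⟨χ, β, h, ?_⟩
    intro x y v hxy hyv hv hyp hc hb
    by_cases hy : y < p + 1
    · exact hp x y v hxy hyv hv hy hc hb
    · have hy' : y = p + 1 := by omega
      subst hy'
      have h1 : χ p = χ v ∧ β p = β v := by
        rcases Nat.lt_or_ge x p with h' | h'
        · have := hp x p v h' (by omega) hv (by omega) hc hb
          grind
        · have : x = p := by omega
          grind
      have h2 : χ (p + 1) = χ p := by
        by_contra h2
        exact hz ⟨v, hyv, hv, h1.1, h1.2, h2⟩
      have := h.mono p (p + 1)
      have := h.mono (p + 1) v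
      grind
  · obtain ⟨hz1, hzN, hzc, hzb, hne1⟩ := Nat.find_spec hz
    have hmin := fun x (hx : x < Nat.find hz) => Nat.find_min hz hx
    set z := Nat.find hz
    have hne : ∀ x, p < x → x < z → χ x ≠ χ p := by
      intro x h1 h2 h3
      rcases Nat.lt_or_ge (p + 1) x with h4 | h4
      · have := h.mono p x h1 (by omega) h3.symm
        have := h.mono x z h2 hzN (h3.trans hzc)
        exact hmin x h2 ⟨h4, by omega, h3.symm, by omega, hne1⟩
      · have : x = p + 1 := by omega
        subst this
        exact hne1 h3
    by_cases hsep : nb p ≤ z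
    · obtain ⟨β', h1, h2⟩ := h.split_block hnb hp hz1 hzN hzc hzb hne hsep
      exact ⟨χ, β', h1, h2⟩
    · by_cases hw : ∃ w, z < w ∧ w < N ∧ χ w = χ (p + 1) ∧ β w = β (p + 1)
      · obtain ⟨w, h1, h2, h3, h4⟩ := hw
        exact h.swap_positions hnb hp hz1 hzc hzb hne h1 h2 h3 h4
      · refine h.swap_colors hnb hp hz1 hzN hzc hzb hne (by omega) ?_
        intro w h1 h2 h3 h4
        exact hw ⟨w, h1, h2, h3, h4⟩

/-- All blocks can be made intervals. -/
theorem BlockColoring.exists_contiguous (hnb : Monotone nb) (h : BlockColoring N C nb χ β)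
    (p : ℕ) :
    ∃ (χ' : ℕ → ι) (β' : ℕ → ℤ), BlockColoring N C nb χ' β' ∧ ContiguousBelow N (p + 1) χ' β' := by
  induction p with
  | zero => exact ⟨χ, β, h, fun x y z hxy _ _ hy => by omega⟩
  | succ p ih =>
    obtain ⟨χ', β', h1, h2⟩ := ih
    exact h1.exists_contiguousBelow_succ hnb h2

end Exchange
-- Interval blocks and sequences of cuts
/-- `c` cuts the positions `0, …, N - 1` into blocks of at most `C` positions so that a block never
conflicts with the block that comes `d + 1` blocks later. -/
structure IsCutSequence (N C d : ℕ) (nb : ℕ → ℕ) (c : ℕ → ℕ) : Prop where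
  zero : c 0 = 0
  le : ∀ k, c k ≤ N
  mono : Monotone c
  succ_le : ∀ k, c (k + 1) ≤ c k + C
  reach : ∃ m, c m = N
  sep : ∀ j, 0 < c j → nb (c j - 1) ≤ c (j + d)

open Classical in
/-- The first position after `x` at which the block changes, `N` if there is none. -/
noncomputable def nextCut {ι : Type*} (N : ℕ) (χ : ℕ → ι) (β : ℕ → ℤ) (x : ℕ) : ℕ :=
  if h : ∃ y, x < y ∧ y < N ∧ ¬ (χ (y - 1) = χ y ∧ β (y - 1) = β y) then Nat.find h else N

section Cuts

variable {ι : Type*} {N : ℕ} {χ : ℕ → ι} {β : ℕ → ℤ}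

theorem nextCut_le (x : ℕ) : nextCut N χ β x ≤ N := by
  classical
  unfold nextCut
  split_ifs with h
  · exact (Nat.find_spec h).2.1.le
  · exact le_rfl

theorem lt_nextCut {x : ℕ} (hx : x < N) : x < nextCut N χ β x := by
  classical
  unfold nextCut
  split_ifs with h
  · exact (Nat.find_spec h).1
  · exact hx

theorem nextCut_spec {x : ℕ} (hx : nextCut N χ β x < N) :
    ¬ (χ (nextCut N χ β x - 1) = χ (nextCut N χ β x) ∧
      β (nextCut N χ β x - 1) = β (nextCut N χ β x)) := by
  classical
  unfold nextCut at hx ⊢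
  split_ifs at hx ⊢ with h
  · exact (Nat.find_spec h).2.2
  · omega

theorem eq_of_lt_nextCut {x y : ℕ} (hxy : x ≤ y) (hy : y < nextCut N χ β x) :
    χ y = χ x ∧ β y = β x := by
  classical
  have hN := nextCut_le (N := N) (χ := χ) (β := β) x
  induction y, hxy using Nat.le_induction with
  | base => exact ⟨rfl, rfl⟩
  | succ y hxy ih =>
    have h1 := ih (by omega)
    by_contra h2
    have h3 : ∃ y, x < y ∧ y < N ∧ ¬ (χ (y - 1) = χ y ∧ β (y - 1) = β y) := by
      refine ⟨y + 1, by omega, by omega, ?_⟩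
      rw [Nat.add_sub_cancel]
      grind
    have h4 : nextCut N χ β x ≤ y + 1 := by
      unfold nextCut
      rw [dif_pos h3]
      refine Nat.find_min' h3 ⟨by omega, by omega, ?_⟩
      rw [Nat.add_sub_cancel]
      grind
    omega

theorem nextCut_of_ge {x : ℕ} (hx : N ≤ x) : nextCut N χ β x = N := by
  unfold nextCut
  rw [dif_neg]
  rintro ⟨y, h1, h2, -⟩
  omega

end Cuts

/-- Cut wherever the interval block changes. If `nb (c j - 1)` exceeded `c (j + (l - 1))`, the
positions `c j - 1, c j, ..., c (j + (l - 1))` would be `l + 1` pairwise conflicting positions in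
different blocks, one too many for `l` colors. -/
theorem BlockColoring.exists_isCutSequence {N C l : ℕ} {nb : ℕ → ℕ} {χ : ℕ → Fin l}
    {β : ℕ → ℤ} (hnb : Monotone nb) (hN : ∀ x < N, nb x ≤ N)
    (h : BlockColoring N C nb χ β) : ∃ c, IsCutSequence N C (l - 1) nb c := by
  obtain ⟨χ, β, h, hc⟩ := h.exists_contiguous hnb N
  have hl : 0 < l := (χ 0).pos
  let c : ℕ → ℕ := fun k => (nextCut N χ β)^[k] 0
  have c_succ : ∀ k, c (k + 1) = nextCut N χ β (c k) := fun k =>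
    Function.iterate_succ_apply' _ _ _
  have c_le : ∀ k, c k ≤ N := by
    intro k
    cases k with
    | zero => exact Nat.zero_le _
    | succ k => rw [c_succ]; exact nextCut_le _
  have c_lt : ∀ k, c k < N → c k < c (k + 1) := by
    intro k hk
    rw [c_succ]
    exact lt_nextCut hk
  have c_mono : Monotone c := by
    refine monotone_nat_of_le_succ fun k => ?_
    rcases (c_le k).lt_or_eq with h1 | h1
    · exact (c_lt k h1).le
    · rw [c_succ, h1, nextCut_of_ge le_rfl]
  -- Each cut before `N` advances by at least one, so `N` is reached after `N` cuts; afterwards the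
  -- sequence is constant.
  have c_ge : ∀ k, min k N ≤ c k := by
    intro k
    induction k with
    | zero => simp
    | succ k ih =>
      rcases (c_le k).lt_or_eq with h1 | h1
      · have := c_lt k h1
        omega
      · have := c_mono (Nat.le_succ k)
        simp only [Nat.succ_eq_add_one] at this
        omega
  refine ⟨c, rfl, c_le, c_mono, ?_, ⟨N, le_antisymm (c_le N) (by simpa using c_ge N)⟩, ?_⟩
  · intro k
    have h1 : Finset.Ico (c k) (c (k + 1)) ⊆
        (Finset.range N).filter (fun x => χ x = χ (c k) ∧ β x = β (c k)) := by
      intro x hx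
      rw [Finset.mem_Ico] at hx
      rw [Finset.mem_filter, Finset.mem_range]
      exact ⟨lt_of_lt_of_le hx.2 (c_le _), eq_of_lt_nextCut hx.1 (by rw [← c_succ]; exact hx.2)⟩
    have h2 := (Finset.card_le_card h1).trans (h.card_le _ _)
    rw [Nat.card_Ico] at h2
    omega
  · intro j hj
    by_contra! hlt
    have hNj : nb (c j - 1) ≤ N := hN _ (by have := c_le j; omega)
    let f : Fin (l + 1) → ℕ := fun s => if (s : ℕ) = 0 then c j - 1 else c (j + (s - 1))
    have f_lt : ∀ s, f s < nb (c j - 1) := by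
      intro s
      have h0 : c j ≤ c (j + (l - 1)) := c_mono (by omega)
      simp only [f]
      split_ifs with hs
      · omega
      · have : c (j + ((s : ℕ) - 1)) ≤ c (j + (l - 1)) := c_mono (by omega)
        omega
    have f_ge : ∀ s, c j - 1 ≤ f s := by
      intro s
      simp only [f]
      split_ifs with hs
      · omega
      · have : c j ≤ c (j + ((s : ℕ) - 1)) := c_mono (by omega)
        omega
    have f_cut : ∀ s : Fin (l + 1), 0 < (s : ℕ) →
        ¬ (χ (f s - 1) = χ (f s) ∧ β (f s - 1) = β (f s)) := by
      intro s hs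
      have h1 := f_lt s
      have h2 : 0 < f s := by
        simp only [f, if_neg hs.ne']
        exact lt_of_lt_of_le hj (c_mono (by omega))
      simp only [f, if_neg hs.ne'] at h1 h2 ⊢
      obtain ⟨k, hk⟩ : ∃ k, j + ((s : ℕ) - 1) = k + 1 := by
        refine Nat.exists_eq_succ_of_ne_zero fun h0 => ?_
        rw [h0] at h2
        exact absurd h2 (lt_irrefl _)
      rw [hk, c_succ] at h1 ⊢
      exact nextCut_spec (by omega)
    have f_mono : ∀ s t : Fin (l + 1), s < t → f s < f t := by
      intro s t hst
      have ht : ¬ (t : ℕ) = 0 := by have : (s : ℕ) < t := hst; omega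
      have h1 := f_lt t
      simp only [f, if_neg ht] at h1 ⊢
      split_ifs with hs
      · have : c j ≤ c (j + ((t : ℕ) - 1)) := c_mono (by omega)
        omega
      · have hst' : (s : ℕ) < t := hst
        have h2 : c (j + ((s : ℕ) - 1)) ≤ c (j + ((t : ℕ) - 1)) := c_mono (by omega)
        have h3 := c_lt (j + ((s : ℕ) - 1)) (by omega)
        have h4 : c (j + ((s : ℕ) - 1) + 1) ≤ c (j + ((t : ℕ) - 1)) := c_mono (by omega)
        omega
    obtain ⟨s, t, hst, hχ⟩ := Fintype.exists_ne_map_eq_of_card_lt (fun s => χ (f s)) (by simp)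
    wlog hlt' : s < t generalizing s t
    · exact this t s hst.symm hχ.symm (lt_of_le_of_ne (not_lt.mp hlt') hst.symm)
    have h1 := f_mono s t hlt'
    have h2 := f_lt t
    have h3 := hnb (f_ge s)
    have h4 := f_cut t (lt_of_le_of_lt (Nat.zero_le _) hlt')
    have h5 : β (f s) = β (f t) := by
      by_contra h5
      have := h.sep (f s) (f t) h1 (by omega) hχ h5
      omega
    -- The two positions share color and block name, so by contiguity the block also contains `f t -
    -- 1`. This contradicts the block change at `f t`.
    rcases Nat.lt_or_ge (f s) (f t - 1) with h6 | h6
    · have := hc (f s) (f t - 1) (f t) h6 (by omega) (by omega) (by omega) hχ h5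
      exact h4 ⟨this.1.trans hχ, this.2.trans h5⟩
    · have h7 : f t - 1 = f s := by omega
      rw [h7] at h4
      exact h4 ⟨hχ, h5⟩

/-! ## The order of the intervals -/

section Order

variable {n : ℕ}

/-- The order of the left endpoints, ties being broken by the numbering. -/
def Before (lft : Fin n → ℝ) (u v : Fin n) : Prop :=
  lft u < lft v ∨ (lft u = lft v ∧ u < v)

theorem Before.trans {lft : Fin n → ℝ} {u v w : Fin n} (h₁ : Before lft u v)
    (h₂ : Before lft v w) : Before lft u w := by
  unfold Before at *
  rcases h₁ with h₁ | h₁ <;> rcases h₂ with h₂ | h₂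
  · exact Or.inl (h₁.trans h₂)
  · exact Or.inl (h₂.1 ▸ h₁)
  · exact Or.inl (h₁.1 ▸ h₂)
  · exact Or.inr ⟨h₁.1.trans h₂.1, h₁.2.trans h₂.2⟩

theorem Before.irrefl (lft : Fin n → ℝ) (u : Fin n) : ¬ Before lft u u := by
  simp [Before]

theorem before_or_before (lft : Fin n → ℝ) {u v : Fin n} (h : u ≠ v) :
    Before lft u v ∨ Before lft v u := by
  unfold Before
  rcases lt_trichotomy (lft u) (lft v) with h1 | h1 | h1
  · exact Or.inl (Or.inl h1)
  · rcases lt_or_gt_of_ne h with h2 | h2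
    · exact Or.inl (Or.inr ⟨h1, h2⟩)
    · exact Or.inr (Or.inr ⟨h1.symm, h2⟩)
  · exact Or.inr (Or.inl h1)

theorem Before.le {lft : Fin n → ℝ} {u v : Fin n} (h : Before lft u v) : lft u ≤ lft v :=
  h.elim le_of_lt (fun h => h.1.le)

open Classical in
/-- The number of vertices before `v`. -/
noncomputable def rankNat (lft : Fin n → ℝ) (v : Fin n) : ℕ :=
  (Finset.univ.filter (fun u => Before lft u v)).card

theorem rankNat_lt_of_before {lft : Fin n → ℝ} {u v : Fin n} (h : Before lft u v) :
    rankNat lft u < rankNat lft v := by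
  classical
  refine Finset.card_lt_card ((Finset.ssubset_iff_of_subset ?_).mpr ⟨u, ?_, ?_⟩)
  · intro w
    simp only [Finset.mem_filter, Finset.mem_univ, true_and]
    exact fun hw => hw.trans h
  · simpa using h
  · simpa using Before.irrefl lft u

theorem rankNat_lt (lft : Fin n → ℝ) (v : Fin n) : rankNat lft v < n := by
  classical
  have h : (Finset.univ.filter (fun u => Before lft u v)).card < (Finset.univ : Finset (Fin n)).card :=
    Finset.card_lt_card ((Finset.ssubset_iff_of_subset (Finset.filter_subset _ _)).mpr
      ⟨v, Finset.mem_univ v, by simpa using Before.irrefl lft v⟩)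
  rw [Finset.card_fin] at h
  unfold rankNat
  convert h

theorem rankNat_lt_iff {lft : Fin n → ℝ} {u v : Fin n} :
    rankNat lft u < rankNat lft v ↔ Before lft u v := by
  refine ⟨fun h => ?_, rankNat_lt_of_before⟩
  have hne : u ≠ v := by rintro rfl; exact lt_irrefl _ h
  refine (before_or_before lft hne).resolve_right fun h' => ?_
  exact absurd (rankNat_lt_of_before h') (by omega)

theorem rankNat_injective (lft : Fin n → ℝ) : Function.Injective (rankNat lft) := by
  intro u v h
  by_contra hne
  rcases before_or_before lft hne with h1 | h1 <;> have := rankNat_lt_of_before h1 <;> omega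

/-- The position of a vertex in the order of the intervals. -/
noncomputable def rank (lft : Fin n → ℝ) : Fin n ≃ Fin n :=
  Equiv.ofBijective (fun v => ⟨rankNat lft v, rankNat_lt lft v⟩)
    (Finite.injective_iff_bijective.mp fun _ _ h =>
      rankNat_injective lft (congrArg Fin.val h))

@[simp]
theorem coe_rank (lft : Fin n → ℝ) (v : Fin n) : (rank lft v : ℕ) = rankNat lft v := rfl

theorem rankNat_rank_symm (lft : Fin n → ℝ) (r : Fin n) :
    rankNat lft ((rank lft).symm r) = r := by
  rw [← coe_rank, Equiv.apply_symm_apply]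

theorem le_of_rankNat_le {lft : Fin n → ℝ} {u v : Fin n} (h : rankNat lft u ≤ rankNat lft v) :
    lft u ≤ lft v := by
  rcases h.lt_or_eq with h1 | h1
  · exact (rankNat_lt_iff.mp h1).le
  · rw [rankNat_injective lft h1]

theorem rankNat_lt_of_lt {lft : Fin n → ℝ} {u v : Fin n} (h : lft u < lft v) :
    rankNat lft u < rankNat lft v := rankNat_lt_iff.mpr (Or.inl h)

end Order

section Rep

variable {V : Type*} {G : SimpleGraph V} {lft rgt : V → ℝ}

/-- The one place where properness of the representation enters: left and right endpoints are
ordered alike. -/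
theorem IsProperIntervalRep.rgt_le_rgt (h : IsProperIntervalRep G lft rgt) {u v : V}
    (huv : lft u ≤ lft v) : rgt u ≤ rgt v := by
  by_contra! hlt
  refine h.proper v u ⟨Set.Icc_subset_Icc huv hlt.le, fun hsub => ?_⟩
  have := (hsub (Set.right_mem_Icc.mpr (h.le u))).2
  exact absurd this (not_le.mpr hlt)

theorem IsProperIntervalRep.adj_iff_of_le (h : IsProperIntervalRep G lft rgt) {u v : V}
    (huv : lft u ≤ lft v) (hne : u ≠ v) : G.Adj u v ↔ lft v ≤ rgt u := by
  rw [h.adj_iff, Set.Icc_inter_Icc, Set.nonempty_Icc]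
  simp only [le_inf_iff, sup_le_iff]
  have := h.le u
  have := h.le v
  constructor
  · rintro ⟨-, h1, -⟩
    exact h1.2
  · intro h1
    exact ⟨hne, ⟨h.le u, h1⟩, huv.trans (h.le v), h.le v⟩

end Rep

/-! ## Positions: every vertex occupies as many consecutive positions as its weight says -/

section Layout

variable {n : ℕ}

/-- The total weight of the first `r` vertices. -/
noncomputable def prefixWeight (lft : Fin n → ℝ) (W : Fin n → ℕ) (r : ℕ) : ℕ :=
  ∑ v with rankNat lft v < r, W v

open Classical in
/-- The total weight of the vertices that begin before the end of the vertex of rank `r`. -/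
noncomputable def reachWeight (lft rgt : Fin n → ℝ) (W : Fin n → ℕ) (r : ℕ) : ℕ :=
  if h : r < n then ∑ u with lft u ≤ rgt ((rank lft).symm ⟨r, h⟩), W u else ∑ u, W u

/-- The rank of the vertex that occupies position `x`. -/
def segment (n : ℕ) (P : ℕ → ℕ) (x : ℕ) : ℕ :=
  ((Finset.range n).filter (fun r => P (r + 1) ≤ x)).card

theorem segment_eq {P : ℕ → ℕ} (hP : Monotone P) {r x : ℕ} (hr : r < n) (h₁ : P r ≤ x)
    (h₂ : x < P (r + 1)) : segment n P x = r := by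
  have : (Finset.range n).filter (fun r => P (r + 1) ≤ x) = Finset.range r := by
    ext s
    simp only [Finset.mem_filter, Finset.mem_range]
    constructor
    · rintro ⟨-, h⟩
      by_contra! hrs
      have := hP (show r + 1 ≤ s + 1 by omega)
      omega
    · intro h
      have := hP (show s + 1 ≤ r by omega)
      omega
  rw [segment, this, Finset.card_range]

theorem segment_mono (n : ℕ) (P : ℕ → ℕ) : Monotone (segment n P) := by
  intro x y hxy
  refine Finset.card_le_card fun r => ?_
  simp only [Finset.mem_filter]
  exact fun h => ⟨h.1, h.2.trans hxy⟩

theorem le_segment {P : ℕ → ℕ} (hP : Monotone P) {r x : ℕ} (hr : r ≤ n) (h : P r ≤ x) :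
    r ≤ segment n P x := by
  have : Finset.range r ⊆ (Finset.range n).filter (fun r => P (r + 1) ≤ x) := by
    intro s
    simp only [Finset.mem_filter, Finset.mem_range]
    intro hs
    have := hP (show s + 1 ≤ r by omega)
    omega
  simpa [segment] using Finset.card_le_card this

variable (lft rgt : Fin n → ℝ) (W : Fin n → ℕ)

theorem prefixWeight_mono : Monotone (prefixWeight lft W) := by
  intro r s hrs
  refine Finset.sum_le_sum_of_subset fun v => ?_
  simp only [Finset.mem_filter]
  exact fun h => ⟨h.1, h.2.trans_le hrs⟩

@[simp]
theorem prefixWeight_zero : prefixWeight lft W 0 = 0 := by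
  simp [prefixWeight]

theorem prefixWeight_of_ge {r : ℕ} (hr : n ≤ r) : prefixWeight lft W r = ∑ v, W v := by
  unfold prefixWeight
  rw [Finset.filter_true_of_mem]
  exact fun v _ => (rankNat_lt lft v).trans_le hr

theorem prefixWeight_le (r : ℕ) : prefixWeight lft W r ≤ ∑ v, W v :=
  Finset.sum_le_sum_of_subset (Finset.filter_subset _ _)

theorem prefixWeight_succ (v : Fin n) :
    prefixWeight lft W (rankNat lft v + 1) = prefixWeight lft W (rankNat lft v) + W v := by
  unfold prefixWeight
  have : (Finset.univ.filter fun u => rankNat lft u < rankNat lft v + 1) =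
      insert v (Finset.univ.filter fun u => rankNat lft u < rankNat lft v) := by
    ext u
    simp only [Finset.mem_filter, Finset.mem_univ, true_and, Finset.mem_insert]
    rw [Nat.lt_succ_iff_lt_or_eq, or_comm, (rankNat_injective lft).eq_iff]
  rw [this, Finset.sum_insert (by simp), add_comm]

theorem reachWeight_le (r : ℕ) : reachWeight lft rgt W r ≤ ∑ v, W v := by
  unfold reachWeight
  split_ifs
  · exact Finset.sum_le_sum_of_subset (Finset.filter_subset _ _)
  · exact le_rfl

theorem reachWeight_rankNat (v : Fin n) : reachWeight lft rgt W (rankNat lft v) =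
    ∑ u with lft u ≤ rgt v, W u := by
  classical
  unfold reachWeight
  rw [dif_pos (rankNat_lt lft v)]
  have : (rank lft).symm ⟨rankNat lft v, rankNat_lt lft v⟩ = v := by
    rw [Equiv.symm_apply_eq]; rfl
  rw [this]

variable {lft rgt} {G : SimpleGraph (Fin n)} (hrep : IsProperIntervalRep G lft rgt)

include hrep in
theorem reachWeight_mono : Monotone (reachWeight lft rgt W) := by
  intro r s hrs
  by_cases hs : s < n
  · have hr : r < n := hrs.trans_lt hs
    have hle : lft ((rank lft).symm ⟨r, hr⟩) ≤ lft ((rank lft).symm ⟨s, hs⟩) :=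
      le_of_rankNat_le (by rw [rankNat_rank_symm, rankNat_rank_symm]; exact hrs)
    have := hrep.rgt_le_rgt hle
    unfold reachWeight
    rw [dif_pos hr, dif_pos hs]
    refine Finset.sum_le_sum_of_subset fun u => ?_
    simp only [Finset.mem_filter]
    exact fun h => ⟨h.1, h.2.trans this⟩
  · refine (reachWeight_le lft rgt W r).trans ?_
    unfold reachWeight
    rw [dif_neg hs]

include hrep in
theorem prefixWeight_succ_le_reachWeight {r : ℕ} (hr : r < n) :
    prefixWeight lft W (r + 1) ≤ reachWeight lft rgt W r := by
  unfold prefixWeight reachWeight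
  rw [dif_pos hr]
  refine Finset.sum_le_sum_of_subset fun u => ?_
  simp only [Finset.mem_filter, Finset.mem_univ, true_and]
  intro h
  refine le_trans (le_of_rankNat_le ?_) (hrep.le _)
  rw [rankNat_rank_symm]
  exact Nat.lt_succ_iff.mp h

/-- The vertices of ranks `r < s` are adjacent if the latter lies before the reach of the former. -/
theorem prefixWeight_succ_le_of_adj {u v : Fin n} (h : lft v ≤ rgt u) :
    prefixWeight lft W (rankNat lft v + 1) ≤ reachWeight lft rgt W (rankNat lft u) := by
  rw [reachWeight_rankNat]
  refine Finset.sum_le_sum_of_subset fun w => ?_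
  simp only [Finset.mem_filter, Finset.mem_univ, true_and]
  exact fun hw => (le_of_rankNat_le (Nat.lt_succ_iff.mp hw)).trans h

theorem reachWeight_le_of_not_adj {u v : Fin n} (h : ¬ lft v ≤ rgt u) :
    reachWeight lft rgt W (rankNat lft u) ≤ prefixWeight lft W (rankNat lft v) := by
  rw [reachWeight_rankNat]
  refine Finset.sum_le_sum_of_subset fun w => ?_
  simp only [Finset.mem_filter, Finset.mem_univ, true_and]
  exact fun hw => rankNat_lt_of_lt (hw.trans_lt (not_le.mp h))

end Layout

/-- The first position that does not conflict with position `x`. -/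
noncomputable def conflictEnd {n : ℕ} (lft rgt : Fin n → ℝ) (W : Fin n → ℕ) (x : ℕ) : ℕ :=
  reachWeight lft rgt W (segment n (prefixWeight lft W) x)

theorem conflictEnd_mono {n : ℕ} {lft rgt : Fin n → ℝ} (W : Fin n → ℕ) {G : SimpleGraph (Fin n)}
    (hrep : IsProperIntervalRep G lft rgt) : Monotone (conflictEnd lft rgt W) :=
  (reachWeight_mono W hrep).comp (segment_mono _ _)

/-! ### From split colorings to block colorings -/

/-- In a block coloring the positions of a clique take few positions of every color. -/
theorem BlockColoring.card_clique_le {N C l : ℕ} {nb : ℕ → ℕ} {χ : ℕ → Fin l} {β : ℕ → ℤ}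
    (h : BlockColoring N C nb χ β) {p q : ℕ} (hq : q ≤ N) (hclique : ∀ x, p ≤ x → q ≤ nb x) :
    q - p ≤ l * C := by
  have h1 : (Finset.Ico p q).card = ∑ a : Fin l, ((Finset.Ico p q).filter (fun x => χ x = a)).card :=
    Finset.card_eq_sum_card_fiberwise fun x _ => Finset.mem_univ (χ x)
  rw [Nat.card_Ico] at h1
  rw [h1]
  refine (Finset.sum_le_card_nsmul _ _ C fun a _ => ?_).trans (by simp)
  rcases ((Finset.Ico p q).filter (fun x => χ x = a)).eq_empty_or_nonempty with h2 | ⟨x, hx⟩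
  · simp [h2]
  · refine le_trans (Finset.card_le_card ?_) (h.card_le a (β x))
    intro y hy
    simp only [Finset.mem_filter, Finset.mem_Ico, Finset.mem_range] at hx hy ⊢
    refine ⟨by omega, hy.2, ?_⟩
    have := h.sep x y
    have := h.sep y x
    have := hclique x
    have := hclique y
    grind

/-- A coloring yields a block coloring if the positions joined by monochromatic chains of
conflicts, as recorded by `κ`, form sets of at most `C` positions. -/
theorem BlockColoring.exists_of_components {ι γ : Type*} [DecidableEq ι] [DecidableEq γ] {N C : ℕ}
    {nb : ℕ → ℕ} (hnb : Monotone nb) {χ : ℕ → ι} (κ : ℕ → γ)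
    (hκ : ∀ s t, s < t → t < N → χ s = χ t → t < nb s → κ s = κ t)
    (hC : ∀ a g, ((Finset.range N).filter (fun x => χ x = a ∧ κ x = g)).card ≤ C) :
    ∃ β, BlockColoring N C nb χ β := by
  classical
  -- `S a y` collects the positions up to `y` of color `a` that conflict with no earlier position of
  -- this color. They open the blocks, and their number serves as block name.
  let S : ι → ℕ → Finset ℕ := fun a y => (Finset.range (y + 1)).filter
    (fun t => χ t = a ∧ ∀ s < t, χ s = a → nb s ≤ t)
  have hS : ∀ a x y, x ≤ y → S a x ⊆ S a y := by
    intro a x y hxy t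
    simp only [S, Finset.mem_filter, Finset.mem_range]
    exact fun h => ⟨by omega, h.2⟩
  -- Equal names mean that no block opens after `x` up to `y`, so `y` conflicts with an earlier `t`
  -- of its color. If `t` lies after `x`, recurse to `t`; otherwise monotonicity of `nb` makes `x`
  -- itself conflict with `y`.
  have hkey : ∀ y, y < N → ∀ x, x < y → χ x = χ y → (S (χ x) x).card = (S (χ y) y).card →
      κ x = κ y := by
    intro y
    induction y using Nat.strong_induction_on with
    | _ y ih =>
      intro hy x hxy hc hcard
      rw [hc] at hcard
      have heq := Finset.eq_of_subset_of_card_le (hS (χ y) x y hxy.le) hcard.ge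
      have hyS : y ∉ S (χ y) y := by
        rw [← heq]
        simp only [S, Finset.mem_filter, Finset.mem_range]
        omega
      simp only [S, Finset.mem_filter, Finset.mem_range, true_and, not_and, not_forall,
        not_le] at hyS
      obtain ⟨t, ht, htc, htn⟩ := hyS (by omega)
      rcases Nat.lt_or_ge x t with h1 | h1
      · refine (ih t ht (by omega) x h1 (hc.trans htc.symm) ?_).trans (hκ t y ht hy htc htn)
        rw [hc, htc]
        refine le_antisymm (Finset.card_le_card (hS _ _ _ h1.le)) ?_
        rw [hcard]
        exact Finset.card_le_card (hS _ _ _ ht.le)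
      · exact hκ x y hxy hy hc (htn.trans_le (hnb h1))
  refine ⟨fun y => ((S (χ y) y).card : ℤ), ?_, ?_, ?_⟩
  · intro x y hxy _ hc
    simp only [hc]
    exact_mod_cast Finset.card_le_card (hS _ _ _ hxy.le)
  · intro x y hxy _ hc hne
    by_contra! hlt
    refine hne ?_
    simp only [hc]
    congr 2
    refine Finset.Subset.antisymm (hS _ _ _ hxy.le) fun t => ?_
    simp only [S, Finset.mem_filter, Finset.mem_range]
    rintro ⟨h1, h2, h3⟩
    refine ⟨?_, h2, h3⟩
    by_contra! h4
    have := h3 x (by omega) hc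
    omega
  · intro a k
    rcases ((Finset.range N).filter
      (fun x => χ x = a ∧ ((S (χ x) x).card : ℤ) = k)).eq_empty_or_nonempty with h2 | ⟨x, hx⟩
    · rw [h2]; simp
    · refine le_trans (Finset.card_le_card ?_) (hC a (κ x))
      intro y hy
      simp only [Finset.mem_filter, Finset.mem_range] at hx hy ⊢
      refine ⟨hy.1, hy.2.1, ?_⟩
      rcases lt_trichotomy x y with h3 | h3 | h3
      · exact (hkey y hy.1 x h3 (hx.2.1.trans hy.2.1.symm)
          (by exact_mod_cast hx.2.2.trans hy.2.2.symm)).symm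
      · rw [h3]
      · exact hkey x hx.1 y h3 (hy.2.1.trans hx.2.1.symm)
          (by exact_mod_cast hy.2.2.trans hx.2.2.symm)

theorem lt_card_filter_lt_iff {N : ℕ} {f : Fin N → ℕ} (hf : Monotone f) (r : ℕ) (x : Fin N) :
    (x : ℕ) < (Finset.univ.filter (fun y => f y < r)).card ↔ f x < r := by
  constructor
  · intro h
    by_contra! hr
    have : Finset.univ.filter (fun y => f y < r) ⊆ Finset.Iio x := by
      intro y
      simp only [Finset.mem_filter, Finset.mem_univ, true_and, Finset.mem_Iio]
      intro hy
      by_contra! hxy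
      exact absurd (hf hxy) (by omega)
    have := Finset.card_le_card this
    rw [Fin.card_Iio] at this
    omega
  · intro h
    have : Finset.Iic x ⊆ Finset.univ.filter (fun y => f y < r) := by
      intro y
      simp only [Finset.mem_filter, Finset.mem_univ, true_and, Finset.mem_Iic]
      exact fun hy => (hf hy).trans_lt h
    have := Finset.card_le_card this
    rw [Fin.card_Iic] at this
    omega

section Units

variable {n : ℕ} {G : SimpleGraph (Fin n)} {W : Fin n → ℕ} {C l : ℕ}

theorem SplitColoring.sum_weight_eq (K : SplitColoring G W C l) : ∑ j, K.weight j = ∑ v, W v := by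
  rw [← Finset.sum_fiberwise Finset.univ K.owner K.weight]
  exact Finset.sum_congr rfl fun v _ => K.sum_weight v

/-- The units of weight of the copies can be arranged on the positions of their vertices. -/
theorem SplitColoring.exists_arrangement (lft : Fin n → ℝ) (K : SplitColoring G W C l) :
    ∃ e : Fin (∑ v, W v) ≃ (Σ j : Fin K.card, Fin (K.weight j)),
      ∀ (x : Fin (∑ v, W v)) (r : ℕ), (x : ℕ) < prefixWeight lft W r ↔
        rankNat lft (K.owner (e x).1) < r := by
  classical
  have hcard : Fintype.card (Σ j : Fin K.card, Fin (K.weight j)) = ∑ v, W v := by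
    rw [Fintype.card_sigma, ← K.sum_weight_eq]
    simp
  let e₀ := (Fintype.equivFinOfCardEq hcard).symm
  let f : Fin (∑ v, W v) → ℕ := fun x => rankNat lft (K.owner (e₀ x).1)
  -- Sorting the units by the rank of their vertex puts exactly the units of rank below `r` into the
  -- first `prefixWeight lft W r` positions.
  refine ⟨(Tuple.sort f).trans e₀, fun x r => ?_⟩
  have hmono : Monotone (f ∘ Tuple.sort f) := Tuple.monotone_sort f
  rw [show rankNat lft (K.owner (((Tuple.sort f).trans e₀) x).1) = (f ∘ Tuple.sort f) x from rfl,
    ← lt_card_filter_lt_iff hmono]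
  suffices h : prefixWeight lft W r =
      (Finset.univ.filter (fun y => (f ∘ Tuple.sort f) y < r)).card by rw [h]
  have h1 : (Finset.univ.filter (fun y => (f ∘ Tuple.sort f) y < r)).card =
      (Finset.univ.filter (fun t : (Σ j : Fin K.card, Fin (K.weight j)) =>
        rankNat lft (K.owner t.1) < r)).card :=
    Finset.card_equiv ((Tuple.sort f).trans e₀) (by simp [f])
  rw [h1, Finset.card_filter, Fintype.sum_sigma]
  rw [prefixWeight, Finset.sum_filter, ← Finset.sum_fiberwise Finset.univ K.owner]
  refine Finset.sum_congr rfl fun v _ => ?_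
  rw [← K.sum_weight v]
  split_ifs with hv
  · refine Finset.sum_congr rfl fun j hj => ?_
    simp [(Finset.mem_filter.mp hj).2, hv]
  · symm
    refine Finset.sum_eq_zero fun j hj => ?_
    simp [(Finset.mem_filter.mp hj).2, hv]

open Classical in
/-- The monochromatic component of a copy. -/
noncomputable def SplitColoring.component (K : SplitColoring G W C l) (j : Fin K.card) :
    Σ i : Fin l, ((copyGraph G K.owner).induce {x | K.color x = i}).ConnectedComponent :=
  ⟨K.color j, SimpleGraph.connectedComponentMk _ ⟨j, rfl⟩⟩

/-- The type of a component depends on its color; this allows naming the color by any equal term. -/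
theorem SplitColoring.component_eq (K : SplitColoring G W C l) {j : Fin K.card} {i : Fin l}
    (h : K.color j = i) :
    K.component j = ⟨i, SimpleGraph.connectedComponentMk _ ⟨j, h⟩⟩ := by
  subst h
  rfl

theorem SplitColoring.component_eq_of_adj (K : SplitColoring G W C l) {j j' : Fin K.card}
    (hc : K.color j = K.color j')
    (h : K.owner j = K.owner j' ∨ G.Adj (K.owner j) (K.owner j')) :
    K.component j = K.component j' := by
  by_cases hj : j = j'
  · rw [hj]
  rw [K.component_eq hc, K.component_eq (rfl : K.color j' = K.color j')]
  congr 1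
  refine SimpleGraph.ConnectedComponent.sound (SimpleGraph.Adj.reachable ?_)
  exact ⟨hj, h⟩

open Classical in
theorem SplitColoring.sum_component_le (K : SplitColoring G W C l)
    (g : Σ i : Fin l, ((copyGraph G K.owner).induce {x | K.color x = i}).ConnectedComponent) :
    ∑ j with K.component j = g, K.weight j ≤ C := by
  obtain ⟨i, g⟩ := g
  refine le_trans (le_of_eq ?_) (K.isColoring i g)
  symm
  refine Finset.sum_bij (fun x _ => x.1) ?_ ?_ ?_ ?_
  · intro x hx
    simp only [Finset.mem_filter, Finset.mem_univ, true_and] at hx ⊢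
    rw [K.component_eq x.2, ← hx]
  · intro x _ y _ h
    exact Subtype.ext h
  · intro j hj
    simp only [Finset.mem_filter, Finset.mem_univ, true_and] at hj
    have hi : K.color j = i := congrArg Sigma.fst hj
    rw [K.component_eq hi] at hj
    refine ⟨⟨j, hi⟩, ?_, rfl⟩
    simp only [Finset.mem_filter, Finset.mem_univ, true_and]
    simpa using hj
  · intro x _
    rfl

/-- Each position takes the color of the copy whose unit it carries. Conflicting positions of one
color belong to copies of equal or adjacent vertices, hence to one monochromatic component, and a
component has at most `C` units. -/
theorem SplitColoring.exists_blockColoring {lft rgt : Fin n → ℝ}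
    (hrep : IsProperIntervalRep G lft rgt) (hl : 0 < l) (K : SplitColoring G W C l) :
    ∃ (χ : ℕ → Fin l) (β : ℕ → ℤ),
      BlockColoring (∑ v, W v) C (conflictEnd lft rgt W) χ β := by
  classical
  set N := ∑ v, W v with hN
  obtain ⟨e, he⟩ : ∃ e : Fin N ≃ (Σ j : Fin K.card, Fin (K.weight j)),
      ∀ (x : Fin N) (r : ℕ), (x : ℕ) < prefixWeight lft W r ↔
        rankNat lft (K.owner (e x).1) < r := K.exists_arrangement lft
  let χ : ℕ → Fin l := fun x => if h : x < N then K.color (e ⟨x, h⟩).1 else ⟨0, hl⟩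
  let κ : ℕ → Option (Σ i : Fin l,
      ((copyGraph G K.owner).induce {x | K.color x = i}).ConnectedComponent) :=
    fun x => if h : x < N then some (K.component (e ⟨x, h⟩).1) else none
  have hseg : ∀ x (h : x < N), segment n (prefixWeight lft W) x =
      rankNat lft (K.owner (e ⟨x, h⟩).1) := by
    intro x h
    refine segment_eq (prefixWeight_mono lft W) (rankNat_lt _ _) ?_ ?_
    · have := (he ⟨x, h⟩ (rankNat lft (K.owner (e ⟨x, h⟩).1))).not.mpr (lt_irrefl _)
      simpa using this
    · exact (he ⟨x, h⟩ _).mpr (Nat.lt_succ_self _)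
  refine ⟨χ, BlockColoring.exists_of_components (conflictEnd_mono W hrep) κ ?_ ?_⟩
  · intro s t hst ht hc hlt
    have hs : s < N := hst.trans ht
    simp only [χ, κ, dif_pos hs, dif_pos ht] at hc ⊢
    refine congrArg some (K.component_eq_of_adj hc ?_)
    unfold conflictEnd at hlt
    rw [hseg s hs] at hlt
    have hmono := segment_mono n (prefixWeight lft W) hst.le
    rw [hseg s hs, hseg t ht] at hmono
    by_contra! hcon
    have hle := le_of_rankNat_le hmono
    rw [hrep.adj_iff_of_le hle hcon.1] at hcon
    have h1 := reachWeight_le_of_not_adj W hcon.2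
    have h2 := (he ⟨t, ht⟩ (rankNat lft (K.owner (e ⟨t, ht⟩).1))).not.mpr (lt_irrefl _)
    simp only [not_lt] at h2
    omega
  · intro a g
    cases g with
    | none =>
      rw [Finset.filter_false_of_mem]
      · simp
      · intro x hx
        simp [κ, Finset.mem_range.mp hx]
    | some g =>
      refine le_trans ?_ (K.sum_component_le g)
      have h1 : ∑ j with K.component j = g, K.weight j =
          (Finset.univ.filter (fun t : (Σ j : Fin K.card, Fin (K.weight j)) =>
            K.component t.1 = g)).card := by
        rw [Finset.card_filter, Fintype.sum_sigma, Finset.sum_filter]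
        refine Finset.sum_congr rfl fun j _ => ?_
        split_ifs <;> simp
      rw [h1]
      refine le_trans ?_ (Finset.card_le_card_of_injOn (s := Finset.univ.filter
        (fun x : Fin N => K.component (e x).1 = g)) e ?_ e.injective.injOn)
      · refine (Finset.card_le_card fun x => ?_).trans (Finset.card_image_le (f := Fin.val))
        simp only [Finset.mem_filter, Finset.mem_range, Finset.mem_image, Finset.mem_univ,
          true_and]
        rintro ⟨hx, -, h2⟩
        refine ⟨⟨x, hx⟩, ?_, rfl⟩
        simp only [κ, dif_pos hx] at h2
        exact Option.some_injective _ h2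
      · intro x
        simp

/-- What a split coloring says about the positions: the cliques are not too heavy, and the
positions can be cut into blocks. -/
theorem SplitColorable.clique_le_and_exists_isCutSequence {lft rgt : Fin n → ℝ}
    (hrep : IsProperIntervalRep G lft rgt) (hl : 0 < l) (h : SplitColorable G W C l) :
    (∀ r < n, reachWeight lft rgt W r ≤ prefixWeight lft W r + l * C) ∧
      ∃ c, IsCutSequence (∑ v, W v) C (l - 1) (conflictEnd lft rgt W) c := by
  obtain ⟨K⟩ := h
  obtain ⟨χ, β, hβ⟩ := K.exists_blockColoring hrep hl
  refine ⟨fun r hr => ?_, hβ.exists_isCutSequence (conflictEnd_mono W hrep)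
    fun x _ => reachWeight_le _ _ _ _⟩
  have := hβ.card_clique_le (p := prefixWeight lft W r) (q := reachWeight lft rgt W r)
    (reachWeight_le _ _ _ _)
    (fun x hx => reachWeight_mono W hrep (le_segment (prefixWeight_mono lft W) hr.le hx))
  omega

end Units

/-! ## From cuts to split colorings -/

/-- The size of the intersection of `[a, b)` and `[c, d)`. -/
def overlap (a b c d : ℕ) : ℕ := min b d - max a c

theorem overlap_comm (a b c d : ℕ) : overlap a b c d = overlap c d a b := by
  unfold overlap
  rw [min_comm, max_comm]

theorem sum_overlap {a b : ℕ} (hab : a ≤ b) {f : ℕ → ℕ} (hf : Monotone f) (h0 : f 0 ≤ a) (m : ℕ) :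
    ∑ k ∈ Finset.range m, overlap a b (f k) (f (k + 1)) = min b (max a (f m)) - a := by
  induction m with
  | zero => simp; omega
  | succ m ih =>
    rw [Finset.sum_range_succ, ih, overlap]
    have : f m ≤ f (m + 1) := hf (Nat.le_succ m)
    omega

/-- The list of the pairs of a block and a vertex (given by its rank) that meet. -/
def pieceList (n : ℕ) (P c : ℕ → ℕ) (m : ℕ) : List (ℕ × ℕ) :=
  (List.range m).flatMap fun k =>
    ((List.range n).filter fun i => 0 < overlap (P i) (P (i + 1)) (c k) (c (k + 1))).map
      fun i => (k, i)

theorem mem_pieceList {n : ℕ} {P c : ℕ → ℕ} {m : ℕ} {x : ℕ × ℕ} :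
    x ∈ pieceList n P c m ↔ x.1 < m ∧ x.2 < n ∧
      0 < overlap (P x.2) (P (x.2 + 1)) (c x.1) (c (x.1 + 1)) := by
  obtain ⟨k, i⟩ := x
  simp only [pieceList, List.mem_flatMap, List.mem_range, List.mem_map, List.mem_filter,
    decide_eq_true_eq, Prod.mk.injEq]
  constructor
  · rintro ⟨k', hk', i', ⟨hi', h⟩, rfl, rfl⟩
    exact ⟨hk', hi', h⟩
  · rintro ⟨hk, hi, h⟩
    exact ⟨k, hk, i, ⟨hi, h⟩, rfl, rfl⟩

theorem nodup_pieceList (n : ℕ) (P c : ℕ → ℕ) (m : ℕ) : (pieceList n P c m).Nodup := by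
  rw [pieceList, List.nodup_flatMap]
  refine ⟨fun k _ => ?_, ?_⟩
  · exact ((List.nodup_range).filter _).map fun i j h => (Prod.mk.inj h).2
  · refine List.Pairwise.imp ?_ List.nodup_range
    intro k k' hne x hx hx'
    simp only [List.mem_map] at hx hx'
    obtain ⟨i, -, rfl⟩ := hx
    obtain ⟨i', -, h⟩ := hx'
    exact hne (Prod.mk.inj h).1.symm

theorem sum_get_filter_eq {α : Type*} [DecidableEq α] {L : List α} (hL : L.Nodup)
    (p : α → Prop) [DecidablePred p] (f : α → ℕ) :
    ∑ t : Fin L.length with p L[t], f L[t] = ∑ x ∈ L.toFinset with p x, f x := by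
  refine Finset.sum_bij (fun t _ => L[t]) ?_ ?_ ?_ ?_
  · intro t ht
    simp only [Finset.mem_filter, Finset.mem_univ, true_and] at ht ⊢
    exact ⟨by simp, ht⟩
  · intro s _ t _ h
    exact Fin.ext ((List.Nodup.getElem_inj_iff hL).mp h)
  · intro x hx
    simp only [Finset.mem_filter, List.mem_toFinset] at hx
    obtain ⟨t, ht, rfl⟩ := List.mem_iff_getElem.mp hx.1
    exact ⟨⟨t, ht⟩, by simpa using hx.2, rfl⟩
  · intro t _
    rfl

/-- The block is constant along monochromatic walks, so a component never leaves its block. -/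
theorem isComponentColoring_of_blocks {U : Type*} [Fintype U] {H : SimpleGraph U} {w : U → ℕ}
    {C l : ℕ} {color : U → Fin l} (block : U → ℕ)
    (h : ∀ x y, H.Adj x y → color x = color y → block x = block y)
    (hC : ∀ k, ∑ x with block x = k, w x ≤ C) : IsComponentColoring H w C color := by
  classical
  intro i K
  obtain ⟨x₀, rfl⟩ := K.exists_rep
  have hblock : ∀ x y, (H.induce {x | color x = i}).Reachable x y → block x.1 = block y.1 := by
    rintro x y ⟨p⟩
    induction p with
    | nil => rfl
    | cons hadj _ ih =>
      rename_i u v _ _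
      exact (h u.1 v.1 hadj (u.2.trans v.2.symm)).trans ih
  refine le_trans ?_ (hC (block x₀.1))
  refine le_of_eq_of_le (Finset.sum_image (g := Subtype.val) (f := w)
    Subtype.val_injective.injOn).symm (Finset.sum_le_sum_of_subset ?_)
  intro y hy
  simp only [Finset.mem_image, Finset.mem_filter, Finset.mem_univ, true_and] at hy ⊢
  obtain ⟨x, hx, rfl⟩ := hy
  exact hblock _ _ (SimpleGraph.ConnectedComponent.exact hx)

section Build

variable {n : ℕ} {G : SimpleGraph (Fin n)} {lft rgt : Fin n → ℝ} {W : Fin n → ℕ} {C d : ℕ}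
  {c : ℕ → ℕ}

theorem pieceList_snd_lt {P : ℕ → ℕ} {m : ℕ} (t : Fin (pieceList n P c m).length) :
    (pieceList n P c m)[t].2 < n :=
  (mem_pieceList.mp (List.getElem_mem t.2)).2.1

/-- Pieces of the same color that belong to equal or adjacent vertices lie in the same block. -/
theorem IsCutSequence.block_eq (hrep : IsProperIntervalRep G lft rgt)
    (hc : IsCutSequence (∑ v, W v) C d (conflictEnd lft rgt W) c) {k k' : ℕ} {u v : Fin n}
    (hu : 0 < overlap (prefixWeight lft W (rankNat lft u)) (prefixWeight lft W (rankNat lft u + 1))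
      (c k) (c (k + 1)))
    (hv : 0 < overlap (prefixWeight lft W (rankNat lft v)) (prefixWeight lft W (rankNat lft v + 1))
      (c k') (c (k' + 1)))
    (huv : u = v ∨ G.Adj u v) (hmod : k % (d + 1) = k' % (d + 1)) : k = k' := by
  by_contra hne
  wlog hlt : k < k' generalizing k k' u v
  · exact this hv hu (huv.imp Eq.symm (fun h => h.symm)) hmod.symm (Ne.symm hne) (by omega)
  unfold overlap at hu hv
  -- Blocks of the same cyclic color are at least `d + 1` apart. The cut after block `k` thus
  -- guarantees that block `k'` starts beyond the reach of `u`, whereas `v` lies within that reach.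
  have hdvd : k + (d + 1) ≤ k' := by
    have h1 : (k' - k) % (d + 1) = 0 := Nat.sub_mod_eq_zero_of_mod_eq hmod.symm
    have h2 := Nat.le_of_dvd (by omega) (Nat.dvd_of_mod_eq_zero h1)
    omega
  have h1 : c (k + 1 + d) ≤ c k' := hc.mono (by omega)
  have h2 := hc.sep (k + 1) (by omega)
  have h3 : rankNat lft u ≤ segment n (prefixWeight lft W) (c (k + 1) - 1) :=
    le_segment (prefixWeight_mono lft W) (rankNat_lt lft u).le (by omega)
  have h4 : reachWeight lft rgt W (rankNat lft u) ≤ c k' :=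
    (reachWeight_mono W hrep h3).trans (h2.trans h1)
  have h5 : prefixWeight lft W (rankNat lft v + 1) ≤ reachWeight lft rgt W (rankNat lft u) := by
    rcases Nat.lt_or_ge (rankNat lft u) (rankNat lft v) with h6 | h6
    · have hne' : u ≠ v := by rintro rfl; exact lt_irrefl _ h6
      exact prefixWeight_succ_le_of_adj W
        ((hrep.adj_iff_of_le (le_of_rankNat_le h6.le) hne').mp (huv.resolve_left hne'))
    · exact (prefixWeight_mono lft W (by omega)).trans
        (prefixWeight_succ_le_reachWeight W hrep (rankNat_lt lft u))
  omega

/-- The split coloring that belongs to a cut sequence: the blocks are colored cyclically. -/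
noncomputable def IsCutSequence.splitColoring (hrep : IsProperIntervalRep G lft rgt)
    (hc : IsCutSequence (∑ v, W v) C d (conflictEnd lft rgt W) c) {m : ℕ}
    (hm : c m = ∑ v, W v) : SplitColoring G W C (d + 1) where
  card := (pieceList n (prefixWeight lft W) c m).length
  owner t := (rank lft).symm ⟨(pieceList n (prefixWeight lft W) c m)[t].2, pieceList_snd_lt t⟩
  weight t := overlap (prefixWeight lft W (pieceList n (prefixWeight lft W) c m)[t].2)
    (prefixWeight lft W ((pieceList n (prefixWeight lft W) c m)[t].2 + 1))
    (c (pieceList n (prefixWeight lft W) c m)[t].1)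
    (c ((pieceList n (prefixWeight lft W) c m)[t].1 + 1))
  color t := ⟨(pieceList n (prefixWeight lft W) c m)[t].1 % (d + 1), Nat.mod_lt _ (by omega)⟩
  sum_weight := by
    intro v
    have h1 : (Finset.univ.filter fun t : Fin (pieceList n (prefixWeight lft W) c m).length =>
        (rank lft).symm ⟨(pieceList n (prefixWeight lft W) c m)[t].2, pieceList_snd_lt t⟩ = v) =
        Finset.univ.filter fun t => (pieceList n (prefixWeight lft W) c m)[t].2 = rankNat lft v := by
      ext t
      simp only [Finset.mem_filter, Finset.mem_univ, true_and]
      rw [Equiv.symm_apply_eq, Fin.ext_iff, coe_rank]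
    rw [h1, sum_get_filter_eq (nodup_pieceList _ _ _ _) (fun x => x.2 = rankNat lft v)
      (fun x => overlap (prefixWeight lft W x.2) (prefixWeight lft W (x.2 + 1)) (c x.1)
        (c (x.1 + 1)))]
    have h2 : ∑ x ∈ (pieceList n (prefixWeight lft W) c m).toFinset with x.2 = rankNat lft v,
        overlap (prefixWeight lft W x.2) (prefixWeight lft W (x.2 + 1)) (c x.1) (c (x.1 + 1)) =
        ∑ k ∈ Finset.range m, overlap (prefixWeight lft W (rankNat lft v))
          (prefixWeight lft W (rankNat lft v + 1)) (c k) (c (k + 1)) := by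
      refine Finset.sum_of_injOn Prod.fst ?_ ?_ ?_ ?_
      · rintro ⟨k, i⟩ hx ⟨k', i'⟩ hx' h
        simp only [Finset.coe_filter, Set.mem_ofPred_eq] at hx hx' h
        exact Prod.ext h (hx.2.trans hx'.2.symm)
      · rintro ⟨k, i⟩ hx
        simp only [Finset.coe_filter, Set.mem_ofPred_eq, List.mem_toFinset, mem_pieceList] at hx
        simpa using hx.1.1
      · intro k hk hk'
        by_contra hne
        refine hk' ⟨(k, rankNat lft v), ?_, rfl⟩
        simp only [Finset.coe_filter, Set.mem_ofPred_eq, List.mem_toFinset, mem_pieceList]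
        exact ⟨⟨Finset.mem_range.mp hk, rankNat_lt lft v, Nat.pos_of_ne_zero hne⟩, trivial⟩
      · rintro ⟨k, i⟩ hx
        simp only [Finset.mem_filter] at hx
        obtain ⟨-, rfl⟩ := hx
        rfl
    rw [h2, sum_overlap (prefixWeight_mono lft W (Nat.le_add_right _ 1)) hc.mono (by rw [hc.zero]; omega),
      hm]
    have h3 := prefixWeight_succ lft W v
    have h4 := prefixWeight_le lft W (rankNat lft v + 1)
    omega
  isColoring := by
    refine isComponentColoring_of_blocks
      (fun t => (pieceList n (prefixWeight lft W) c m)[t].1) ?_ ?_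
    · intro t t' hadj hcol
      refine hc.block_eq hrep ?_ ?_ hadj.2 (congrArg Fin.val hcol)
      · rw [rankNat_rank_symm]
        exact (mem_pieceList.mp (List.getElem_mem t.2)).2.2
      · rw [rankNat_rank_symm]
        exact (mem_pieceList.mp (List.getElem_mem t'.2)).2.2
    · intro k
      rw [sum_get_filter_eq (nodup_pieceList _ _ _ _) (fun x => x.1 = k)
        (fun x => overlap (prefixWeight lft W x.2) (prefixWeight lft W (x.2 + 1)) (c x.1)
          (c (x.1 + 1)))]
      by_cases hk : k < m
      · have h1 : ∑ x ∈ (pieceList n (prefixWeight lft W) c m).toFinset with x.1 = k,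
            overlap (prefixWeight lft W x.2) (prefixWeight lft W (x.2 + 1)) (c x.1) (c (x.1 + 1)) =
            ∑ i ∈ Finset.range n, overlap (c k) (c (k + 1)) (prefixWeight lft W i)
              (prefixWeight lft W (i + 1)) := by
          refine Finset.sum_of_injOn Prod.snd ?_ ?_ ?_ ?_
          · rintro ⟨k, i⟩ hx ⟨k', i'⟩ hx' h
            simp only [Finset.coe_filter, Set.mem_ofPred_eq] at hx hx' h
            exact Prod.ext (hx.2.trans hx'.2.symm) h
          · rintro ⟨k, i⟩ hx
            simp only [Finset.coe_filter, Set.mem_ofPred_eq, List.mem_toFinset,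
              mem_pieceList] at hx
            simpa using hx.1.2.1
          · intro i hi hi'
            by_contra hne
            rw [overlap_comm] at hne
            refine hi' ⟨(k, i), ?_, rfl⟩
            simp only [Finset.coe_filter, Set.mem_ofPred_eq, List.mem_toFinset, mem_pieceList]
            exact ⟨⟨hk, Finset.mem_range.mp hi, Nat.pos_of_ne_zero hne⟩, trivial⟩
          · rintro ⟨k, i⟩ hx
            simp only [Finset.mem_filter] at hx
            obtain ⟨-, rfl⟩ := hx
            exact overlap_comm _ _ _ _
        rw [h1, sum_overlap (hc.mono (Nat.le_add_right k 1)) (prefixWeight_mono lft W) (by simp)]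
        have := hc.succ_le k
        omega
      · rw [Finset.sum_eq_zero]
        · exact Nat.zero_le _
        · intro x hx
          simp only [Finset.mem_filter, List.mem_toFinset, mem_pieceList] at hx
          omega

theorem IsCutSequence.splitColorable (hrep : IsProperIntervalRep G lft rgt)
    (hc : IsCutSequence (∑ v, W v) C d (conflictEnd lft rgt W) c) :
    SplitColorable G W C (d + 1) :=
  let ⟨_, hm⟩ := hc.reach
  ⟨hc.splitColoring hrep hm⟩

theorem IsCutSequence.holds_splitColoring (hrep : IsProperIntervalRep G lft rgt)
    (hc : IsCutSequence (∑ v, W v) C d (conflictEnd lft rgt W) c) {m : ℕ}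
    (hm : c m = ∑ v, W v) {s : State} (h0 : s.var 0 = d + 1)
    (h1 : s.var 1 = (pieceList n (prefixWeight lft W) c m).length)
    (ho : ∀ v : Fin n, s.arr 4 (rankNat lft v : ℕ) = (v : ℕ))
    (h : ∀ t : ℕ, ∀ ht : t < (pieceList n (prefixWeight lft W) c m).length,
      s.arr 1 t = s.arr 4 ((pieceList n (prefixWeight lft W) c m)[t].2 : ℕ) ∧
      s.arr 2 t = overlap (prefixWeight lft W (pieceList n (prefixWeight lft W) c m)[t].2)
        (prefixWeight lft W ((pieceList n (prefixWeight lft W) c m)[t].2 + 1))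
        (c (pieceList n (prefixWeight lft W) c m)[t].1)
        (c ((pieceList n (prefixWeight lft W) c m)[t].1 + 1)) ∧
      s.arr 3 t = (((pieceList n (prefixWeight lft W) c m)[t].1 % (d + 1) : ℕ) : ℤ)) :
    Holds s (hc.splitColoring hrep hm) := by
  refine ⟨by rw [h0]; push_cast; rfl, h1, fun t => ?_⟩
  obtain ⟨h2, h3, h4⟩ := h t t.2
  refine ⟨?_, h3, h4⟩
  rw [h2, ← ho]
  congr 1
  exact (congrArg Nat.cast (rankNat_rank_symm lft ⟨_, pieceList_snd_lt t⟩)).symm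

end Build

/-! ## Admissible cuts -/

/-- `PullBack n P C b i t y z`: a position past the start of segment `i` from which a cut at `y` or
later can be reached by `t` admissible steps of length at most `C` is at least `z`. Here
segment `j` consists of the cuts `x` with `P j < x ≤ P (j + 1)`, and `b j` is the least admissible
cut greater than `P j`, for `i < j < n`. -/
inductive PullBack (n : ℕ) (P : ℕ → ℕ) (C : ℕ) (b : ℕ → ℤ) (i : ℕ) : ℕ → ℤ → ℤ → Prop
  | base {t : ℕ} {y : ℤ} (h : t = 0 ∨ y ≤ P (i + 1)) : PullBack n P C b i t y (y - t * C)
  | step {t j : ℕ} {y z : ℤ} (hij : i < j) (hj : j < n) (h₁ : (P j : ℤ) < y)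
      (h₂ : y ≤ P (j + 1)) (h : PullBack n P C b i t (max y (b j) - C) z) :
      PullBack n P C b i (t + 1) y z

theorem PullBack.congr {n : ℕ} {P : ℕ → ℕ} {C : ℕ} {b b' : ℕ → ℤ} {i t : ℕ} {y z : ℤ}
    (h : PullBack n P C b i t y z) (hb : ∀ j, i < j → b' j = b j) :
    PullBack n P C b' i t y z := by
  induction h with
  | base h => exact .base h
  | step hij hj h₁ h₂ _ ih => exact .step hij hj h₁ h₂ (by rw [hb _ hij]; exact ih)

/-- From `i₀` on, `b i` is the least admissible cut greater than `P i`, or the last cut. -/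
structure IsThreshold (n : ℕ) (P G : ℕ → ℕ) (C d i₀ : ℕ) (b : ℕ → ℤ) : Prop where
  last : b n = P n
  spec : ∀ i, i₀ ≤ i → i < n → ∃ z, PullBack n P C b i d (G i) z ∧
    b i = if max (P i + 1 : ℤ) z ≤ P (i + 1) then max (P i + 1 : ℤ) z else b (i + 1)

/-- The cut `x` is admissible. -/
def Admissible (n : ℕ) (P : ℕ → ℕ) (b : ℕ → ℤ) (x : ℕ) : Prop :=
  x = P n ∨ ∃ i < n, P i < x ∧ x ≤ P (i + 1) ∧ b i ≤ x

/-- The greatest cut `≤ x + C` in the first `m` segments that is admissible, at least `x`. -/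
def forward (P : ℕ → ℕ) (b : ℕ → ℤ) (C x : ℕ) : ℕ → ℕ
  | 0 => x
  | m + 1 =>
    if b m ≤ (min (P (m + 1)) (x + C) : ℕ) then max (forward P b C x m) (min (P (m + 1)) (x + C))
    else forward P b C x m

/-- The cuts made greedily. -/
def greedyCut (n : ℕ) (P : ℕ → ℕ) (b : ℕ → ℤ) (C : ℕ) : ℕ → ℕ
  | 0 => 0
  | k + 1 => forward P b C (greedyCut n P b C k) n

/-! ### Thresholds decide the existence of a cut sequence -/

section Threshold

variable {n : ℕ} {P G : ℕ → ℕ} {C d i₀ : ℕ} {b : ℕ → ℤ}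

theorem exists_segment (hP0 : P 0 = 0) {y : ℕ} (hy0 : 0 < y) (hy : y ≤ P n) :
    ∃ i < n, P i < y ∧ y ≤ P (i + 1) := by
  induction n with
  | zero => omega
  | succ n ih =>
    by_cases h : y ≤ P n
    · obtain ⟨i, h1, h2⟩ := ih h
      exact ⟨i, by omega, h2⟩
    · exact ⟨n, by omega, by omega, hy⟩

theorem IsThreshold.le_last (hP : Monotone P) (hb : IsThreshold n P G C d i₀ b) {i : ℕ}
    (h₁ : i₀ ≤ i) (h₂ : i ≤ n) : b i ≤ P n := by
  induction h₂ using Nat.decreasingInduction with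
  | self => rw [hb.last]
  | of_succ i hi ih =>
    obtain ⟨z, -, h⟩ := hb.spec i h₁ hi
    have h3 : P (i + 1) ≤ P n := hP hi
    have := ih (by omega)
    rw [h]
    split_ifs <;> omega

/-- The second case is needed when nothing lies beyond `P i`: then `b i = P n = P i` and the strict
inequality fails. -/
theorem IsThreshold.lt_or_eq_last (hP : Monotone P) (hb : IsThreshold n P G C d i₀ b) {i : ℕ}
    (h₁ : i₀ ≤ i) (h₂ : i ≤ n) : (P i : ℤ) < b i ∨ b i = P n := by
  induction h₂ using Nat.decreasingInduction with
  | self => exact Or.inr hb.last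
  | of_succ i hi ih =>
    obtain ⟨z, -, h⟩ := hb.spec i h₁ hi
    have h3 : P i ≤ P (i + 1) := hP (Nat.le_add_right i 1)
    have := ih (by omega)
    rw [h]
    split_ifs <;> omega

theorem IsThreshold.le (hP : Monotone P) (hb : IsThreshold n P G C d i₀ b) {i : ℕ}
    (h₁ : i₀ ≤ i) (h₂ : i ≤ n) : (P i : ℤ) ≤ b i := by
  have h3 : P i ≤ P n := hP h₂
  rcases hb.lt_or_eq_last hP h₁ h₂ with h | h <;> omega

theorem IsThreshold.admissible (hb : IsThreshold n P G C d i₀ b) {i : ℕ}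
    (h₁ : i₀ ≤ i) (h₂ : i ≤ n) : Admissible n P b (b i).toNat := by
  induction h₂ using Nat.decreasingInduction with
  | self => left; rw [hb.last]; simp
  | of_succ i hi ih =>
    obtain ⟨z, -, h⟩ := hb.spec i h₁ hi
    split_ifs at h with h3
    · exact Or.inr ⟨i, hi, by omega, by omega, by omega⟩
    · rw [h]
      exact ih (by omega)

/-- Pulling back for segment `i₀` consults only thresholds of later segments, so overwriting entry
`i₀` disturbs nothing established so far. -/
theorem IsThreshold.update (hb : IsThreshold n P G C d (i₀ + 1) b) (hi : i₀ < n) {z v : ℤ}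
    (hz : PullBack n P C b i₀ d (G i₀) z)
    (hv : v = if max (P i₀ + 1 : ℤ) z ≤ P (i₀ + 1) then max (P i₀ + 1 : ℤ) z else b (i₀ + 1))
    {b' : ℕ → ℤ} (hb' : b' i₀ = v) (hb'' : ∀ j, i₀ < j → b' j = b j) :
    IsThreshold n P G C d i₀ b' := by
  refine ⟨by rw [hb'' n hi, hb.last], fun i h1 h2 => ?_⟩
  rcases h1.eq_or_lt with rfl | h1
  · exact ⟨z, hz.congr hb'', by rw [hb', hv, hb'' (i₀ + 1) (by omega)]⟩
  · obtain ⟨z, h3, h4⟩ := hb.spec i h1 h2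
    exact ⟨z, h3.congr fun j hj => hb'' j (by omega),
      by rw [hb'' i (by omega), h4, hb'' (i + 1) (by omega)]⟩

/-- All cuts of a cut sequence are admissible. -/
theorem IsThreshold.le_cut (hP : Monotone P) (hb : IsThreshold n P G C d i₀ b) {c : ℕ → ℕ}
    (hc : IsCutSequence (P n) C d (fun x => G (segment n P x)) c) {i : ℕ}
    (h₁ : i₀ ≤ i) (h₂ : i ≤ n) (k : ℕ) (hk : P i < c k) : b i ≤ c k := by
  have key : ∀ e i, n - i = e → i₀ ≤ i → i ≤ n → ∀ k, P i < c k → b i ≤ c k := by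
    intro e
    induction e using Nat.strong_induction_on with
    | _ e ih =>
      intro i he h₁ h₂ k hk
      have hkn := hc.le k
      have hin : i < n := by
        refine lt_of_le_of_ne h₂ ?_
        rintro rfl
        omega
      obtain ⟨z, hz, hbz⟩ := hb.spec i h₁ hin
      by_cases hk' : P (i + 1) < c k
      · have h3 := ih (n - (i + 1)) (by omega) (i + 1) rfl (by omega) hin k hk'
        split_ifs at hbz <;> omega
      -- Each backward step is sound for the given cuts: a cut that is at least `y > P j` is also at
      -- least `b j` by induction on later segments, and the cut before it is at most `C` smaller.
      · have hpull : ∀ (t : ℕ) (y z : ℤ), PullBack n P C b i t y z → y ≤ c (k + t) → z ≤ c k := by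
          intro t y z hz
          induction hz with
          | @base t y _ =>
            intro hy
            have h4 : ∀ t, c (k + t) ≤ c k + t * C := by
              intro t
              induction t with
              | zero => simp
              | succ t ih =>
                have h5 := hc.succ_le (k + t)
                have h6 : (t + 1) * C = t * C + C := by ring
                rw [← add_assoc]
                omega
            have h5 := h4 t
            zify at h5
            linarith
          | @step t j y z hij hj hy1 hy2 _ ih' =>
            intro hy
            refine ih' ?_
            have h3 := ih (n - j) (by omega) j rfl (by omega) hj.le (k + (t + 1)) (by omega)
            have h4 := hc.succ_le (k + t)
            rw [add_assoc] at h4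
            omega
        have hsep := hc.sep k (by omega)
        simp only [segment_eq hP hin (show P i ≤ c k - 1 by omega) (by omega)] at hsep
        have := hpull d _ _ hz (by exact_mod_cast hsep)
        rw [hbz, if_pos (by omega)]
        omega
  exact key _ i rfl h₁ h₂ k hk

/-- The first cut beyond `P i` is at least `b i`, and it follows a cut that is at most `P i`.
Violation of this bound is the program's certificate that no cut sequence exists. -/
theorem IsThreshold.le_add (hP : Monotone P) (hb : IsThreshold n P G C d i₀ b)
    {c : ℕ → ℕ}
    (hc : IsCutSequence (P n) C d (fun x => G (segment n P x)) c) {i : ℕ}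
    (h₁ : i₀ ≤ i) (h₂ : i ≤ n) : b i ≤ P i + C := by
  by_cases h : P i = P n
  · have := hb.le_last hP h₁ h₂
    omega
  · have h3 : P i ≤ P n := hP h₂
    obtain ⟨m, hm⟩ := hc.reach
    have hex : ∃ k, P i < c k := ⟨m, by omega⟩
    have h4 := Nat.find_spec hex
    have h5 := hb.le_cut hP hc h₁ h₂ _ h4
    obtain ⟨k, hk⟩ : ∃ k, Nat.find hex = k + 1 := by
      refine Nat.exists_eq_succ_of_ne_zero fun h0 => ?_
      rw [h0, hc.zero] at h4
      omega
    have h6 := Nat.find_min hex (show k < Nat.find hex by omega)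
    have h7 := hc.succ_le k
    rw [hk] at h5
    omega

theorem le_forward (P : ℕ → ℕ) (b : ℕ → ℤ) (C x m : ℕ) : x ≤ forward P b C x m := by
  induction m with
  | zero => exact le_rfl
  | succ m ih =>
    rw [forward]
    split_ifs <;> omega

theorem forward_le (P : ℕ → ℕ) (b : ℕ → ℤ) (C x m : ℕ) : forward P b C x m ≤ x + C := by
  induction m with
  | zero => exact Nat.le_add_right x C
  | succ m ih =>
    rw [forward]
    split_ifs <;> omega

theorem forward_le_last (hP : Monotone P) {x : ℕ} (hx : x ≤ P n) {m : ℕ} (hm : m ≤ n) :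
    forward P b C x m ≤ P n := by
  induction m with
  | zero => exact hx
  | succ m ih =>
    have := ih (by omega)
    have : P (m + 1) ≤ P n := hP hm
    rw [forward]
    split_ifs <;> omega

theorem le_forward_of_segment {x y i m : ℕ} (hi : i < m) (h₁ : y ≤ P (i + 1)) (h₂ : b i ≤ y)
    (hy : y ≤ x + C) : y ≤ forward P b C x m := by
  induction m with
  | zero => omega
  | succ m ih =>
    rw [forward]
    rcases Nat.lt_or_ge i m with h | h
    · have := ih h
      split_ifs <;> omega
    · have : i = m := by omega
      subst this
      rw [if_pos (by omega)]
      omega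

/-- Greedy domination: no admissible cut within distance `C` lies beyond the greedy one. -/
theorem IsThreshold.le_forward (hP0 : P 0 = 0) (hP : Monotone P)
    (hb : IsThreshold n P G C d 0 b) {x y : ℕ}
    (hy : Admissible n P b y) (hyx : y ≤ x + C) : y ≤ forward P b C x n := by
  rcases hy with rfl | ⟨i, h1, h2, h3, h4⟩
  · rcases Nat.eq_zero_or_pos (P n) with h0 | h0
    · omega
    · obtain ⟨i, h1, h2, h3⟩ := exists_segment hP0 h0 le_rfl
      exact le_forward_of_segment h1 h3 (hb.le_last hP (Nat.zero_le i) h1.le) hyx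
  · exact le_forward_of_segment h1 h3 h4 hyx

theorem IsThreshold.forward_admissible (hP : Monotone P)
    (hb : IsThreshold n P G C d 0 b) {x m : ℕ} (hm : m ≤ n) :
    forward P b C x m = x ∨ Admissible n P b (forward P b C x m) := by
  induction m with
  | zero => exact Or.inl rfl
  | succ m ih =>
    rw [forward]
    split_ifs with h
    · rcases max_choice (forward P b C x m) (min (P (m + 1)) (x + C)) with h1 | h1
      · rw [h1]
        exact ih (by omega)
      · rw [h1]
        right
        have h2 : P (m + 1) ≤ P n := hP hm
        -- Passing the test `b m ≤ min (P (m + 1)) (x + C)` places the candidate beyond `P m`,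
        -- except when `b m = P n`; then the candidate is `P n`.
        rcases hb.lt_or_eq_last hP (Nat.zero_le m) (by omega) with h3 | h3
        · exact Or.inr ⟨m, hm, by omega, by omega, h⟩
        · left
          omega
    · exact ih (by omega)

/-- If no gap between admissible cuts exceeds `C`, greedy cutting makes progress. -/
theorem IsThreshold.lt_forward (hP0 : P 0 = 0) (hP : Monotone P) (hC : 1 ≤ C)
    (hb : IsThreshold n P G C d 0 b) (hgap : ∀ i < n, b i ≤ P i + C) {x : ℕ}
    (hx : x = 0 ∨ Admissible n P b x) (hxn : x < P n) : x < forward P b C x n := by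
  have key : ∀ i, i < n → x = P i → x < forward P b C x n := by
    intro i hi hxi
    have h1 := hb.admissible (Nat.zero_le i) hi.le
    have h2 := hgap i hi
    have h3 := hb.le hP (Nat.zero_le i) hi.le
    refine lt_of_lt_of_le ?_ (hb.le_forward hP0 hP h1 (by omega))
    rcases hb.lt_or_eq_last hP (Nat.zero_le i) hi.le with h4 | h4 <;> omega
  -- A cut strictly inside a segment can move by one, staying above the threshold. A cut at a
  -- segment start `P i` can move to `b i` by the gap condition.
  rcases hx with rfl | rfl | ⟨i, h1, h2, h3, h4⟩
  · refine key 0 (Nat.pos_of_ne_zero ?_) hP0.symm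
    rintro rfl
    omega
  · omega
  · by_cases h5 : x = P (i + 1)
    · refine key (i + 1) (lt_of_le_of_ne h1 ?_) h5
      intro h6
      rw [h6] at h5
      omega
    · exact le_forward_of_segment (y := x + 1) h1 (by omega) (by push_cast; omega) (by omega)

theorem IsThreshold.greedyCut_admissible (hP : Monotone P)
    (hb : IsThreshold n P G C d 0 b) (k : ℕ) :
    greedyCut n P b C k = 0 ∨ Admissible n P b (greedyCut n P b C k) := by
  induction k with
  | zero => exact Or.inl rfl
  | succ k ih =>
    rw [greedyCut]
    rcases hb.forward_admissible (C := C) (x := greedyCut n P b C k) hP le_rfl with h | h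
    · rw [h]
      exact ih
    · exact Or.inr h

theorem greedyCut_mono (n : ℕ) (P : ℕ → ℕ) (b : ℕ → ℤ) (C : ℕ) : Monotone (greedyCut n P b C) :=
  monotone_nat_of_le_succ fun _ => le_forward _ _ _ _ _

theorem greedyCut_le (hP : Monotone P) (k : ℕ) : greedyCut n P b C k ≤ P n := by
  induction k with
  | zero => exact Nat.zero_le _
  | succ k ih => exact forward_le_last hP ih le_rfl

/-- An admissible `c j` in segment `i` lies at or beyond the pulled-back point `z`. Replaying the
pull-back forwards, each of its `d` steps is matched or surpassed by a greedy step, so `c (j + d)`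
reaches `G i`. -/
theorem IsThreshold.isCutSequence_greedyCut (hP0 : P 0 = 0) (hP : Monotone P) (hC : 1 ≤ C)
    (hG : ∀ i, G i ≤ P n)
    (hb : IsThreshold n P G C d 0 b) (hgap : ∀ i < n, b i ≤ P i + C) :
    IsCutSequence (P n) C d (fun x => G (segment n P x)) (greedyCut n P b C) := by
  set c := greedyCut n P b C with hcdef
  have hmono : Monotone c := greedyCut_mono n P b C
  have hle : ∀ k, c k ≤ P n := greedyCut_le hP
  have hadm : ∀ k y, Admissible n P b y → y ≤ c k + C → y ≤ c (k + 1) := fun k y h1 h2 =>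
    hb.le_forward hP0 hP h1 h2
  refine ⟨rfl, hle, hmono, fun k => forward_le _ _ _ _ _, ?_, ?_⟩
  · have h1 : ∀ k, min k (P n) ≤ c k := by
      intro k
      induction k with
      | zero => simp
      | succ k ih =>
        have h2 : c k ≤ c (k + 1) := hmono (Nat.le_add_right k 1)
        rcases (hle k).lt_or_eq with h3 | h3
        · have h4 : c k < c (k + 1) :=
            hb.lt_forward hP0 hP hC hgap (hb.greedyCut_admissible hP k) h3
          omega
        · omega
    exact ⟨P n, le_antisymm (hle _) (by simpa using h1 (P n))⟩
  · intro j hj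
    rcases hb.greedyCut_admissible (C := C) hP j with h | h | ⟨i, h1, h2, h3, h4⟩
    · rw [← hcdef] at h; omega
    · rw [← hcdef] at h
      have : c j ≤ c (j + d) := hmono (by omega)
      exact (hG _).trans (by omega)
    · rw [← hcdef] at h2 h3 h4
      by_cases hlast : c j = P n
      · have : c j ≤ c (j + d) := hmono (by omega)
        exact (hG _).trans (by omega)
      have hseg : segment n P (c j - 1) = i := segment_eq hP h1 (by omega) (by omega)
      simp only [hseg]
      obtain ⟨z, hz, hbz⟩ := hb.spec i (Nat.zero_le i) h1
      have hzj : z ≤ c j := by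
        split_ifs at hbz with h5
        · omega
        · have h6 := hb.lt_or_eq_last hP (Nat.zero_le (i + 1)) h1
          have h7 := hle j
          omega
      -- Within segment `i` every cut from `c j` on is admissible, so greedy steps advance by the
      -- full `C` until they pass the target.
      have hstep : ∀ (t : ℕ) (y : ℤ), y ≤ P (i + 1) → y ≤ c j + t * C → y ≤ c (j + t) := by
        intro t
        induction t with
        | zero => intro y _ h; simpa using h
        | succ t ih =>
          intro y hy1 hy2
          have h5 : c j ≤ c (j + (t + 1)) := hmono (by omega)
          by_cases h6 : y ≤ c j
          · omega
          have h7 := ih (y - C) (by omega) (by push_cast at hy2; linarith)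
          have h8 := hadm (j + t) y.toNat (Or.inr ⟨i, h1, by omega, by omega, by omega⟩) (by omega)
          rw [add_assoc] at h8
          omega
      have hpull : ∀ (t : ℕ) (y z : ℤ), PullBack n P C b i t y z → z ≤ c j → y ≤ c (j + t) := by
        intro t y z hz
        induction hz with
        | base h =>
          intro hz
          rcases h with h | h
          · subst h
            simpa using hz
          · exact hstep _ _ h (by linarith)
        | @step t j' y z hij hj' hy1 hy2 _ ih =>
          intro hz
          have h5 := ih hz
          have h6 : Admissible n P b (max y (b j')).toNat := by
            by_cases h7 : b j' ≤ P (j' + 1)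
            · exact Or.inr ⟨j', hj', by omega, by omega, by omega⟩
            · rw [max_eq_right (by omega)]
              exact hb.admissible (Nat.zero_le _) hj'.le
          have h8 := hadm (j + t) _ h6 (by omega)
          rw [add_assoc] at h8
          omega
      have := hpull d _ _ hz hzj
      omega

/-- Two greedy blocks in a row exceed `C`. -/
theorem IsThreshold.greedyCut_two_mul (hP0 : P 0 = 0) (hP : Monotone P) (hC : 1 ≤ C)
    (hb : IsThreshold n P G C d 0 b) (hgap : ∀ i < n, b i ≤ P i + C) (k : ℕ) :
    min (P n) (k * C) ≤ greedyCut n P b C (2 * k) := by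
  induction k with
  | zero => simp
  | succ k ih =>
    have h1 := greedyCut_mono n P b C (show 2 * k ≤ 2 * k + 1 by omega)
    have h2 := greedyCut_mono n P b C (show 2 * k + 1 ≤ 2 * (k + 1) by omega)
    have h3 := greedyCut_le (b := b) (C := C) hP (n := n) (2 * k + 1)
    have h4 : (k + 1) * C = k * C + C := by ring
    rcases h3.lt_or_eq with h5 | h5
    · have h6 : greedyCut n P b C (2 * k + 1) < greedyCut n P b C (2 * (k + 1)) :=
        hb.lt_forward hP0 hP hC hgap (hb.greedyCut_admissible hP _) h5
      have h7 : greedyCut n P b C (2 * (k + 1)) = 0 ∨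
          Admissible n P b (greedyCut n P b C (2 * (k + 1))) := hb.greedyCut_admissible hP _
      rcases h7 with h7 | h7
      · omega
      -- Otherwise the second of the two cuts is within `C` of the start, and the first greedy step
      -- would have gone at least that far.
      · by_contra! h8
        have h9 : greedyCut n P b C (2 * (k + 1)) ≤ greedyCut n P b C (2 * k + 1) :=
          hb.le_forward (x := greedyCut n P b C (2 * k)) hP0 hP h7 (by omega)
        omega
    · omega

end Threshold

/-! ### Cutting without restrictions -/

section Free

variable {n : ℕ} {P G : ℕ → ℕ} {C d : ℕ} {b : ℕ → ℤ}

/-- With `b i = P i + 1` every cut is admissible, so greedy steps have full length. -/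
theorem forward_eq_min (hP0 : P 0 = 0) (hP : Monotone P) (hb : ∀ i < n, b i = P i + 1) {x : ℕ}
    (hx : x ≤ P n) : forward P b C x n = min (P n) (x + C) := by
  refine le_antisymm (le_min (forward_le_last hP hx le_rfl) (forward_le _ _ _ _ _)) ?_
  rcases Nat.eq_zero_or_pos (min (P n) (x + C)) with h | h
  · omega
  · obtain ⟨i, h1, h2, h3⟩ := exists_segment hP0 h (min_le_left _ _)
    exact le_forward_of_segment h1 h3 (by rw [hb i h1]; omega) (by omega)

theorem greedyCut_eq_min (hP0 : P 0 = 0) (hP : Monotone P) (hb : ∀ i < n, b i = P i + 1) (k : ℕ) :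
    greedyCut n P b C k = min (P n) (k * C) := by
  induction k with
  | zero => simp [greedyCut]
  | succ k ih =>
    rw [greedyCut, ih, forward_eq_min hP0 hP hb (min_le_left _ _)]
    have : (k + 1) * C = k * C + C := by ring
    omega

/-- A cut `j * C > P i` satisfies `(j + d) * C ≥ P i + d * C ≥ G i`. With `d = ⌈ω / C⌉` this is the
upper bound of one color more than the clique bound. -/
theorem isCutSequence_greedyCut_of_clique_le (hP0 : P 0 = 0) (hP : Monotone P) (hC : 1 ≤ C)
    (hG : ∀ i, G i ≤ P n) (hclique : ∀ i < n, G i ≤ P i + d * C)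
    (hb : ∀ i < n, b i = P i + 1) :
    IsCutSequence (P n) C d (fun x => G (segment n P x)) (greedyCut n P b C) := by
  have hc := greedyCut_eq_min (C := C) hP0 hP hb
  refine ⟨rfl, greedyCut_le hP, greedyCut_mono _ _ _ _, fun k => forward_le _ _ _ _ _,
    ⟨P n, ?_⟩, fun j hj => ?_⟩
  · rw [hc]
    exact min_eq_left (Nat.le_mul_of_pos_right _ hC)
  · obtain ⟨i, h1, h2, h3⟩ := exists_segment hP0 hj (greedyCut_le hP _)
    rw [segment_eq hP h1 (by omega) (by omega)]
    have h4 := hclique i h1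
    have h5 := hG i
    rw [hc] at h2 ⊢
    have : (j + d) * C = j * C + d * C := by ring
    omega

end Free

/-! ## Reasoning about programs -/

@[simp]
theorem State.setVar_var (s : State) (x : ℕ) (z : ℤ) (y : ℕ) :
    (s.setVar x z).var y = if y = x then z else s.var y := by
  simp [State.setVar, Function.update_apply]

@[simp]
theorem State.setVar_arr (s : State) (x : ℕ) (z : ℤ) : (s.setVar x z).arr = s.arr := rfl

@[simp]
theorem State.setArr_var (s : State) (a : ℕ) (i z : ℤ) : (s.setArr a i z).var = s.var := rfl

@[simp]
theorem State.setArr_arr (s : State) (a : ℕ) (i z : ℤ) (a' : ℕ) (j : ℤ) :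
    (s.setArr a i z).arr a' j = if a' = a ∧ j = i then z else s.arr a' j := by
  by_cases h : a' = a
  · subst h
    simp [State.setArr, Function.update_apply]
  · simp [State.setArr, h]

/-- The program assigns to variable `x`. -/
def Cmd.writesVar (x : ℕ) : Cmd → Bool
  | .skip => false
  | .assign y _ => x == y
  | .store _ _ _ => false
  | .seq p q => p.writesVar x || q.writesVar x
  | .ite _ p q => p.writesVar x || q.writesVar x
  | .while _ p => p.writesVar x

/-- The program writes to array `a`. -/
def Cmd.writesArr (a : ℕ) : Cmd → Bool
  | .skip => false
  | .assign _ _ => false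
  | .store a' _ _ => a == a'
  | .seq p q => p.writesArr a || q.writesArr a
  | .ite _ p q => p.writesArr a || q.writesArr a
  | .while _ p => p.writesArr a

/-- The memory `s'` differs from `s` at most in what `p` writes to. -/
structure Frame (p : Cmd) (s s' : State) : Prop where
  var : ∀ x, p.writesVar x = false → s'.var x = s.var x
  arr : ∀ a, p.writesArr a = false → s'.arr a = s.arr a

theorem Frame.refl (p : Cmd) (s : State) : Frame p s s := ⟨fun _ _ => rfl, fun _ _ => rfl⟩

theorem Frame.trans {p : Cmd} {s s' s'' : State} (h : Frame p s s') (h' : Frame p s' s'') :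
    Frame p s s'' :=
  ⟨fun x hx => (h'.var x hx).trans (h.var x hx), fun a ha => (h'.arr a ha).trans (h.arr a ha)⟩

theorem Frame.mono {p q : Cmd} {s s' : State} (h : Frame p s s')
    (hv : ∀ x, q.writesVar x = false → p.writesVar x = false)
    (ha : ∀ x, q.writesArr x = false → p.writesArr x = false) : Frame q s s' :=
  ⟨fun x hx => h.var x (hv x hx), fun a h' => h.arr a (ha a h')⟩

variable {E : Side → ℤ → ℝ} {B : ℤ}

/-- Loop invariants need to mention only what changes; for concrete programs the side conditions on
`writesVar` and `writesArr` hold by `rfl`. -/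
theorem Exec.frame {p : Cmd} {s s' : State} {T : ℕ} (h : Exec E B p s T s') : Frame p s s' := by
  induction h with
  | skip s => exact .refl _ s
  | assign x e s he =>
    refine ⟨fun y hy => ?_, fun a _ => rfl⟩
    simp only [Cmd.writesVar, beq_eq_false_iff_ne, ne_eq] at hy
    simp [hy]
  | store a i e s hi he =>
    refine ⟨fun y _ => rfl, fun a' ha => ?_⟩
    simp only [Cmd.writesArr, beq_eq_false_iff_ne, ne_eq] at ha
    funext j
    simp [ha]
  | seq _ _ ih₁ ih₂ =>
    refine (ih₁.mono ?_ ?_).trans (ih₂.mono ?_ ?_) <;> intro x hx <;>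
      simp_all [Cmd.writesVar, Cmd.writesArr]
  | ite_true _ _ ih =>
    refine ih.mono ?_ ?_ <;> intro x hx <;> simp_all [Cmd.writesVar, Cmd.writesArr]
  | ite_false _ _ ih =>
    refine ih.mono ?_ ?_ <;> intro x hx <;> simp_all [Cmd.writesVar, Cmd.writesArr]
  | while_true _ _ _ ih₁ ih₂ =>
    refine (ih₁.mono ?_ ?_).trans ih₂ <;> intro x hx <;> simpa [Cmd.writesVar, Cmd.writesArr] using hx
  | while_false _ => exact .refl _ _

/-- Started in `s`, the program `p` halts within `t` steps in a memory that satisfies `Q`. -/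
def Run (E : Side → ℤ → ℝ) (B : ℤ) (p : Cmd) (s : State) (t : ℕ) (Q : State → Prop) : Prop :=
  ∃ (T : ℕ) (s' : State), Exec E B p s T s' ∧ T ≤ t ∧ Q s'

namespace Run

variable {p q : Cmd} {s : State} {t t₁ t₂ : ℕ} {Q R : State → Prop}

theorem mono (h : Run E B p s t₁ R) (ht : t₁ ≤ t) (hQ : ∀ s', R s' → Q s') : Run E B p s t Q :=
  let ⟨T, s', h₁, h₂, h₃⟩ := h
  ⟨T, s', h₁, h₂.trans ht, hQ s' h₃⟩

theorem frame (h : Run E B p s t Q) : Run E B p s t (fun s' => Q s' ∧ Frame p s s') :=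
  let ⟨T, s', h₁, h₂, h₃⟩ := h
  ⟨T, s', h₁, h₂, h₃, h₁.frame⟩

theorem skip (ht : 1 ≤ t) (hQ : Q s) : Run E B .skip s t Q := ⟨1, s, .skip s, ht, hQ⟩

theorem assign {x : ℕ} {e : AExp} {v : ℤ} (he : e.eval E s = v) (hv : |v| ≤ B)
    (ht : e.size + 1 ≤ t) (hQ : Q (s.setVar x v)) : Run E B (.assign x e) s t Q :=
  ⟨_, _, .assign x e s (he ▸ hv), ht, he ▸ hQ⟩

theorem store {a : ℕ} {i e : AExp} {u v : ℤ} (hi : i.eval E s = u) (he : e.eval E s = v)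
    (hu : |u| ≤ B) (hv : |v| ≤ B) (ht : i.size + e.size + 1 ≤ t) (hQ : Q (s.setArr a u v)) :
    Run E B (.store a i e) s t Q :=
  ⟨_, _, .store a i e s (hi ▸ hu) (he ▸ hv), ht, hi ▸ he ▸ hQ⟩

theorem seq (hp : Run E B p s t₁ R) (hq : ∀ s', R s' → Run E B q s' t₂ Q) (ht : t₁ + t₂ ≤ t) :
    Run E B (.seq p q) s t Q := by
  obtain ⟨T₁, s₁, h₁, h₂, h₃⟩ := hp
  obtain ⟨T₂, s₂, h₄, h₅, h₆⟩ := hq s₁ h₃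
  exact ⟨_, s₂, .seq h₁ h₄, by omega, h₆⟩

theorem assign_seq {x : ℕ} {e : AExp} {v : ℤ} (he : e.eval E s = v) (hv : |v| ≤ B)
    (hq : Run E B q (s.setVar x v) t₂ Q) (ht : e.size + 1 + t₂ ≤ t) :
    Run E B (.seq (.assign x e) q) s t Q :=
  seq (R := fun s' => s' = s.setVar x v) (assign he hv le_rfl rfl) (fun _ h => h ▸ hq) ht

theorem store_seq {a : ℕ} {i e : AExp} {u v : ℤ} (hi : i.eval E s = u) (he : e.eval E s = v)
    (hu : |u| ≤ B) (hv : |v| ≤ B) (hq : Run E B q (s.setArr a u v) t₂ Q)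
    (ht : i.size + e.size + 1 + t₂ ≤ t) : Run E B (.seq (.store a i e) q) s t Q :=
  seq (R := fun s' => s' = s.setArr a u v) (store hi he hu hv le_rfl rfl) (fun _ h => h ▸ hq) ht

theorem ite {e : AExp} (hp : e.eval E s ≠ 0 → Run E B p s t₁ Q)
    (hq : e.eval E s = 0 → Run E B q s t₁ Q) (ht : e.size + 1 + t₁ ≤ t) :
    Run E B (.ite e p q) s t Q := by
  by_cases h : e.eval E s = 0
  · obtain ⟨T, s', h₁, h₂, h₃⟩ := hq h
    exact ⟨_, s', .ite_false h h₁, by omega, h₃⟩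
  · obtain ⟨T, s', h₁, h₂, h₃⟩ := hp h
    exact ⟨_, s', .ite_true h h₁, by omega, h₃⟩

end Run

/-- Execute `body` for the values `0, 1, …` of variable `x` below the value of variable `y`. -/
def Cmd.forLoop (x y : ℕ) (body : Cmd) : Cmd :=
  .seq (.assign x (.const 0))
    (.while (.bin .le (.bin .add (.var x) (.const 1)) (.var y))
      (.seq body (.assign x (.bin .add (.var x) (.const 1)))))

/-- Each round costs `6` for the guard and `4` for the increment besides the body; the initial
assignment and the last guard cost `2 + 6`. The hypothesis `hI` says that the invariant ignores the
counter, whose value is supplied separately. -/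
theorem Run.forLoop {x y : ℕ} {body : Cmd} {s : State} {m tb : ℕ} {I : ℕ → State → Prop}
    (hxy : x ≠ y) (hbx : body.writesVar x = false) (hby : body.writesVar y = false)
    (hm : s.var y = m) (hB : (m : ℤ) + 1 ≤ B) (h0 : I 0 s)
    (hI : ∀ k s' z, I k s' → I k (s'.setVar x z))
    (hbody : ∀ k < m, ∀ s', s'.var x = (k : ℤ) → Frame (Cmd.forLoop x y body) s s' → I k s' →
      Run E B body s' tb (I (k + 1))) :
    Run E B (Cmd.forLoop x y body) s (m * (tb + 10) + 8)
      (fun s' => I m s' ∧ Frame (Cmd.forLoop x y body) s s') := by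
  refine Run.frame ?_
  have hloop : ∀ e k, k + e = m → ∀ s', s'.var x = (k : ℤ) → Frame (Cmd.forLoop x y body) s s' →
      I k s' → Run E B (.while (.bin .le (.bin .add (.var x) (.const 1)) (.var y))
        (.seq body (.assign x (.bin .add (.var x) (.const 1))))) s' (e * (tb + 10) + 6) (I m) := by
    intro e
    have hyF : ∀ s', Frame (Cmd.forLoop x y body) s s' → s'.var y = m := by
      intro s' hF
      rw [← hm]
      refine hF.var y ?_
      simp [Cmd.forLoop, Cmd.writesVar, hby, hxy.symm]
    induction e with
    | zero =>
      intro k hk s' hx hF hI'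
      have hk' : k = m := by omega
      subst hk'
      refine ⟨_, s', .while_false ?_, by simp [AExp.size], hI'⟩
      simp [AExp.eval, BinOp.eval, hx, hyF s' hF]
    | succ e ih =>
      intro k hk s' hx hF hI'
      obtain ⟨T, s₁, h₁, h₂, h₃⟩ := hbody k (by omega) s' hx hF hI'
      have hF₁ := h₁.frame
      have hx₁ : s₁.var x = k := by rw [hF₁.var x hbx, hx]
      have hev : (AExp.bin .add (.var x) (.const 1)).eval E s₁ = (k + 1 : ℕ) := by
        simp [AExp.eval, BinOp.eval, hx₁]
      have h₄ : Exec E B (.assign x (.bin .add (.var x) (.const 1))) s₁ 4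
          (s₁.setVar x (k + 1 : ℕ)) := by
        have := Exec.assign (E := E) (B := B) x (.bin .add (.var x) (.const 1)) s₁
          (by rw [hev, abs_of_nonneg (by positivity)]; push_cast; omega)
        rwa [hev] at this
      have h₅ := Exec.seq h₁ h₄
      have hF₂ : Frame (Cmd.forLoop x y body) s (s₁.setVar x (k + 1 : ℕ)) :=
        hF.trans (h₅.frame.mono
          (fun v hv => by simp_all [Cmd.forLoop, Cmd.writesVar])
          (fun v hv => by simp_all [Cmd.forLoop, Cmd.writesArr]))
      obtain ⟨T', s₂, h₆, h₇, h₈⟩ := ih (k + 1) (by omega) (s₁.setVar x (k + 1 : ℕ)) (by simp) hF₂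
        (hI _ _ _ h₃)
      refine ⟨_, s₂, .while_true ?_ h₅ h₆, ?_, h₈⟩
      · have : (k : ℤ) + 1 ≤ m := by omega
        simp [AExp.eval, BinOp.eval, hx, hyF s' hF, this]
      · have : (e + 1) * (tb + 10) = e * (tb + 10) + tb + 10 := by ring
        simp only [AExp.size]
        omega
  refine Run.assign_seq (v := 0) (t₂ := m * (tb + 10) + 6) rfl ?_ (hloop m 0 (by omega) _
    (by simp) ?_ (hI _ _ _ h0)) (by simp only [AExp.size]; omega)
  · simp only [abs_zero]
    omega
  · refine ⟨fun v hv => ?_, fun _ _ => rfl⟩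
    have : v ≠ x := by
      rintro rfl
      simp [Cmd.forLoop, Cmd.writesVar] at hv
    simp [this]

/-! ## The first pass: order and prefix sums

Variables `2`, `3` run over the vertices, `4`, `5`, `6` are the rank, the prefix weight and the
reach weight of a vertex, `7` is the weight of the heaviest clique, `8` the total weight. Arrays `4`,
`5`, `6` hold, indexed by ranks, the vertices, the prefix weights and the reach weights. -/

/-- `1` if vertex `u` (variable `3`) is before vertex `v` (variable `2`), otherwise `0`. -/
def beforeExp : AExp :=
  .bin .mul (.endLe .left (.var 3) .left (.var 2))
    (.bin .sub (.const 1) (.bin .mul (.endLe .left (.var 2) .left (.var 3))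
      (.bin .sub (.const 1) (.bin .le (.bin .add (.var 3) (.const 1)) (.var 2)))))

/-- Take vertex `u` into account in the sums for vertex `v`. -/
def compareCmd : Cmd :=
  .seq (.assign 27 beforeExp)
  (.seq (.assign 4 (.bin .add (.var 4) (.var 27)))
  (.seq (.assign 5 (.bin .add (.var 5) (.bin .mul (.var 27) (.get 0 (.var 3)))))
    (.assign 6 (.bin .add (.var 6)
      (.bin .mul (.endLe .left (.var 3) .right (.var 2)) (.get 0 (.var 3)))))))

/-- Record the sums for vertex `v`. -/
def recordCmd : Cmd :=
  .seq (.store 4 (.var 4) (.var 2))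
  (.seq (.store 5 (.var 4) (.var 5))
  (.seq (.store 6 (.var 4) (.var 6))
  (.seq (.ite (.bin .le (.bin .add (.var 7) (.const 1)) (.bin .sub (.var 6) (.var 5)))
      (.assign 7 (.bin .sub (.var 6) (.var 5))) .skip)
    (.assign 8 (.bin .add (.var 8) (.get 0 (.var 2)))))))

def rankVertexCmd : Cmd :=
  .seq (.assign 4 (.const 0)) (.seq (.assign 5 (.const 0)) (.seq (.assign 6 (.const 0))
    (.seq (Cmd.forLoop 3 0 compareCmd) recordCmd)))

/-- The final store puts the total weight into cell `n` of array `5`, so that the end of the last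
segment can be read like the others. -/
def rankPass : Cmd :=
  .seq (Cmd.forLoop 2 0 rankVertexCmd) (.store 5 (.var 0) (.var 8))

section PartialSums

variable {n : ℕ}

/-- The sum of the first `k` values. -/
def partialSum (f : Fin n → ℕ) (k : ℕ) : ℕ := ∑ u ∈ Finset.univ.filter (fun u : Fin n => (u : ℕ) < k), f u

theorem partialSum_zero (f : Fin n → ℕ) : partialSum f 0 = 0 := by simp [partialSum]

theorem partialSum_succ (f : Fin n → ℕ) (v : Fin n) :
    partialSum f (v + 1) = partialSum f v + f v := by
  unfold partialSum
  have : (Finset.univ.filter fun u : Fin n => (u : ℕ) < v + 1) =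
      insert v (Finset.univ.filter fun u : Fin n => (u : ℕ) < v) := by
    ext u
    simp only [Finset.mem_filter, Finset.mem_univ, true_and, Finset.mem_insert, Fin.ext_iff]
    omega
  rw [this, Finset.sum_insert (by simp), add_comm]

theorem partialSum_self (f : Fin n → ℕ) : partialSum f n = ∑ u, f u := by
  simp [partialSum]

theorem partialSum_le (f : Fin n → ℕ) (k : ℕ) : partialSum f k ≤ ∑ u, f u :=
  Finset.sum_le_sum_of_subset (Finset.filter_subset _ _)

end PartialSums

section Endpoints

variable {n : ℕ} (lft rgt : Fin n → ℝ)

@[simp]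
theorem endpoint_left (v : Fin n) : endpoint lft rgt .left (v : ℕ) = lft v := by
  simp [endpoint]

@[simp]
theorem endpoint_right (v : Fin n) : endpoint lft rgt .right (v : ℕ) = rgt v := by
  simp [endpoint]

open Classical in
theorem eval_beforeExp {s : State} {u v : Fin n} (hu : s.var 3 = (u : ℕ)) (hv : s.var 2 = (v : ℕ)) :
    beforeExp.eval (endpoint lft rgt) s = if Before lft u v then 1 else 0 := by
  simp only [beforeExp, AExp.eval, BinOp.eval, hu, hv, endpoint_left, Before]
  have h1 : ((u : ℕ) : ℤ) + 1 ≤ ((v : ℕ) : ℤ) ↔ u < v := by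
    rw [Fin.lt_def]
    omega
  rw [if_congr h1 rfl rfl]
  rcases lt_trichotomy (lft u) (lft v) with h | h | h
  · simp [h, h.le, not_le.mpr h]
  · by_cases h2 : u < v <;> simp [h, h2]
  · simp [not_le.mpr h, not_lt.mpr h.le, h.ne']

open Classical in
theorem rankNat_eq_sum (v : Fin n) : rankNat lft v = ∑ u, if Before lft u v then 1 else 0 := by
  rw [rankNat, Finset.card_filter]

open Classical in
theorem prefixWeight_rankNat (W : Fin n → ℕ) (v : Fin n) :
    prefixWeight lft W (rankNat lft v) = ∑ u, if Before lft u v then W u else 0 := by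
  rw [prefixWeight, Finset.sum_filter]
  simp only [rankNat_lt_iff]

open Classical in
theorem reachWeight_rankNat_eq_sum (W : Fin n → ℕ) (v : Fin n) :
    reachWeight lft rgt W (rankNat lft v) = ∑ u, if lft u ≤ rgt v then W u else 0 := by
  rw [reachWeight_rankNat, Finset.sum_filter]

end Endpoints

/-- What the first pass leaves in the memory. -/
structure Ranked {n : ℕ} (lft rgt : Fin n → ℝ) (W : Fin n → ℕ) (C : ℕ) (s : State) : Prop where
  card : s.var 0 = n
  bound : s.var 1 = C
  total : s.var 8 = (∑ v, W v : ℕ)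
  order : ∀ v, s.arr 4 (rankNat lft v : ℕ) = (v : ℕ)
  pre : ∀ r ≤ n, s.arr 5 (r : ℕ) = prefixWeight lft W r
  reach : ∀ r < n, s.arr 6 (r : ℕ) = reachWeight lft rgt W r

/-- The variable `7` holds the weight of the heaviest clique. -/
structure HoldsCliqueWeight {n : ℕ} (lft rgt : Fin n → ℝ) (W : Fin n → ℕ) (s : State) : Prop where
  nonneg : 0 ≤ s.var 7
  le_total : s.var 7 ≤ (∑ v, W v : ℕ)
  le : ∀ r < n, (reachWeight lft rgt W r : ℤ) - prefixWeight lft W r ≤ s.var 7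
  attained : s.var 7 = 0 ∨
    ∃ r < n, s.var 7 = (reachWeight lft rgt W r : ℤ) - prefixWeight lft W r

section RankPass

variable {n C : ℕ} (lft rgt : Fin n → ℝ) (W : Fin n → ℕ) {B : ℤ}

open Classical in
/-- The state of the sums for vertex `v` after `k` vertices have been compared with it. -/
def SumsUpTo (v : Fin n) (k : ℕ) (s : State) : Prop :=
  s.var 4 = partialSum (fun u => if Before lft u v then 1 else 0) k ∧
  s.var 5 = partialSum (fun u => if Before lft u v then W u else 0) k ∧
  s.var 6 = partialSum (fun u => if lft u ≤ rgt v then W u else 0) k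

theorem run_compareCmd (hB : (4 * (n + C + ∑ v, W v + 2) : ℕ) ≤ B) {s : State} {u v : Fin n}
    (hu : s.var 3 = (u : ℕ)) (hv : s.var 2 = (v : ℕ)) (hW : ∀ v : Fin n, s.arr 0 (v : ℕ) = W v)
    (hs : SumsUpTo lft rgt W v u s) :
    Run (endpoint lft rgt) B compareCmd s 60 (SumsUpTo lft rgt W v (u + 1)) := by
  classical
  obtain ⟨h4, h5, h6⟩ := hs
  have hWu : W u ≤ ∑ v, W v := Finset.single_le_sum (fun _ _ => Nat.zero_le _) (Finset.mem_univ u)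
  have b4 := partialSum_le (fun u => if Before lft u v then 1 else 0) (u + 1)
  rw [← rankNat_eq_sum] at b4
  have b4' := rankNat_lt lft v
  have b5 := partialSum_le (fun u => if Before lft u v then W u else 0) (u + 1)
  rw [← prefixWeight_rankNat] at b5
  have b5' := prefixWeight_le lft W (rankNat lft v)
  have b6 := partialSum_le (fun u => if lft u ≤ rgt v then W u else 0) (u + 1)
  rw [← reachWeight_rankNat_eq_sum] at b6
  have b6' := reachWeight_le lft rgt W (rankNat lft v)
  refine Run.assign_seq (t₂ := 40) (eval_beforeExp lft rgt hu hv) ?_ ?_ (by decide)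
  · split_ifs <;> simp <;> omega
  refine Run.assign_seq (t₂ := 30)
    (v := partialSum (fun u => if Before lft u v then 1 else 0) (u + 1)) ?_ ?_ ?_ (by decide)
  · rw [partialSum_succ]
    simp [AExp.eval, BinOp.eval, h4]
  · rw [abs_of_nonneg (by positivity)]
    omega
  refine Run.assign_seq (t₂ := 20)
    (v := partialSum (fun u => if Before lft u v then W u else 0) (u + 1)) ?_ ?_ ?_ (by decide)
  · rw [partialSum_succ (fun u => if Before lft u v then W u else 0)]
    simp [AExp.eval, BinOp.eval, h5, hu, hW]
  · rw [abs_of_nonneg (by positivity)]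
    omega
  refine Run.assign (v := partialSum (fun u => if lft u ≤ rgt v then W u else 0) (u + 1))
    ?_ ?_ (by decide) ?_
  · rw [partialSum_succ (fun u => if lft u ≤ rgt v then W u else 0)]
    simp [AExp.eval, BinOp.eval, h6, hu, hv, hW]
  · rw [abs_of_nonneg (by positivity)]
    omega
  · simp [SumsUpTo]

/-- The state of the first pass after `k` vertices. -/
structure RankedUpTo (k : ℕ) (s : State) : Prop where
  order : ∀ v : Fin n, (v : ℕ) < k → s.arr 4 (rankNat lft v : ℕ) = (v : ℕ)
  pre : ∀ v : Fin n, (v : ℕ) < k →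
    s.arr 5 (rankNat lft v : ℕ) = prefixWeight lft W (rankNat lft v)
  reach : ∀ v : Fin n, (v : ℕ) < k →
    s.arr 6 (rankNat lft v : ℕ) = reachWeight lft rgt W (rankNat lft v)
  total : s.var 8 = partialSum W k
  nonneg : 0 ≤ s.var 7
  le_total : s.var 7 ≤ (∑ v, W v : ℕ)
  le : ∀ v : Fin n, (v : ℕ) < k →
    (reachWeight lft rgt W (rankNat lft v) : ℤ) - prefixWeight lft W (rankNat lft v) ≤ s.var 7
  attained : s.var 7 = 0 ∨
    ∃ r < n, s.var 7 = (reachWeight lft rgt W r : ℤ) - prefixWeight lft W r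

theorem run_recordCmd (hB : (4 * (n + C + ∑ v, W v + 2) : ℕ) ≤ B) {s : State} {v : Fin n}
    (hv : s.var 2 = (v : ℕ)) (hW : ∀ v : Fin n, s.arr 0 (v : ℕ) = W v)
    (hs : SumsUpTo lft rgt W v n s) (hr : RankedUpTo lft rgt W v s) :
    Run (endpoint lft rgt) B recordCmd s 60 (RankedUpTo lft rgt W (v + 1)) := by
  classical
  obtain ⟨h4, h5, h6⟩ := hs
  rw [partialSum_self, ← rankNat_eq_sum] at h4
  rw [partialSum_self, ← prefixWeight_rankNat] at h5
  rw [partialSum_self, ← reachWeight_rankNat_eq_sum] at h6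
  have b4 := rankNat_lt lft v
  have b5 := prefixWeight_le lft W (rankNat lft v)
  have b6 := reachWeight_le lft rgt W (rankNat lft v)
  have bt := partialSum_le W (v + 1)
  have hvn := v.2
  have hlt : ∀ u : Fin n, (u : ℕ) < v + 1 → (u : ℕ) < v ∨ u = v := fun u hu => by
    rw [Fin.ext_iff]; omega
  refine Run.store_seq (t₂ := 50) (u := rankNat lft v) (v := (v : ℕ)) (by simp [AExp.eval, h4])
    (by simp [AExp.eval, hv]) ?_ ?_ ?_ (by decide)
  · rw [abs_of_nonneg (by positivity)]; omega
  · rw [abs_of_nonneg (by positivity)]; omega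
  refine Run.store_seq (t₂ := 40) (u := rankNat lft v) (v := prefixWeight lft W (rankNat lft v))
    (by simp [AExp.eval, h4]) (by simp [AExp.eval, h5]) ?_ ?_ ?_ (by decide)
  · rw [abs_of_nonneg (by positivity)]; omega
  · rw [abs_of_nonneg (by positivity)]; omega
  refine Run.store_seq (t₂ := 30) (u := rankNat lft v) (v := reachWeight lft rgt W (rankNat lft v))
    (by simp [AExp.eval, h4]) (by simp [AExp.eval, h6]) ?_ ?_ ?_ (by decide)
  · rw [abs_of_nonneg (by positivity)]; omega
  · rw [abs_of_nonneg (by positivity)]; omega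
  -- The invariant is stated for the memory after the pending update of variable `8`, the only
  -- assignment left.
  refine Run.seq (t₁ := 20) (t₂ := 10) (R := fun s' => s'.var 2 = (v : ℕ) ∧
    (∀ v : Fin n, s'.arr 0 (v : ℕ) = W v) ∧ s'.var 8 = partialSum W v ∧
    RankedUpTo lft rgt W (v + 1) (s'.setVar 8 (partialSum W (v + 1)))) ?_ ?_ (by decide)
  · have main : ∀ om : ℤ, 0 ≤ om → om ≤ (∑ v, W v : ℕ) → s.var 7 ≤ om →
        (reachWeight lft rgt W (rankNat lft v) : ℤ) - prefixWeight lft W (rankNat lft v) ≤ om →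
        (om = 0 ∨ ∃ r < n, om = (reachWeight lft rgt W r : ℤ) - prefixWeight lft W r) →
        ∀ s' : State, s'.var 7 = om → s'.var 8 = partialSum W (v + 1) →
        s'.arr = (((s.setArr 4 (rankNat lft v) (v : ℕ)).setArr 5 (rankNat lft v)
          (prefixWeight lft W (rankNat lft v))).setArr 6 (rankNat lft v)
          (reachWeight lft rgt W (rankNat lft v))).arr → RankedUpTo lft rgt W (v + 1) s' := by
      intro om h1 h2 h3 h4 h5 s' hs7 hs8 harr
      have hinj : ∀ u : Fin n, ((rankNat lft u : ℕ) : ℤ) = rankNat lft v ↔ u = v := fun u => by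
        rw [Nat.cast_inj, (rankNat_injective lft).eq_iff]
      refine ⟨?_, ?_, ?_, hs8, by omega, by omega, ?_, by rw [hs7]; exact h5⟩
      · intro u hu
        rw [harr]
        rcases hlt u hu with hu | rfl
        · have : u ≠ v := by rintro rfl; exact lt_irrefl _ hu
          simp [hinj, this, hr.order u hu]
        · simp
      · intro u hu
        rw [harr]
        rcases hlt u hu with hu | rfl
        · have : u ≠ v := by rintro rfl; exact lt_irrefl _ hu
          simp [hinj, this, hr.pre u hu]
        · simp
      · intro u hu
        rw [harr]
        rcases hlt u hu with hu | rfl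
        · have : u ≠ v := by rintro rfl; exact lt_irrefl _ hu
          simp [hinj, this, hr.reach u hu]
        · simp
      · intro u hu
        rw [hs7]
        rcases hlt u hu with hu | rfl
        · exact (hr.le u hu).trans h3
        · exact h4
    have hnn := hr.nonneg
    have hle := hr.le_total
    refine Run.ite (t₁ := 10) ?_ ?_ (by decide)
    · intro hcond
      simp only [AExp.eval, BinOp.eval, State.setArr_var, h5, h6] at hcond
      have hcond' : s.var 7 + 1 ≤ (reachWeight lft rgt W (rankNat lft v) : ℤ) -
          prefixWeight lft W (rankNat lft v) := by
        by_contra hc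
        simp [hc] at hcond
      refine Run.assign (v := (reachWeight lft rgt W (rankNat lft v) : ℤ) -
        prefixWeight lft W (rankNat lft v)) (by simp [AExp.eval, BinOp.eval, h5, h6]) ?_
        (by decide) ⟨by simp [hv], by simp [hW], by simp [hr.total], ?_⟩
      · rw [abs_of_nonneg (by omega)]; omega
      · exact main _ (by omega) (by omega) (by omega) le_rfl (Or.inr ⟨_, b4, rfl⟩) _ (by simp)
          (by simp) rfl
    · intro hcond
      simp only [AExp.eval, BinOp.eval, State.setArr_var, h5, h6] at hcond
      have hcond' : ¬ s.var 7 + 1 ≤ (reachWeight lft rgt W (rankNat lft v) : ℤ) -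
          prefixWeight lft W (rankNat lft v) := by
        intro hc
        simp [hc] at hcond
      refine Run.skip (by decide) ⟨by simp [hv], by simp [hW], by simp [hr.total], ?_⟩
      exact main (s.var 7) hnn hle le_rfl (by omega) hr.attained _ (by simp) (by simp) rfl
  · rintro s' ⟨h1, h2, h3, h7⟩
    refine Run.assign (v := partialSum W (v + 1)) ?_ ?_ (by decide) h7
    · simp [AExp.eval, BinOp.eval, h1, h2, h3, partialSum_succ]
    · rw [abs_of_nonneg (by positivity)]; omega

theorem run_rankVertexCmd (hB : (4 * (n + C + ∑ v, W v + 2) : ℕ) ≤ B) {s : State} {v : Fin n}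
    (hn : s.var 0 = n)
    (hv : s.var 2 = (v : ℕ)) (hW : ∀ v : Fin n, s.arr 0 (v : ℕ) = W v)
    (hr : RankedUpTo lft rgt W v s) :
    Run (endpoint lft rgt) B rankVertexCmd s (70 * n + 80) (RankedUpTo lft rgt W (v + 1)) := by
  have h0 : |(0 : ℤ)| ≤ B := by simp; omega
  refine Run.assign_seq (v := 0) (t₂ := 70 * n + 78) rfl h0 ?_ (by simp [AExp.size]; omega)
  refine Run.assign_seq (v := 0) (t₂ := 70 * n + 76) rfl h0 ?_ (by simp [AExp.size]; omega)
  refine Run.assign_seq (v := 0) (t₂ := 70 * n + 74) rfl h0 ?_ (by simp [AExp.size]; omega)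
  set s₁ := ((s.setVar 4 0).setVar 5 0).setVar 6 0 with hs₁
  refine Run.seq (t₁ := n * (60 + 10) + 8) (t₂ := 60)
    (Run.forLoop (I := SumsUpTo lft rgt W v) (m := n) (tb := 60) (by decide) rfl rfl ?_ ?_ ?_ ?_ ?_)
    ?_ (by omega)
  · simp [hs₁, hn]
  · omega
  · simp [hs₁, SumsUpTo, partialSum_zero]
  · intro k s' z h
    simpa [SumsUpTo] using h
  · intro k hk s' hx hF hI
    refine run_compareCmd lft rgt W hB (u := ⟨k, hk⟩) hx ?_ ?_ hI
    · rw [hF.var 2 rfl, ← hv]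
      simp [hs₁]
    · intro u
      rw [hF.arr 0 rfl, ← hW]
      simp [hs₁]
  · rintro s' ⟨hI, hF⟩
    refine run_recordCmd lft rgt W hB ?_ ?_ hI ?_
    · rw [hF.var 2 rfl, ← hv]
      simp [hs₁]
    · intro u
      rw [hF.arr 0 rfl, ← hW]
      simp [hs₁]
    · obtain ⟨a1, a2, a3, a4, a5, a6, a7, a8⟩ := hr
      have e7 : s'.var 7 = s.var 7 := by rw [hF.var 7 rfl]; simp [hs₁]
      have e8 : s'.var 8 = s.var 8 := by rw [hF.var 8 rfl]; simp [hs₁]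
      have e4 : s'.arr 4 = s.arr 4 := by rw [hF.arr 4 rfl]; simp [hs₁]
      have e5 : s'.arr 5 = s.arr 5 := by rw [hF.arr 5 rfl]; simp [hs₁]
      have e6 : s'.arr 6 = s.arr 6 := by rw [hF.arr 6 rfl]; simp [hs₁]
      exact ⟨by rwa [e4], by rwa [e5], by rwa [e6], by rwa [e8], by rwa [e7], by rwa [e7],
        by rwa [e7], by rwa [e7]⟩

theorem run_rankPass (hB : (4 * (n + C + ∑ v, W v + 2) : ℕ) ≤ B) :
    Run (endpoint lft rgt) B rankPass (initState W C) (n * (70 * n + 90) + 12)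
      (fun s => Ranked lft rgt W C s ∧ HoldsCliqueWeight lft rgt W s) := by
  have hvar0 : (initState W C).var 0 = n := rfl
  have hW : ∀ v : Fin n, (initState W C).arr 0 (v : ℕ) = W v := by
    intro v
    simp [initState]
  refine Run.seq (t₁ := n * (70 * n + 80 + 10) + 8) (t₂ := 4)
    (Run.forLoop (I := RankedUpTo lft rgt W) (m := n) (tb := 70 * n + 80) (by decide) rfl rfl
      hvar0 ?_ ?_ ?_ ?_) ?_ (by ring_nf; omega)
  · omega
  · refine ⟨by simp, by simp, by simp, ?_, ?_, ?_, by simp, Or.inl ?_⟩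
    · simp [initState, partialSum_zero]
    · simp [initState]
    · simp only [initState]
      positivity
    · simp [initState]
  · intro k s' z h
    exact ⟨h.order, h.pre, h.reach, by simpa using h.total, by simpa using h.nonneg,
      by simpa using h.le_total, by simpa using h.le, by simpa using h.attained⟩
  · intro k hk s' hx hF hI
    refine run_rankVertexCmd lft rgt W hB (v := ⟨k, hk⟩) ?_ hx ?_ hI
    · rw [hF.var 0 rfl, hvar0]
    · intro v
      rw [hF.arr 0 rfl, hW]
  · rintro s' ⟨hI, hF⟩
    have e0 : s'.var 0 = n := by rw [hF.var 0 rfl, hvar0]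
    have e1 : s'.var 1 = C := by rw [hF.var 1 rfl]; rfl
    have e8 : s'.var 8 = (∑ v, W v : ℕ) := by rw [hI.total, partialSum_self]
    have hsurj : ∀ r < n, ∃ v : Fin n, rankNat lft v = r := fun r hr =>
      ⟨(rank lft).symm ⟨r, hr⟩, rankNat_rank_symm lft ⟨r, hr⟩⟩
    refine Run.store (u := n) (v := (∑ v, W v : ℕ)) (by simp [AExp.eval, e0])
      (by simp [AExp.eval, e8]) ?_ ?_ (by decide) ⟨⟨by simp [e0], by simp [e1], by simp [e8],
        ?_, ?_, ?_⟩, ⟨hI.nonneg, hI.le_total, ?_, hI.attained⟩⟩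
    · rw [abs_of_nonneg (by positivity)]; omega
    · rw [abs_of_nonneg (by positivity)]; omega
    · intro v
      simpa using hI.order v v.2
    · intro r hr
      rcases hr.lt_or_eq with hr | rfl
      · obtain ⟨v, rfl⟩ := hsurj r hr
        have : ((rankNat lft v : ℕ) : ℤ) ≠ n := by omega
        simpa [this] using hI.pre v v.2
      · simp [prefixWeight_of_ge]
    · intro r hr
      obtain ⟨v, rfl⟩ := hsurj r hr
      simpa using hI.reach v v.2
    · intro r hr
      obtain ⟨v, rfl⟩ := hsurj r hr
      simpa using hI.le v v.2

end RankPass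

/-! ## The second pass: admissible cuts

Variable `10` is the number of colors minus one, `11` tells whether the test has not failed so far.
For the vertex of rank `13`, the variables `14` and `15` are the cut that is to be reached and the number
of steps that are left. Array `7` holds the least admissible cut of every segment. -/

/-- Pull back through segment `17`. -/
def pullStepCmd : Cmd :=
  .seq (.assign 17 (.bin .sub (.bin .sub (.var 0) (.const 1)) (.var 16)))
    (.ite (.bin .mul (.bin .le (.bin .add (.var 13) (.const 1)) (.var 17))
        (.bin .le (.bin .add (.get 5 (.var 17)) (.const 1)) (.var 14)))
      (.seq (.assign 18 (.bin .add (.bin .div (.bin .sub (.var 14) (.get 7 (.var 17))) (.var 1))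
        (.const 1)))
      (.seq (.ite (.bin .le (.var 15) (.var 18)) (.assign 18 (.var 15)) .skip)
      (.seq (.assign 14 (.bin .sub (.var 14) (.bin .mul (.var 18) (.var 1))))
      (.seq (.assign 15 (.bin .sub (.var 15) (.var 18)))
        (.ite (.bin .mul (.bin .le (.bin .add (.get 5 (.var 17)) (.const 1)) (.var 14))
            (.bin .le (.const 1) (.var 15)))
          (.seq (.assign 14 (.bin .sub (.get 7 (.var 17)) (.var 1)))
            (.assign 15 (.bin .sub (.var 15) (.const 1))))
          .skip)))))
      .skip)

/-- Store the least admissible cut of segment `13`. -/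
def storeThresholdCmd : Cmd :=
  .seq (.assign 19 (.bin .sub (.var 14) (.bin .mul (.var 15) (.var 1))))
  (.seq (.ite (.bin .le (.var 19) (.get 5 (.var 13)))
      (.assign 19 (.bin .add (.get 5 (.var 13)) (.const 1))) .skip)
  (.seq (.ite (.bin .le (.var 19) (.get 5 (.bin .add (.var 13) (.const 1))))
      (.store 7 (.var 13) (.var 19))
      (.store 7 (.var 13) (.get 7 (.bin .add (.var 13) (.const 1)))))
    (.ite (.bin .le (.get 7 (.var 13)) (.bin .add (.get 5 (.var 13)) (.var 1))) .skip
      (.assign 11 (.const 0)))))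

def thresholdCmd : Cmd :=
  .ite (.var 11)
    (.seq (.assign 13 (.bin .sub (.bin .sub (.var 0) (.const 1)) (.var 12)))
    (.seq (.assign 14 (.get 6 (.var 13)))
    (.seq (.assign 15 (.var 10))
    (.seq (Cmd.forLoop 16 0 pullStepCmd) storeThresholdCmd))))
    .skip

/-- Cell `n` of array `7` is the sentinel `b n = P n`. -/
def thresholdPass : Cmd :=
  .seq (.store 7 (.var 0) (.var 8)) (.seq (.assign 11 (.const 1)) (Cmd.forLoop 12 0 thresholdCmd))

/-- As long as the target stays at or above `b j`, the maximum in `PullBack.step` has no effect, so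
`k` steps amount to subtracting `k * C`. This is what a single division computes. -/
theorem PullBack.steps {n : ℕ} {P : ℕ → ℕ} {C : ℕ} {b : ℕ → ℤ} {i j t k : ℕ} {y z : ℤ}
    (hij : i < j) (hj : j < n) (hb : (P j : ℤ) < b j) (hy : y ≤ P (j + 1))
    (hk : k = 0 ∨ b j ≤ y - (k - 1) * C) (h : PullBack n P C b i t (y - k * C) z) :
    PullBack n P C b i (t + k) y z := by
  induction k generalizing y with
  | zero => simpa using h
  | succ k ih =>
    have hk' : b j ≤ y - k * C := by
      rcases hk with hk | hk
      · omega
      · push_cast at hk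
        linarith
    have h0 : (0 : ℤ) ≤ k * C := by positivity
    refine PullBack.step (t := t + k) hij hj (by linarith) hy ?_
    rw [max_eq_left (by linarith)]
    refine ih (by omega) ?_ ?_
    · rcases Nat.eq_zero_or_pos k with h1 | h1
      · exact Or.inl h1
      · right
        linarith
    · have : y - (k + 1 : ℕ) * C = y - C - k * C := by
        push_cast
        ring
      rwa [this] at h

section ThresholdPass

variable {n C d N : ℕ} {P G : ℕ → ℕ} {b : ℕ → ℤ} {E : Side → ℤ → ℝ} {B : ℤ}

/-- The state of pulling back for the vertex of rank `i`, after `k` segments. -/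
def PulledBack (n : ℕ) (P G : ℕ → ℕ) (C d N : ℕ) (b : ℕ → ℤ) (i k : ℕ) (s : State) : Prop :=
  ∃ t : ℕ, s.var 15 = t ∧ t ≤ d ∧ (t = 0 ∨ s.var 14 ≤ P (max (n - k) (i + 1))) ∧
    (∀ z, PullBack n P C b i t (s.var 14) z → PullBack n P C b i d (G i) z) ∧
    0 ≤ s.var 14 + d * C - t * C ∧ s.var 14 ≤ N

/-- One division takes the target below `b j` or exhausts the steps. If it is still beyond `P j`,
one more step leads to `b j - C`, which is at most `P j` by the gap condition; so constant time
clears a segment. -/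
theorem run_pullStepCmd (hP : Monotone P) (hN : P n = N) (hC : 1 ≤ C) (hd : d * C ≤ N + C)
    (hdB : d ≤ N + 1)
    (hB : (4 * (n + C + N + 2) : ℕ) ≤ B) {i k : ℕ} (hk : k < n)
    (hb : IsThreshold n P G C d (i + 1) b)
    (hgap : ∀ j, i < j → j < n → b j ≤ P j + C) {s : State} (h0 : s.var 0 = n) (h1 : s.var 1 = C)
    (h13 : s.var 13 = i) (h16 : s.var 16 = k) (h5 : ∀ r ≤ n, s.arr 5 (r : ℕ) = P r)
    (h7 : ∀ r ≤ n, i < r → s.arr 7 (r : ℕ) = b r) (hI : PulledBack n P G C d N b i k s) :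
    Run E B pullStepCmd s 80 (PulledBack n P G C d N b i (k + 1)) := by
  obtain ⟨t, ht, htd, hty, hpull, hy0, hyN⟩ := hI
  obtain ⟨j, hj⟩ : ∃ j, n = j + 1 + k := ⟨n - 1 - k, by omega⟩
  refine Run.assign_seq (t₂ := 70) (v := j) ?_ ?_ ?_ (by decide)
  · simp only [AExp.eval, BinOp.eval, h0, h16]
    omega
  · rw [abs_of_nonneg (by positivity)]
    omega
  have h5j : s.arr 5 (j : ℤ) = P j := h5 j (by omega)
  refine Run.ite (t₁ := 55) ?_ ?_ (by decide)
  swap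
  · intro hcond
    have hcond' : i < j → s.var 14 ≤ P j := by
      intro hij
      by_contra hc
      have e1 : (i : ℤ) + 1 ≤ j := by omega
      have e2 : (P j : ℤ) + 1 ≤ s.var 14 := by omega
      simp [AExp.eval, BinOp.eval, h13, h5j, e1, e2] at hcond
    refine Run.skip (by decide) ⟨t, by simpa using ht, htd, ?_, by simpa using hpull,
      by simpa using hy0, by simpa using hyN⟩
    refine hty.imp id fun hty => ?_
    simp only [State.setVar_var]
    rcases Nat.lt_or_ge i j with hij | hij
    · rw [show max (n - (k + 1)) (i + 1) = j by omega]
      simpa using hcond' hij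
    · rw [show max (n - (k + 1)) (i + 1) = max (n - k) (i + 1) by omega]
      simpa using hty
  intro hcond
  obtain ⟨hij, hyj⟩ : i < j ∧ (P j : ℤ) < s.var 14 := by
    simp only [AExp.eval, BinOp.eval, State.setVar_var, State.setVar_arr] at hcond
    simp only [h13, h5j, reduceIte, Nat.reduceEqDiff] at hcond
    by_contra hc
    rw [not_and_or] at hc
    rcases hc with hc | hc
    · rw [if_neg (show ¬ (i : ℤ) + 1 ≤ j by omega)] at hcond
      simp at hcond
    · rw [if_neg (show ¬ (P j : ℤ) + 1 ≤ s.var 14 by omega)] at hcond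
      simp at hcond
  have h7j : s.arr 7 (j : ℤ) = b j := h7 j (by omega) hij
  have hjn : j < n := by omega
  have hmax : max (n - k) (i + 1) = j + 1 := by omega
  have hmax' : max (n - (k + 1)) (i + 1) = j := by omega
  rw [hmax] at hty
  have hbj := hgap j hij hjn
  have hbj0 := hb.le hP (show i + 1 ≤ j from hij) hjn.le
  have hbjN := hb.le_last hP (show i + 1 ≤ j from hij) hjn.le
  set y := s.var 14 with hy
  -- `y - (q + 1) * C` is the first value in steps of `C` that falls below `b j`. As `b j ≤ P j + C
  -- < y + C`, `q` is at least `-1`, and the step count `q + 1` is nonnegative.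
  set q := (y - b j) / C with hq
  have hCpos : (0 : ℤ) < C := by omega
  have hq1 : q * C ≤ y - b j := Int.ediv_mul_le _ hCpos.ne'
  have hq2 : y - b j < (q + 1) * C := Int.lt_ediv_add_one_mul_self _ hCpos
  have hq3 : -1 ≤ q := (Int.le_ediv_iff_mul_le hCpos).mpr (by omega)
  have hq4 : q ≤ N := by
    refine Int.ediv_le_of_le_mul hCpos ?_
    have : (N : ℤ) * 1 ≤ N * C := mul_le_mul_of_nonneg_left (by omega) (by positivity)
    omega
  refine Run.assign_seq (t₂ := 44) (v := q + 1) ?_ ?_ ?_ (by decide)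
  · simp [AExp.eval, BinOp.eval, h7j, h1, hq, hy]
  · rw [abs_of_nonneg (by omega)]
    omega
  -- the number of steps inside the segment
  obtain ⟨m, hm, hmt, hmC⟩ : ∃ m : ℕ, (m : ℤ) = min (t : ℤ) (q + 1) ∧ m ≤ t ∧
      (m : ℤ) * C ≤ t * C := by
    refine ⟨(min (t : ℤ) (q + 1)).toNat, by omega, by omega, ?_⟩
    exact mul_le_mul_of_nonneg_right (by omega) hCpos.le
  have htC : (t : ℤ) * C ≤ d * C := mul_le_mul_of_nonneg_right (by omega) hCpos.le
  have htC0 : (0 : ℤ) ≤ (t : ℤ) * C := by positivity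
  have hmC0 : (0 : ℤ) ≤ (m : ℤ) * C := by positivity
  have hd' : (d : ℤ) * C ≤ N + C := by exact_mod_cast hd
  have hmstep : m = 0 ∨ b j ≤ y - (m - 1) * C := by
    right
    have : ((m : ℤ) - 1) * C ≤ q * C := mul_le_mul_of_nonneg_right (by omega) hCpos.le
    linarith
  refine Run.seq (t₁ := 8) (t₂ := 36) (R := fun s' => s' =
    ((s.setVar 17 j).setVar 18 m)) ?_ ?_ (by decide)
  · have hset : ∀ v w : ℤ, ((s.setVar 17 j).setVar 18 v).setVar 18 w =
        (s.setVar 17 j).setVar 18 w := by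
      intro v w
      ext <;> simp
      split_ifs <;> rfl
    refine Run.ite (t₁ := 4) (fun hc => ?_) (fun hc => ?_) (by decide)
    · have hc' : (t : ℤ) ≤ q + 1 := by
        by_contra hc'
        simp [AExp.eval, BinOp.eval, ht, hc'] at hc
      refine Run.assign (v := m) ?_ ?_ (by decide) (hset _ _)
      · simp only [AExp.eval, State.setVar_var]
        simp only [ht, Nat.reduceEqDiff, reduceIte]
        omega
      · rw [abs_of_nonneg (by positivity)]
        omega
    · have hc' : ¬ (t : ℤ) ≤ q + 1 := by
        intro hc'
        simp [AExp.eval, BinOp.eval, ht, hc'] at hc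
      refine Run.skip (by decide) ?_
      rw [show (m : ℤ) = q + 1 by omega]
  rintro _ rfl
  refine Run.assign_seq (t₂ := 30) (v := y - m * C) ?_ ?_ ?_ (by decide)
  · simp [AExp.eval, BinOp.eval, h1, hy]
  · rw [abs_le]
    constructor <;> omega
  refine Run.assign_seq (t₂ := 26) (v := (t - m : ℕ)) ?_ ?_ ?_ (by decide)
  · simp only [AExp.eval, BinOp.eval, State.setVar_var]
    simp only [ht, Nat.reduceEqDiff, reduceIte]
    omega
  · rw [abs_of_nonneg (by positivity)]
    omega
  have hsub : ((t - m : ℕ) : ℤ) * C = t * C - m * C := by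
    rw [Nat.cast_sub hmt]
    ring
  have hpull' : ∀ z, PullBack n P C b i (t - m) (y - m * C) z → PullBack n P C b i d (G i) z := by
    intro z hz
    rcases hty with h | h
    · have hm0 : m = 0 := by omega
      subst hm0
      exact hpull z (by simpa using hz)
    · refine hpull z ?_
      have hbP : (P j : ℤ) < b j := by
        rcases hb.lt_or_eq_last hP (show i + 1 ≤ j from hij) hjn.le with h' | h'
        · exact h'
        · have : P (j + 1) ≤ P n := hP hjn
          omega
      have := PullBack.steps hij hjn hbP h hmstep hz
      rwa [Nat.sub_add_cancel hmt] at this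
  refine Run.ite (t₁ := 12) (fun hc => ?_) (fun hc => ?_) (by decide)
  · obtain ⟨hc1, hc2⟩ : (P j : ℤ) < y - m * C ∧ 1 ≤ t - m := by
      simp only [AExp.eval, BinOp.eval, State.setVar_var, State.setVar_arr] at hc
      simp only [h5j, reduceIte, Nat.reduceEqDiff] at hc
      by_contra hc'
      rw [not_and_or] at hc'
      rcases hc' with hc' | hc'
      · rw [if_neg (show ¬ (P j : ℤ) + 1 ≤ y - m * C by omega)] at hc
        simp at hc
      · rw [if_neg (show ¬ (1 : ℤ) ≤ (t - m : ℕ) by omega)] at hc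
        simp at hc
    -- Steps are left, so the count was not truncated to `t`; the target is below `b j` and the next
    -- step starts from `b j`.
    have hmq : (m : ℤ) = q + 1 := by omega
    have hyb : y - m * C < b j := by
      rw [hmq]
      linarith
    have hyP : y ≤ P (j + 1) := hty.resolve_left (by omega)
    refine Run.assign_seq (t₂ := 4) (v := b j - C) ?_ ?_ ?_ (by decide)
    · simp [AExp.eval, BinOp.eval, h7j, h1]
    · rw [abs_le]
      constructor <;> omega
    refine Run.assign (v := (t - m - 1 : ℕ)) ?_ ?_ (by decide) ⟨t - m - 1, by simp, by omega, ?_, ?_, ?_, ?_⟩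
    · simp only [AExp.eval, BinOp.eval, State.setVar_var]
      simp only [Nat.reduceEqDiff, reduceIte]
      omega
    · rw [abs_of_nonneg (by positivity)]
      omega
    · right
      rw [hmax']
      simp
      omega
    · intro z hz
      refine hpull' z ?_
      obtain ⟨e, he⟩ : ∃ e, t - m = e + 1 := ⟨t - m - 1, by omega⟩
      rw [he] at hz ⊢
      refine PullBack.step hij hjn hc1 (by omega) ?_
      rw [max_eq_right hyb.le]
      simpa using hz
    · have : ((t - m - 1 : ℕ) : ℤ) * C = t * C - m * C - C := by
        rw [Nat.cast_sub hc2, Nat.cast_sub hmt]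
        push_cast
        ring
      simp only [State.setVar_var, Nat.reduceEqDiff, reduceIte]
      omega
    · simp
      omega
  · have hc' : t - m = 0 ∨ y - m * C ≤ P j := by
      by_contra hc'
      rw [not_or] at hc'
      have e1 : (P j : ℤ) + 1 ≤ y - m * C := by omega
      have e2 : (1 : ℤ) ≤ (t - m : ℕ) := by omega
      simp only [AExp.eval, BinOp.eval, State.setVar_var, State.setVar_arr] at hc
      simp only [h5j, reduceIte, Nat.reduceEqDiff, if_pos e1, if_pos e2] at hc
      simp at hc
    refine Run.skip (by decide) ⟨t - m, by simp, by omega, ?_, ?_, ?_, ?_⟩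
    · rw [hmax']
      simpa using hc'
    · intro z hz
      exact hpull' z (by simpa using hz)
    · simp only [State.setVar_var, Nat.reduceEqDiff, reduceIte]
      omega
    · simp only [State.setVar_var, Nat.reduceEqDiff, reduceIte]
      omega

/-- The state of the second pass when the segments from `i` on have been processed. -/
def TestedFrom (n : ℕ) (P G : ℕ → ℕ) (C d i : ℕ) (s : State) : Prop :=
  (s.var 11 = 1 ∧ IsThreshold n P G C d i (fun j => s.arr 7 j) ∧
    ∀ j, i ≤ j → j < n → s.arr 7 (j : ℕ) ≤ P j + C) ∨
  (s.var 11 = 0 ∧ ¬ ∃ c, IsCutSequence (P n) C d (fun x => G (segment n P x)) c)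

/-- After all segments the target is at most `P (i + 1)` or no step is left, so the base case of
`PullBack` yields `z = y - t * C`. -/
theorem run_storeThresholdCmd (hP : Monotone P) (hN : P n = N) (hd : d * C ≤ N + C)
    (hB : (4 * (n + C + N + 2) : ℕ) ≤ B) {i k : ℕ} (hk : n = i + 1 + k) {s : State}
    (hb : IsThreshold n P G C d (i + 1) (fun j => s.arr 7 j))
    (hgap : ∀ j, i < j → j < n → s.arr 7 (j : ℕ) ≤ P j + C) (h1 : s.var 1 = C)
    (h13 : s.var 13 = i) (h5 : ∀ r ≤ n, s.arr 5 (r : ℕ) = P r) (h11 : s.var 11 = 1)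
    (hI : PulledBack n P G C d N (fun j => s.arr 7 j) i n s) :
    Run E B storeThresholdCmd s 80 (TestedFrom n P G C d i) := by
  obtain ⟨t, ht, htd, hty, hpull, hy0, hyN⟩ := hI
  rw [show max (n - n) (i + 1) = i + 1 by omega] at hty
  have hi : i < n := by omega
  have h5i : s.arr 5 (i : ℤ) = P i := h5 i hi.le
  have h5i' : s.arr 5 ((i : ℤ) + 1) = P (i + 1) := by exact_mod_cast h5 (i + 1) hi
  have hPi : P (i + 1) ≤ P n := hP hi
  have hPi' : P i ≤ P (i + 1) := hP (Nat.le_add_right i 1)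
  have hCnn : (0 : ℤ) ≤ C := by positivity
  have htC : (t : ℤ) * C ≤ d * C := mul_le_mul_of_nonneg_right (by omega) hCnn
  have htC0 : (0 : ℤ) ≤ (t : ℤ) * C := by positivity
  have hd' : (d : ℤ) * C ≤ N + C := by exact_mod_cast hd
  have hbnn := hb.le hP (le_refl (i + 1)) hi
  have hbN := hb.le_last hP (le_refl (i + 1)) hi
  set y := s.var 14 with hy
  set z := y - t * C with hz
  have hpz : PullBack n P C (fun j => s.arr 7 j) i d (G i) z := hpull z (.base hty)
  refine Run.assign_seq (t₂ := 70) (v := z) ?_ ?_ ?_ (by decide)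
  · simp [AExp.eval, BinOp.eval, ht, h1, hz, hy]
  · rw [abs_le]
    constructor <;> omega
  set a := max (P i + 1 : ℤ) z with ha
  refine Run.seq (t₁ := 12) (t₂ := 56) (R := fun s' => s' = s.setVar 19 a) ?_ ?_ (by decide)
  · refine Run.ite (t₁ := 7) (fun hc => ?_) (fun hc => ?_) (by decide)
    · have hc' : z ≤ P i := by
        by_contra hc'
        simp [AExp.eval, BinOp.eval, h13, h5i, hc'] at hc
      refine Run.assign (v := a) ?_ ?_ (by decide) ?_
      · simp [AExp.eval, BinOp.eval, h13, h5i, ha]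
        omega
      · rw [abs_le]
        constructor <;> omega
      · ext <;> simp
        split_ifs <;> rfl
    · have hc' : ¬ z ≤ P i := by
        intro hc'
        simp [AExp.eval, BinOp.eval, h13, h5i, hc'] at hc
      refine Run.skip (by decide) ?_
      rw [show a = z by omega]
  rintro _ rfl
  set v := if a ≤ P (i + 1) then a else s.arr 7 (i + 1 : ℕ) with hv
  have hvb : |v| ≤ B := by
    rw [hv, abs_le]
    split_ifs <;> constructor <;> omega
  have hib : |(i : ℤ)| ≤ B := by
    rw [abs_of_nonneg (by positivity)]
    omega
  refine Run.seq (t₁ := 20) (t₂ := 20) (R := fun s' => s' = (s.setVar 19 a).setArr 7 i v) ?_ ?_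
    (by decide)
  · refine Run.ite (t₁ := 12) (fun hc => ?_) (fun hc => ?_) (by decide)
    · have hc' : a ≤ P (i + 1) := by
        by_contra hc'
        simp [AExp.eval, BinOp.eval, h13, h5i', hc'] at hc
      rw [if_pos hc'] at hv
      exact Run.store (by simp [AExp.eval, h13]) (by simp [AExp.eval, hv]) hib hvb (by decide) rfl
    · have hc' : ¬ a ≤ P (i + 1) := by
        intro hc'
        simp [AExp.eval, BinOp.eval, h13, h5i', hc'] at hc
      rw [if_neg hc'] at hv
      exact Run.store (by simp [AExp.eval, h13]) (by simp [AExp.eval, BinOp.eval, hv, h13]) hib hvb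
        (by decide) rfl
  rintro _ rfl
  have hb' : IsThreshold n P G C d i (fun j => ((s.setVar 19 a).setArr 7 i v).arr 7 j) := by
    refine hb.update hi hpz (v := v) hv (by simp) ?_
    intro j hj
    have : (j : ℤ) ≠ i := by omega
    simp [this]
  have hgap' : ∀ j, i < j → j < n →
      ((s.setVar 19 a).setArr 7 i v).arr 7 (j : ℕ) ≤ P j + C := by
    intro j hj hjn
    have : (j : ℤ) ≠ i := by omega
    simpa [this] using hgap j hj hjn
  refine Run.ite (t₁ := 4) (fun hc => ?_) (fun hc => ?_) (by decide)
  · have hc' : v ≤ P i + C := by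
      by_contra hc'
      simp [AExp.eval, BinOp.eval, h13, h5i, h1, hc'] at hc
    refine Run.skip (by decide) (Or.inl ⟨by simpa using h11, hb', ?_⟩)
    intro j hj hjn
    rcases hj.eq_or_lt with rfl | hj
    · simpa using hc'
    · exact hgap' j hj hjn
  · have hc' : ¬ v ≤ P i + C := by
      intro hc'
      simp [AExp.eval, BinOp.eval, h13, h5i, h1, hc'] at hc
    refine Run.assign (v := 0) rfl (by simp; omega) (by decide) (Or.inr ⟨by simp, ?_⟩)
    -- The thresholds are valid including the new one, so a cut sequence would bound it by `P i +
    -- C`.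
    rintro ⟨c, hcut⟩
    have := hb'.le_add hP hcut le_rfl hi.le
    simp at this
    omega

theorem run_thresholdCmd (hP : Monotone P) (hN : P n = N) (hG : ∀ i, G i ≤ N) (hC : 1 ≤ C)
    (hd : d * C ≤ N + C) (hdB : d ≤ N + 1)
    (hB : (4 * (n + C + N + 2) : ℕ) ≤ B) {k : ℕ} (hk : k < n) {s : State} (h0 : s.var 0 = n)
    (h1 : s.var 1 = C) (h10 : s.var 10 = d) (h12 : s.var 12 = k)
    (h5 : ∀ r ≤ n, s.arr 5 (r : ℕ) = P r) (h6 : ∀ r < n, s.arr 6 (r : ℕ) = G r)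
    (hI : TestedFrom n P G C d (n - k) s) :
    Run E B thresholdCmd s (90 * n + 110) (TestedFrom n P G C d (n - (k + 1))) := by
  refine Run.ite (t₁ := 90 * n + 108) (fun hc => ?_) (fun hc => ?_) (by simp [AExp.size]; omega)
  swap
  · refine Run.skip (by omega) ?_
    rcases hI with hI | hI
    · simp only [AExp.eval] at hc
      omega
    · exact Or.inr hI
  obtain ⟨h11, hb, hgap⟩ : s.var 11 = 1 ∧ IsThreshold n P G C d (n - k) (fun j => s.arr 7 j) ∧
      ∀ j, n - k ≤ j → j < n → s.arr 7 (j : ℕ) ≤ P j + C :=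
    hI.resolve_right fun h => hc h.1
  obtain ⟨i, hi⟩ : ∃ i, n = i + 1 + k := ⟨n - 1 - k, by omega⟩
  rw [show n - k = i + 1 by omega] at hb hgap
  rw [show n - (k + 1) = i by omega]
  have hGi := hG i
  refine Run.assign_seq (t₂ := 90 * n + 102) (v := i) ?_ ?_ ?_ (by simp [AExp.size]; omega)
  · simp only [AExp.eval, BinOp.eval, h0, h12]
    omega
  · rw [abs_of_nonneg (by positivity)]
    omega
  refine Run.assign_seq (t₂ := 90 * n + 99) (v := G i) ?_ ?_ ?_ (by simp [AExp.size]; omega)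
  · simp [AExp.eval, h6 i (by omega)]
  · rw [abs_of_nonneg (by positivity)]
    omega
  refine Run.assign_seq (t₂ := 90 * n + 97) (v := d) ?_ ?_ ?_ (by simp [AExp.size]; omega)
  · simp [AExp.eval, h10]
  · rw [abs_of_nonneg (by positivity)]
    omega
  set s₁ := ((s.setVar 13 i).setVar 14 (G i)).setVar 15 d with hs₁
  refine Run.seq (t₁ := n * (80 + 10) + 8) (t₂ := 80)
    (Run.forLoop (I := PulledBack n P G C d N (fun j => s.arr 7 j) i) (m := n) (tb := 80)
      (by decide) rfl rfl (by simp [hs₁, h0]) (by omega) ?_ ?_ ?_) ?_ (by omega)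
  · refine ⟨d, by simp [hs₁], le_rfl, ?_, ?_, ?_, ?_⟩
    · right
      rw [show max (n - 0) (i + 1) = n by omega, hN]
      simp [hs₁]
      exact hGi
    · simp [hs₁]
    · simp [hs₁]
    · simp [hs₁]
      exact hGi
  · intro j s' z h
    simpa [PulledBack] using h
  · intro j hj s' hx hF hI'
    refine run_pullStepCmd hP hN hC hd hdB hB hj hb (fun j h h' => hgap j h h') ?_ ?_ ?_ hx ?_ ?_ hI'
    · rw [hF.var 0 rfl]
      simp [hs₁, h0]
    · rw [hF.var 1 rfl]
      simp [hs₁, h1]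
    · rw [hF.var 13 rfl]
      simp [hs₁]
    · rw [hF.arr 5 rfl]
      simpa [hs₁] using h5
    · rw [hF.arr 7 rfl]
      simp [hs₁]
  · rintro s' ⟨hI', hF⟩
    have e7 : s'.arr 7 = s.arr 7 := by
      rw [hF.arr 7 rfl]
      simp [hs₁]
    refine run_storeThresholdCmd hP hN hd hB hi (by rw [e7]; exact hb) (by rw [e7]; exact hgap)
      ?_ ?_ ?_ ?_ (by rw [e7]; exact hI')
    · rw [hF.var 1 rfl]
      simp [hs₁, h1]
    · rw [hF.var 13 rfl]
      simp [hs₁]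
    · rw [hF.arr 5 rfl]
      simpa [hs₁] using h5
    · rw [hF.var 11 rfl]
      simp [hs₁, h11]

theorem run_thresholdPass (hP : Monotone P) (hN : P n = N) (hG : ∀ i, G i ≤ N) (hC : 1 ≤ C)
    (hd : d * C ≤ N + C) (hdB : d ≤ N + 1)
    (hB : (4 * (n + C + N + 2) : ℕ) ≤ B) {s : State} (h0 : s.var 0 = n)
    (h1 : s.var 1 = C) (h8 : s.var 8 = N) (h10 : s.var 10 = d)
    (h5 : ∀ r ≤ n, s.arr 5 (r : ℕ) = P r) (h6 : ∀ r < n, s.arr 6 (r : ℕ) = G r) :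
    Run E B thresholdPass s (n * (90 * n + 120) + 20) (TestedFrom n P G C d 0) := by
  refine Run.store_seq (t₂ := n * (90 * n + 120) + 14) (u := n) (v := N) (by simp [AExp.eval, h0])
    (by simp [AExp.eval, h8]) ?_ ?_ ?_ (by simp [AExp.size]; omega)
  · rw [abs_of_nonneg (by positivity)]
    omega
  · rw [abs_of_nonneg (by positivity)]
    omega
  refine Run.assign_seq (t₂ := n * (90 * n + 120) + 10) (v := 1) rfl (by simp; omega) ?_
    (by simp [AExp.size]; omega)
  set s₁ := (s.setArr 7 n N).setVar 11 1 with hs₁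
  refine (Run.forLoop (I := fun k => TestedFrom n P G C d (n - k)) (m := n) (tb := 90 * n + 110)
    (by decide) rfl rfl (by simp [hs₁, h0]) (by omega) ?_ ?_ ?_).mono (by ring_nf; omega) ?_
  -- No segment has been processed yet, so only the sentinel has to be checked.
  · refine Or.inl ⟨by simp [hs₁], ⟨by simp [hs₁, hN], ?_⟩, ?_⟩
    · intro i h h'
      omega
    · intro i h h'
      omega
  · intro k s' z h
    simpa [TestedFrom] using h
  · intro k hk s' hx hF hI
    refine run_thresholdCmd hP hN hG hC hd hdB hB hk ?_ ?_ ?_ hx ?_ ?_ hI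
    · rw [hF.var 0 rfl]
      simp [hs₁, h0]
    · rw [hF.var 1 rfl]
      simp [hs₁, h1]
    · rw [hF.var 10 rfl]
      simp [hs₁, h10]
    · rw [hF.arr 5 rfl]
      simpa [hs₁] using h5
    · rw [hF.arr 6 rfl]
      simpa [hs₁] using h6
  · rintro s' ⟨h, -⟩
    simpa using h

end ThresholdPass

/-! ## The third pass: greedy cuts and the list of copies

Variable `9` is the number of colors, `20` the number of the current block, `22` and `23` its ends,
`26` the number of copies listed so far. -/

/-- Move the cut `23` forward to the greatest admissible cut in segment `24`. -/
def forwardCmd : Cmd :=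
  .seq (.assign 25 (.get 5 (.bin .add (.var 24) (.const 1))))
  (.seq (.ite (.bin .le (.bin .add (.var 22) (.var 1)) (.var 25))
      (.assign 25 (.bin .add (.var 22) (.var 1))) .skip)
    (.ite (.bin .mul (.bin .le (.get 7 (.var 24)) (.var 25))
        (.bin .le (.bin .add (.var 23) (.const 1)) (.var 25)))
      (.assign 23 (.var 25)) .skip))

/-- List the copy of the vertex of rank `24` in the current block if there is one. -/
def listCopyCmd : Cmd :=
  .seq (.assign 25 (.get 5 (.bin .add (.var 24) (.const 1))))
  (.seq (.ite (.bin .le (.var 23) (.var 25)) (.assign 25 (.var 23)) .skip)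
  (.seq (.assign 28 (.get 5 (.var 24)))
  (.seq (.ite (.bin .le (.var 28) (.var 22)) (.assign 28 (.var 22)) .skip)
  (.seq (.assign 25 (.bin .sub (.var 25) (.var 28)))
    (.ite (.bin .le (.const 1) (.var 25))
      (.seq (.store 1 (.var 26) (.get 4 (.var 24)))
      (.seq (.store 2 (.var 26) (.var 25))
      (.seq (.store 3 (.var 26) (.bin .mod (.var 20) (.var 9)))
        (.assign 26 (.bin .add (.var 26) (.const 1))))))
      .skip)))))

def blockCmd : Cmd :=
  .seq (.assign 23 (.var 22))
  (.seq (Cmd.forLoop 24 0 forwardCmd)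
  (.seq (Cmd.forLoop 24 0 listCopyCmd) (.assign 22 (.var 23))))

def outputPass : Cmd :=
  .seq (.assign 21 (.bin .add (.var 0) (.var 0)))
  (.seq (.assign 22 (.const 0))
  (.seq (.assign 26 (.const 0)) (Cmd.forLoop 20 21 blockCmd)))

section PieceList

variable {n : ℕ} {P c : ℕ → ℕ}

/-- The pairs of block `k` and one of the first `i` vertices that meet. -/
def pieceRow (P c : ℕ → ℕ) (k i : ℕ) : List (ℕ × ℕ) :=
  ((List.range i).filter fun i => 0 < overlap (P i) (P (i + 1)) (c k) (c (k + 1))).map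
    fun i => (k, i)

theorem pieceRow_succ (k i : ℕ) : pieceRow P c k (i + 1) =
    pieceRow P c k i ++ if 0 < overlap (P i) (P (i + 1)) (c k) (c (k + 1)) then [(k, i)] else [] := by
  unfold pieceRow
  rw [List.range_succ, List.filter_append, List.map_append]
  split_ifs with h <;> simp [h]

theorem pieceList_succ (m : ℕ) :
    pieceList n P c (m + 1) = pieceList n P c m ++ pieceRow P c m n := by
  simp [pieceList, pieceRow, List.range_succ, List.flatMap_append]

theorem length_pieceRow_le (k i : ℕ) : (pieceRow P c k i).length ≤ i := by
  rw [pieceRow, List.length_map]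
  exact (List.length_filter_le _ _).trans_eq List.length_range

theorem length_pieceList_le (m : ℕ) : (pieceList n P c m).length ≤ m * n := by
  induction m with
  | zero => simp [pieceList]
  | succ m ih =>
    rw [pieceList_succ, List.length_append, add_mul, one_mul]
    exact add_le_add ih (length_pieceRow_le _ _)

end PieceList

/-- The arrays `1`, `2`, `3` list the vertices, the weights and the colors of the pieces in `L`. -/
def Listed (P c : ℕ → ℕ) (l : ℕ) (L : List (ℕ × ℕ)) (s : State) : Prop :=
  s.var 26 = L.length ∧ ∀ t : ℕ, ∀ ht : t < L.length,
    s.arr 1 t = s.arr 4 (L[t].2 : ℕ) ∧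
    s.arr 2 t = overlap (P L[t].2) (P (L[t].2 + 1)) (c L[t].1) (c (L[t].1 + 1)) ∧
    s.arr 3 t = ((L[t].1 % l : ℕ) : ℤ)

section OutputPass

variable {n C N l : ℕ} {P c : ℕ → ℕ} {E : Side → ℤ → ℝ} {B : ℤ}

theorem Listed.congr {L : List (ℕ × ℕ)} {s s' : State} (h : Listed P c l L s)
    (h26 : s'.var 26 = s.var 26) (ha : s'.arr = s.arr) : Listed P c l L s' := by
  unfold Listed
  rw [h26, ha]
  exact h

theorem Listed.append {L : List (ℕ × ℕ)} {k i : ℕ} {s s' : State} (h : Listed P c l L s)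
    (h26 : s'.var 26 = L.length + 1) (h4 : s'.arr 4 = s.arr 4)
    (h1 : ∀ t, s'.arr 1 t = if t = L.length then s.arr 4 i else s.arr 1 t)
    (h2 : ∀ t, s'.arr 2 t = if t = L.length then
      (overlap (P i) (P (i + 1)) (c k) (c (k + 1)) : ℤ) else s.arr 2 t)
    (h3 : ∀ t, s'.arr 3 t = if t = L.length then ((k % l : ℕ) : ℤ) else s.arr 3 t) :
    Listed P c l (L ++ [(k, i)]) s' := by
  refine ⟨by simp [h26], fun t ht => ?_⟩
  rw [h1, h2, h3, h4]
  by_cases htL : t < L.length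
  · have : (t : ℤ) ≠ L.length := by omega
    simp only [this, if_false, List.getElem_append_left htL]
    exact h.2 t htL
  · have : t = L.length := by
      simp at ht
      omega
    subst this
    simp

theorem run_listCopyCmd (hP : Monotone P) (hN : P n = N) (hc : ∀ k, c k ≤ N)
    (hB : (4 * (n + C + N + 2) : ℕ) ≤ B) {L : List (ℕ × ℕ)} (hL : (L.length : ℤ) + 1 ≤ B)
    {k i : ℕ} (hk : k < 2 * n) (hi : i < n) {s : State} (h9 : s.var 9 = l)
    (h20 : s.var 20 = k) (h22 : s.var 22 = c k) (h23 : s.var 23 = c (k + 1)) (h24 : s.var 24 = i)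
    (h4 : |s.arr 4 i| ≤ B) (h5 : ∀ r ≤ n, s.arr 5 (r : ℕ) = P r) (hI : Listed P c l L s) :
    Run E B listCopyCmd s 80 (Listed P c l
      (L ++ if 0 < overlap (P i) (P (i + 1)) (c k) (c (k + 1)) then [(k, i)] else [])) := by
  have h5i : s.arr 5 (i : ℤ) = P i := h5 i hi.le
  have h5i' : s.arr 5 ((i : ℤ) + 1) = P (i + 1) := by exact_mod_cast h5 (i + 1) hi
  have hPi : P (i + 1) ≤ P n := hP hi
  have hPi' : P i ≤ P (i + 1) := hP (Nat.le_add_right i 1)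
  have hck := hc k
  have hck' := hc (k + 1)
  refine Run.assign_seq (t₂ := 70) (v := P (i + 1)) ?_ ?_ ?_ (by decide)
  · simp [AExp.eval, BinOp.eval, h24, h5i']
  · rw [abs_of_nonneg (by positivity)]
    omega
  refine Run.seq (t₁ := 10) (t₂ := 60)
    (R := fun s' => s' = s.setVar 25 (min (P (i + 1)) (c (k + 1)) : ℕ)) ?_ ?_ (by decide)
  · refine Run.ite (t₁ := 2) (fun h => ?_) (fun h => ?_) (by decide)
    · have h' : c (k + 1) ≤ P (i + 1) := by
        by_contra h'
        simp [AExp.eval, BinOp.eval, h23, h'] at h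
      refine Run.assign (v := c (k + 1)) (by simp [AExp.eval, h23]) ?_ (by decide) ?_
      · rw [abs_of_nonneg (by positivity)]
        omega
      · rw [min_eq_right h']
        ext <;> simp
        split_ifs <;> rfl
    · have h' : ¬ c (k + 1) ≤ P (i + 1) := by
        intro h'
        simp [AExp.eval, BinOp.eval, h23, h'] at h
      refine Run.skip (by decide) ?_
      rw [min_eq_left (by omega)]
  rintro _ rfl
  refine Run.assign_seq (t₂ := 56) (v := P i) ?_ ?_ ?_ (by decide)
  · simp [AExp.eval, h24, h5i]
  · rw [abs_of_nonneg (by positivity)]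
    omega
  refine Run.seq (t₁ := 10) (t₂ := 46)
    (R := fun s' => s' = (s.setVar 25 (min (P (i + 1)) (c (k + 1)) : ℕ)).setVar 28
      (max (P i) (c k) : ℕ)) ?_ ?_ (by decide)
  · refine Run.ite (t₁ := 2) (fun h => ?_) (fun h => ?_) (by decide)
    · have h' : P i ≤ c k := by
        by_contra h'
        simp [AExp.eval, BinOp.eval, h22, h'] at h
      refine Run.assign (v := c k) (by simp [AExp.eval, h22]) ?_ (by decide) ?_
      · rw [abs_of_nonneg (by positivity)]
        omega
      · rw [max_eq_right h']
        ext <;> simp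
        split_ifs <;> rfl
    · have h' : ¬ P i ≤ c k := by
        intro h'
        simp [AExp.eval, BinOp.eval, h22, h'] at h
      refine Run.skip (by decide) ?_
      rw [max_eq_left (by omega)]
  rintro _ rfl
  -- An integer difference, negative if vertex and block are far apart; where positive it equals the
  -- truncated `overlap`.
  set w : ℤ := (min (P (i + 1)) (c (k + 1)) : ℕ) - (max (P i) (c k) : ℕ) with hw
  have hwB : |w| ≤ B := by
    rw [abs_le]
    constructor <;> omega
  refine Run.assign_seq (t₂ := 40) (v := w) (by simp [AExp.eval, BinOp.eval, hw]) hwB ?_ (by decide)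
  set s₁ := ((s.setVar 25 (min (P (i + 1)) (c (k + 1)) : ℕ)).setVar 28
      (max (P i) (c k) : ℕ)).setVar 25 w with hs₁
  refine Run.ite (t₁ := 30) (fun h => ?_) (fun h => ?_) (by decide)
  · have h' : 1 ≤ w := by
      by_contra h'
      simp [AExp.eval, BinOp.eval, hs₁, h'] at h
    have hwo : w = overlap (P i) (P (i + 1)) (c k) (c (k + 1)) := by
      unfold overlap
      omega
    rw [if_pos (by omega)]
    have h26 : s₁.var 26 = L.length := by
      rw [← hI.1]
      simp [hs₁]
    have hu : |(L.length : ℤ)| ≤ B := by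
      rw [abs_of_nonneg (by positivity)]
      omega
    refine Run.store_seq (t₂ := 20) (u := L.length) (v := s.arr 4 i) (by simp [AExp.eval, h26])
      (by simp [AExp.eval, hs₁, h24]) hu h4 ?_ (by decide)
    refine Run.store_seq (t₂ := 15) (u := L.length) (v := w) (by simp [AExp.eval, h26])
      (by simp [AExp.eval, hs₁]) hu hwB ?_ (by decide)
    refine Run.store_seq (t₂ := 8) (u := L.length) (v := (k % l : ℕ)) (by simp [AExp.eval, h26])
      (by simp [AExp.eval, BinOp.eval, hs₁, h20, h9]) hu ?_ ?_ (by decide)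
    · have := Nat.mod_le k l
      rw [abs_of_nonneg (by positivity)]
      omega
    refine Run.assign (v := L.length + 1) (by simp [AExp.eval, BinOp.eval, h26]) ?_ (by decide) ?_
    · rw [abs_of_nonneg (by positivity)]
      omega
    refine hI.append (by simp) ?_ ?_ ?_ ?_
    · funext t
      simp [hs₁]
    · intro t
      simp [hs₁]
    · intro t
      simp [hs₁, hwo]
    · intro t
      simp [hs₁]
  · have h' : ¬ 1 ≤ w := by
      intro h'
      simp [AExp.eval, BinOp.eval, hs₁, h'] at h
    rw [if_neg (by unfold overlap; omega), List.append_nil]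
    exact Run.skip (by decide) (hI.congr (by simp [hs₁]) (by simp [hs₁]))

theorem run_forwardCmd {b : ℕ → ℤ} (hP : Monotone P) (hN : P n = N)
    (hB : (4 * (n + C + N + 2) : ℕ) ≤ B) {e f i : ℕ} (he : e ≤ N) (hi : i < n) {s : State}
    (h1 : s.var 1 = C) (h22 : s.var 22 = e) (h23 : s.var 23 = f) (h24 : s.var 24 = i)
    (h5 : ∀ r ≤ n, s.arr 5 (r : ℕ) = P r) (h7 : s.arr 7 i = b i) :
    Run E B forwardCmd s 50 (fun s' => s'.var 23 =
      ((if b i ≤ (min (P (i + 1)) (e + C) : ℕ) then max f (min (P (i + 1)) (e + C)) else f : ℕ) :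
        ℤ)) := by
  have h5i' : s.arr 5 ((i : ℤ) + 1) = P (i + 1) := by exact_mod_cast h5 (i + 1) hi
  have hPi : P (i + 1) ≤ P n := hP hi
  refine Run.assign_seq (t₂ := 40) (v := P (i + 1)) ?_ ?_ ?_ (by decide)
  · simp [AExp.eval, BinOp.eval, h24, h5i']
  · rw [abs_of_nonneg (by positivity)]
    omega
  set w := min (P (i + 1)) (e + C) with hw
  have hwB : |(w : ℤ)| ≤ B := by
    rw [abs_of_nonneg (by positivity)]
    omega
  refine Run.seq (t₁ := 14) (t₂ := 26) (R := fun s' => s' = s.setVar 25 w) ?_ ?_ (by decide)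
  · refine Run.ite (t₁ := 4) (fun h => ?_) (fun h => ?_) (by decide)
    · have h' : (e : ℤ) + C ≤ P (i + 1) := by
        by_contra h'
        simp [AExp.eval, BinOp.eval, h22, h1, h'] at h
      refine Run.assign (v := w) ?_ hwB (by decide) ?_
      · simp [AExp.eval, BinOp.eval, h22, h1]
        omega
      · ext <;> simp
        split_ifs <;> rfl
    · have h' : ¬ (e : ℤ) + C ≤ P (i + 1) := by
        intro h'
        simp [AExp.eval, BinOp.eval, h22, h1, h'] at h
      refine Run.skip (by decide) ?_
      rw [show w = P (i + 1) by omega]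
  rintro _ rfl
  refine Run.ite (t₁ := 2) (fun h => ?_) (fun h => ?_) (by decide)
  · simp only [AExp.eval, BinOp.eval, State.setVar_var, State.setVar_arr] at h
    simp only [h24, h23, h7, reduceIte, Nat.reduceEqDiff] at h
    have h' : b i ≤ w ∧ (f : ℤ) + 1 ≤ w := by
      by_contra h'
      rw [not_and_or] at h'
      rcases h' with h' | h' <;> simp [h'] at h
    refine Run.assign (v := w) (by simp [AExp.eval]) hwB (by decide) ?_
    rw [if_pos h'.1, max_eq_right (by omega)]
    simp
  · simp only [AExp.eval, BinOp.eval, State.setVar_var, State.setVar_arr] at h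
    simp only [h24, h23, h7, reduceIte, Nat.reduceEqDiff] at h
    refine Run.skip (by decide) ?_
    by_cases h' : b i ≤ w
    · have h'' : ¬ (f : ℤ) + 1 ≤ w := by
        intro h''
        simp [h', h''] at h
      rw [if_pos h', max_eq_left (by omega)]
      simpa using h23
    · rw [if_neg h']
      simpa using h23

theorem run_blockCmd {b : ℕ → ℤ} (hP : Monotone P) (hN : P n = N)
    (hB : (4 * (n + C + N + 2) : ℕ) ≤ B) (hB' : (2 * n * n + 1 : ℕ) ≤ B) {k : ℕ} (hk : k < 2 * n)
    {s : State} (h0 : s.var 0 = n) (h1 : s.var 1 = C) (h9 : s.var 9 = l) (h20 : s.var 20 = k)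
    (h4 : ∀ i < n, |s.arr 4 (i : ℕ)| ≤ B) (h5 : ∀ r ≤ n, s.arr 5 (r : ℕ) = P r)
    (h7 : ∀ r < n, s.arr 7 (r : ℕ) = b r)
    (hI : s.var 22 = greedyCut n P b C k ∧ Listed P (greedyCut n P b C) l
      (pieceList n P (greedyCut n P b C) k) s) :
    Run E B blockCmd s (n * 150 + 30) (fun s' => s'.var 22 = greedyCut n P b C (k + 1) ∧
      Listed P (greedyCut n P b C) l (pieceList n P (greedyCut n P b C) (k + 1)) s') := by
  obtain ⟨h22, hI⟩ := hI
  set c := greedyCut n P b C with hc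
  have hcN : ∀ k, c k ≤ N := fun k => hN ▸ greedyCut_le hP k
  have hcB : ∀ k, |(c k : ℤ)| ≤ B := by
    intro k
    have := hcN k
    rw [abs_of_nonneg (by positivity)]
    omega
  refine Run.assign_seq (t₂ := n * 150 + 28) (v := c k) (by simp [AExp.eval, h22]) (hcB k) ?_
    (by simp [AExp.size]; omega)
  set s₁ := s.setVar 23 (c k) with hs₁
  refine Run.seq (t₁ := n * (50 + 10) + 8) (t₂ := n * 90 + 20)
    (Run.forLoop (I := fun m s' => s'.var 23 = forward P b C (c k) m) (m := n) (tb := 50)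
      (by decide) rfl rfl (by simp [hs₁, h0]) (by omega) (by simp [hs₁, forward]) ?_ ?_) ?_
    (by omega)
  · intro m s' z h
    simpa using h
  · intro m hm s' hx hF h
    refine (run_forwardCmd (f := forward P b C (c k) m) (b := b) hP hN hB (hcN k) hm ?_ ?_ h hx ?_ ?_).mono
      le_rfl ?_
    · rw [hF.var 1 rfl]
      simp [hs₁, h1]
    · rw [hF.var 22 rfl]
      simp [hs₁, h22]
    · rw [hF.arr 5 rfl]
      simpa [hs₁] using h5
    · rw [hF.arr 7 rfl]
      simpa [hs₁] using h7 m hm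
    · intro s'' h''
      rw [h'', forward]
  rintro s₂ ⟨h23, hF₂⟩
  replace h23 : s₂.var 23 = c (k + 1) := h23
  have hI₂ : Listed P c l (pieceList n P c k) s₂ := by
    refine hI.congr ?_ ?_
    · rw [hF₂.var 26 rfl]
      simp [hs₁]
    · funext a
      rw [hF₂.arr a rfl, hs₁, State.setVar_arr]
  refine Run.seq (t₁ := n * (80 + 10) + 8) (t₂ := 4)
    (Run.forLoop (I := fun i s' => Listed P c l (pieceList n P c k ++ pieceRow P c k i) s')
      (m := n) (tb := 80)
      (by decide) rfl rfl ?_ (by omega) (by simpa [pieceRow] using hI₂) ?_ ?_) ?_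
    (by omega)
  · rw [hF₂.var 0 rfl]
    simp [hs₁, h0]
  · intro i s' z h
    exact h.congr (by simp) (by simp)
  · intro i hi s' hx hF h
    rw [pieceRow_succ, ← List.append_assoc]
    have e4 : s'.arr 4 = s.arr 4 := by
      rw [hF.arr 4 rfl, hF₂.arr 4 rfl, hs₁, State.setVar_arr]
    have e5 : s'.arr 5 = s.arr 5 := by
      rw [hF.arr 5 rfl, hF₂.arr 5 rfl, hs₁, State.setVar_arr]
    refine run_listCopyCmd hP hN hcN hB ?_ hk hi ?_ ?_ ?_ ?_ hx ?_ ?_ h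
    -- At most `n` copies arise per block, so after `2 * n` blocks the list index is still within `2
    -- * n * n`.
    · have e1 := length_pieceList_le (n := n) (P := P) (c := c) k
      have e2 := length_pieceRow_le (P := P) (c := c) k i
      have e3 : (k + 1) * n ≤ 2 * n * n := Nat.mul_le_mul_right n hk
      rw [add_mul, one_mul] at e3
      rw [List.length_append]
      push_cast at hB' ⊢
      have e3' : (k : ℤ) * n + n ≤ 2 * n * n := by exact_mod_cast e3
      have e1' : ((pieceList n P c k).length : ℤ) ≤ k * n := by exact_mod_cast e1
      omega
    · rw [hF.var 9 rfl, hF₂.var 9 rfl]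
      simp [hs₁, h9]
    · rw [hF.var 20 rfl, hF₂.var 20 rfl]
      simp [hs₁, h20]
    · rw [hF.var 22 rfl, hF₂.var 22 rfl]
      simp [hs₁, h22]
    · rw [hF.var 23 rfl, h23]
    · rw [e4]
      exact h4 i hi
    · rw [e5]
      exact h5
  · rintro s₃ ⟨h, hF₃⟩
    refine Run.assign (v := c (k + 1)) ?_ (hcB _) (by decide) ⟨by simp, ?_⟩
    · rw [AExp.eval, hF₃.var 23 rfl, h23]
    · rw [pieceList_succ]
      exact h.congr (by simp) (by simp)

theorem run_outputPass {b : ℕ → ℤ} (hP : Monotone P) (hN : P n = N)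
    (hB : (4 * (n + C + N + 2) : ℕ) ≤ B) (hB' : (2 * n * n + 1 : ℕ) ≤ B)
    {s : State} (h0 : s.var 0 = n) (h1 : s.var 1 = C) (h9 : s.var 9 = l)
    (h4 : ∀ i < n, |s.arr 4 (i : ℕ)| ≤ B) (h5 : ∀ r ≤ n, s.arr 5 (r : ℕ) = P r)
    (h7 : ∀ r < n, s.arr 7 (r : ℕ) = b r) :
    Run E B outputPass s (n * (300 * n + 100) + 30) (fun s' => Frame outputPass s s' ∧
      Listed P (greedyCut n P b C) l (pieceList n P (greedyCut n P b C) (2 * n)) s') := by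
  refine (Run.frame ?_).mono le_rfl fun s' h => And.symm h
  refine Run.assign_seq (t₂ := n * (300 * n + 100) + 20) (v := (2 * n : ℕ)) ?_ ?_ ?_
    (by simp [AExp.size]; omega)
  · simp [AExp.eval, BinOp.eval, h0]
    ring
  · rw [abs_of_nonneg (by positivity)]
    omega
  refine Run.assign_seq (t₂ := n * (300 * n + 100) + 16) (v := 0) rfl (by simp; omega) ?_
    (by simp [AExp.size]; omega)
  refine Run.assign_seq (t₂ := n * (300 * n + 100) + 12) (v := 0) rfl (by simp; omega) ?_
    (by simp [AExp.size]; omega)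
  set s₁ := ((s.setVar 21 (2 * n : ℕ)).setVar 22 0).setVar 26 0 with hs₁
  refine (Run.forLoop (I := fun k s' => s'.var 22 = greedyCut n P b C k ∧
      Listed P (greedyCut n P b C) l (pieceList n P (greedyCut n P b C) k) s')
    (m := 2 * n) (tb := n * 150 + 30)
    (by decide) rfl rfl (by simp [hs₁]) (by omega) ?_ ?_ ?_).mono (by ring_nf; omega) ?_
  · exact ⟨by simp [hs₁, greedyCut], by simp [Listed, pieceList, hs₁]⟩
  · intro k s' z h
    exact ⟨by simpa using h.1, h.2.congr (by simp) (by simp)⟩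
  · intro k hk s' hx hF hI
    refine run_blockCmd hP hN hB hB' hk ?_ ?_ ?_ hx ?_ ?_ ?_ hI
    · rw [hF.var 0 rfl]
      simp [hs₁, h0]
    · rw [hF.var 1 rfl]
      simp [hs₁, h1]
    · rw [hF.var 9 rfl]
      simp [hs₁, h9]
    · rw [hF.arr 4 rfl]
      simpa [hs₁] using h4
    · rw [hF.arr 5 rfl]
      simpa [hs₁] using h5
    · rw [hF.arr 7 rfl]
      simpa [hs₁] using h7
  · rintro s' ⟨h, -⟩
    exact h.2

end OutputPass

/-! ## The programs -/

/-- Test whether the number of colors that the heaviest clique needs suffices, and use one more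
color otherwise. -/
def minColorsCmd : Cmd :=
  .seq rankPass
  (.seq (.assign 9 (.bin .div (.bin .sub (.bin .add (.var 7) (.var 1)) (.const 1)) (.var 1)))
  (.seq (.assign 10 (.bin .sub (.var 9) (.const 1)))
    (.ite (.var 9)
      (.seq thresholdPass
        (.ite (.var 11) .skip
          (.seq (Cmd.forLoop 12 0
              (.store 7 (.var 12) (.bin .add (.get 5 (.var 12)) (.const 1))))
            (.assign 9 (.bin .add (.var 9) (.const 1))))))
      .skip)))

/-- Compute the least number of colors. -/
def countColorsCmd : Cmd := .seq minColorsCmd (.assign 0 (.var 9))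

/-- Construct a split coloring with the least number of colors. -/
def splitColorCmd : Cmd :=
  .seq minColorsCmd (.seq outputPass (.seq (.assign 0 (.var 9)) (.assign 1 (.var 26))))

/-! ### Correctness, optimality and running time of the programs -/

section Main

variable {n C : ℕ} {G : SimpleGraph (Fin n)} {lft rgt : Fin n → ℝ} {W : Fin n → ℕ} {B : ℤ}

theorem SplitColorable.weight_eq_zero (h : SplitColorable G W C 0) (v : Fin n) : W v = 0 := by
  obtain ⟨K⟩ := h
  rw [← K.sum_weight v]
  exact Finset.sum_eq_zero fun j _ => (K.color j).elim0

/-- If all weights vanish then there need not be any copies. -/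
def SplitColoring.empty (hW : ∀ v, W v = 0) : SplitColoring G W C 0 where
  card := 0
  owner := Fin.elim0
  weight := Fin.elim0
  color := Fin.elim0
  sum_weight v := by simp [hW]
  isColoring i := i.elim0

/-- The lower bound on the number of colors. Zero colors are treated apart because the passage to
block colorings needs a color to exist. -/
theorem HoldsCliqueWeight.le_mul (hrep : IsProperIntervalRep G lft rgt) {s : State}
    (hs : HoldsCliqueWeight lft rgt W s) {l : ℕ} (h : SplitColorable G W C l) :
    s.var 7 ≤ (l * C : ℕ) := by
  rcases Nat.eq_zero_or_pos l with rfl | hl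
  · have := hs.le_total
    rw [Finset.sum_eq_zero fun v _ => h.weight_eq_zero v] at this
    simpa using this
  · have h1 := (h.clique_le_and_exists_isCutSequence hrep hl).1
    rcases hs.attained with h2 | ⟨r, hr, h2⟩
    · rw [h2]
      positivity
    · have := h1 r hr
      omega

theorem HoldsCliqueWeight.weight_le (hrep : IsProperIntervalRep G lft rgt) {s : State}
    (hs : HoldsCliqueWeight lft rgt W s) (v : Fin n) : W v ≤ s.var 7 := by
  have h1 := hs.le _ (rankNat_lt lft v)
  have h2 := prefixWeight_succ_le_reachWeight W hrep (rankNat_lt lft v)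
  rw [prefixWeight_succ] at h2
  omega

/-- The variable `9` holds the least number of colors, and array `7` holds thresholds for which the
greedy cuts give an optimal split coloring. -/
structure Solved (G : SimpleGraph (Fin n)) (lft rgt : Fin n → ℝ) (W : Fin n → ℕ) (C l : ℕ)
    (s : State) : Prop where
  ranked : Ranked lft rgt W C s
  colors : s.var 9 = l
  isLeast : IsLeast {l' | SplitColorable G W C l'} l
  le_total : l ≤ (∑ v, W v) + 1
  greedy : (l = 0 ∧ ∀ v, W v = 0) ∨ ∃ d, l = d + 1 ∧
    IsCutSequence (∑ v, W v) C d (conflictEnd lft rgt W)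
      (greedyCut n (prefixWeight lft W) (fun j => s.arr 7 j) C) ∧
    ∀ k, min (∑ v, W v) (k * C) ≤
      greedyCut n (prefixWeight lft W) (fun j => s.arr 7 j) C (2 * k)

theorem Ranked.of_frame {p : Cmd} {s s' : State} (h : Ranked lft rgt W C s) (hF : Frame p s s')
    (h0 : p.writesVar 0 = false) (h1 : p.writesVar 1 = false) (h8 : p.writesVar 8 = false)
    (h4 : p.writesArr 4 = false) (h5 : p.writesArr 5 = false) (h6 : p.writesArr 6 = false) :
    Ranked lft rgt W C s' :=
  ⟨(hF.var 0 h0).trans h.card, (hF.var 1 h1).trans h.bound, (hF.var 8 h8).trans h.total,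
    by rw [hF.arr 4 h4]; exact h.order, by rw [hF.arr 5 h5]; exact h.pre,
    by rw [hF.arr 6 h6]; exact h.reach⟩

/-- The answer is `⌈ω / C⌉` or one more. A negative test is conclusive since every split coloring
with `⌈ω / C⌉` colors yields a cut sequence; then all cuts are declared admissible by resetting the
thresholds to `P i + 1`. -/
theorem run_minColorsCmd (hrep : IsProperIntervalRep G lft rgt) (hC : 1 ≤ C)
    (hB : (4 * (n + C + ∑ v, W v + 2) : ℕ) ≤ B) :
    Run (endpoint lft rgt) B minColorsCmd (initState W C) (n * (160 * n + 300) + 100)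
      (fun s => ∃ l, Solved G lft rgt W C l s) := by
  have hP0 : prefixWeight lft W 0 = 0 := prefixWeight_zero lft W
  have hP := prefixWeight_mono lft W
  have hPn : prefixWeight lft W n = ∑ v, W v := prefixWeight_of_ge lft W le_rfl
  have hG := reachWeight_le lft rgt W
  refine Run.seq (t₁ := n * (70 * n + 90) + 12) (t₂ := n * (90 * n + 150) + 80)
    (run_rankPass lft rgt W hB) ?_ (by ring_nf; omega)
  rintro s ⟨hr, hω⟩
  obtain ⟨ω, hω7⟩ := Int.eq_ofNat_of_zero_le hω.nonneg
  have hωN := hω.le_total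
  rw [hω7] at hωN
  set N := ∑ v, W v with hN
  obtain ⟨l, hl⟩ : ∃ l, l = (ω + C - 1) / C := ⟨_, rfl⟩
  have hl1 : ω ≤ l * C := by
    have := Nat.lt_div_mul_add (a := ω + C - 1) (b := C) (by omega)
    rw [← hl] at this
    omega
  have hl2 : l * C ≤ ω + C - 1 := hl ▸ Nat.div_mul_le_self _ _
  have hl3 : l ≤ ω := by
    by_contra h
    have : (ω + 1) * C ≤ l * C := Nat.mul_le_mul_right C (by omega)
    have h2 : ω * 1 ≤ ω * C := Nat.mul_le_mul_left ω hC
    rw [add_mul] at this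
    omega
  have hmin : ∀ l', SplitColorable G W C l' → l ≤ l' := by
    intro l' h
    have h1 := hω.le_mul hrep h
    rw [hω7] at h1
    have h1' : ω ≤ l' * C := by exact_mod_cast h1
    by_contra h2
    have : (l' + 1) * C ≤ l * C := Nat.mul_le_mul_right C (by omega)
    rw [add_mul] at this
    omega
  have hclique : ∀ r < n, reachWeight lft rgt W r ≤ prefixWeight lft W r + l * C := by
    intro r h
    have := hω.le r h
    rw [hω7] at this
    omega
  refine Run.assign_seq (t₂ := n * (90 * n + 150) + 70) (v := l) ?_ ?_ ?_
    (by simp [AExp.size]; omega)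
  · rw [hl]
    simp only [AExp.eval, BinOp.eval, hω7, hr.bound]
    rw [Int.natCast_div, Nat.cast_sub (by omega)]
    push_cast
    rfl
  · rw [abs_of_nonneg (by positivity)]
    omega
  refine Run.assign_seq (t₂ := n * (90 * n + 150) + 60) (v := l - 1) ?_ ?_ ?_
    (by simp [AExp.size]; omega)
  · simp [AExp.eval, BinOp.eval]
  · rw [abs_le]
    constructor <;> omega
  set s₁ := (s.setVar 9 l).setVar 10 (l - 1) with hs₁
  have hr₁ : Ranked lft rgt W C s₁ :=
    ⟨by simp [hs₁, hr.card], by simp [hs₁, hr.bound], by simp [hs₁, hr.total],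
      by simpa [hs₁] using hr.order, by simpa [hs₁] using hr.pre, by simpa [hs₁] using hr.reach⟩
  refine Run.ite (t₁ := n * (90 * n + 150) + 50) (fun h => ?_) (fun h => ?_)
    (by simp [AExp.size]; omega)
  swap
  -- A clique weight of zero makes all weights zero, and the coloring without copies uses no color.
  · have hl0 : l = 0 := by simpa [AExp.eval, hs₁] using h
    have hW : ∀ v, W v = 0 := by
      intro v
      have := hω.weight_le hrep v
      rw [hω7] at this
      rw [hl0] at hl1
      omega
    exact Run.skip (by omega) ⟨l, hr₁, by simp [hs₁], ⟨hl0 ▸ ⟨SplitColoring.empty hW⟩, hmin⟩,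
      by omega, Or.inl ⟨hl0, hW⟩⟩
  obtain ⟨d, rfl⟩ : ∃ d, l = d + 1 := by
    have : l ≠ 0 := by
      rintro rfl
      simp [AExp.eval, hs₁] at h
    exact ⟨l - 1, by omega⟩
  -- Gives `d * C < ω ≤ N`, which keeps all pulled-back targets within a machine word.
  rw [add_mul, one_mul] at hl2
  refine Run.seq (t₁ := n * (90 * n + 120) + 20) (t₂ := n * 20 + 20)
    (Run.frame (run_thresholdPass (d := d) hP hPn hG hC (by omega) (by omega) hB hr₁.card hr₁.bound
      hr₁.total (by simp [hs₁]) hr₁.pre hr₁.reach)) ?_ (by ring_nf; omega)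
  rintro s₂ ⟨h₂, hF₂⟩
  have hr₂ := hr₁.of_frame hF₂ rfl rfl rfl rfl rfl rfl
  have h9 : s₂.var 9 = (d + 1 : ℕ) := by
    rw [hF₂.var 9 rfl]
    simp [hs₁]
  refine Run.ite (t₁ := n * 20 + 18) (fun h => ?_) (fun h => ?_)
    (by simp [AExp.size]; omega)
  · obtain ⟨-, hb, hgap⟩ := h₂.resolve_right fun h' => h h'.1
    replace hgap := fun j => hgap j (Nat.zero_le j)
    have hcut := hb.isCutSequence_greedyCut hP0 hP hC (by rwa [hPn]) hgap
    have hreach := hb.greedyCut_two_mul hP0 hP hC hgap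
    rw [hPn] at hcut
    simp only [hPn] at hreach
    exact Run.skip (by omega) ⟨d + 1, hr₂, h9, ⟨hcut.splitColorable hrep, hmin⟩, by omega,
      Or.inr ⟨d, rfl, hcut, hreach⟩⟩
  · have hno : ¬ SplitColorable G W C (d + 1) := by
      intro h'
      have := (h'.clique_le_and_exists_isCutSequence hrep (Nat.succ_pos d)).2
      rcases h₂ with ⟨h3, -⟩ | ⟨-, h3⟩
      · simp [AExp.eval, h3] at h
      · rw [hPn] at h3
        exact h3 this
    refine Run.seq (t₁ := n * (6 + 10) + 8) (t₂ := 4)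
      (Run.forLoop (I := fun k s' => ∀ j < k, s'.arr 7 (j : ℕ) = prefixWeight lft W j + 1) (m := n)
        (tb := 6) (by decide) rfl rfl hr₂.card (by omega) (by simp) (by simp) ?_) ?_ (by omega)
    · intro k hk s' hx hF hI
      have hPk : prefixWeight lft W k ≤ prefixWeight lft W n := hP hk.le
      refine Run.store (u := k) (v := prefixWeight lft W k + 1) (by simp [AExp.eval, hx]) ?_ ?_ ?_
        (by decide) ?_
      · simp only [AExp.eval, BinOp.eval, hx]
        rw [hF.arr 5 rfl, hr₂.pre k hk.le]
      · rw [abs_of_nonneg (by positivity)]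
        omega
      · rw [abs_of_nonneg (by positivity)]
        omega
      · intro j hj
        rcases Nat.lt_succ_iff_lt_or_eq.mp hj with hj | rfl
        · have : (j : ℤ) ≠ k := by omega
          simpa [this] using hI j hj
        · simp
    rintro s₃ ⟨hb, hF₃⟩
    have hr₃ := hr₂.of_frame hF₃ rfl rfl rfl rfl rfl rfl
    have hcut := isCutSequence_greedyCut_of_clique_le (b := fun j => s₃.arr 7 j) hP0 hP hC
      (by rwa [hPn]) hclique hb
    have hreach := greedyCut_eq_min (C := C) hP0 hP hb
    rw [hPn] at hcut
    simp only [hPn] at hreach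
    refine Run.assign (v := (d + 1 + 1 : ℕ)) ?_ ?_ (by decide) ⟨d + 1 + 1, ?_, by simp, ⟨?_, ?_⟩,
      by omega, Or.inr ⟨d + 1, rfl, hcut, ?_⟩⟩
    · simp [AExp.eval, BinOp.eval, hF₃.var 9 rfl, h9]
    · rw [abs_of_nonneg (by positivity)]
      omega
    · exact ⟨by simp [hr₃.card], by simp [hr₃.bound], by simp [hr₃.total],
        by simpa using hr₃.order, by simpa using hr₃.pre, by simpa using hr₃.reach⟩
    · exact hcut.splitColorable hrep
    · intro l' hl'
      have h3 := hmin l' hl'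
      have h4 : l' ≠ d + 1 := by
        rintro rfl
        exact hno hl'
      omega
    · intro k
      simp only [State.setVar_arr]
      rw [hreach]
      have : k * C ≤ 2 * k * C := Nat.mul_le_mul_right C (by omega)
      omega

theorem run_countColorsCmd (hrep : IsProperIntervalRep G lft rgt) (hC : 1 ≤ C)
    (hB : (4 * (n + C + ∑ v, W v + 2) : ℕ) ≤ B) :
    Run (endpoint lft rgt) B countColorsCmd (initState W C) (n * (160 * n + 300) + 110)
      (fun s => ∃ l : ℕ, IsLeast {l' | SplitColorable G W C l'} l ∧ s.var 0 = l) := by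
  refine Run.seq (t₂ := 10) (run_minColorsCmd hrep hC hB) ?_ (by omega)
  rintro s ⟨l, hs⟩
  have := hs.le_total
  refine Run.assign (v := l) (by simp [AExp.eval, hs.colors]) ?_ (by decide) ⟨l, hs.isLeast, by simp⟩
  rw [abs_of_nonneg (by positivity)]
  omega

theorem run_splitColorCmd (hrep : IsProperIntervalRep G lft rgt) (hC : 1 ≤ C) (hW : ∀ v, W v ≤ C)
    (hB : (4 * (n + C + ∑ v, W v + 2) : ℕ) ≤ B) (hB' : (2 * n * n + 1 : ℕ) ≤ B) :
    Run (endpoint lft rgt) B splitColorCmd (initState W C) (n * (460 * n + 400) + 150)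
      (fun s => ∃ l : ℕ, IsLeast {l' | SplitColorable G W C l'} l ∧
        ∃ K : SplitColoring G W C l, Holds s K) := by
  have hPn : prefixWeight lft W n = ∑ v, W v := prefixWeight_of_ge lft W le_rfl
  refine Run.seq (t₂ := n * (300 * n + 100) + 40) (run_minColorsCmd hrep hC hB) ?_
    (by ring_nf; omega)
  rintro s ⟨l, hs⟩
  have hr := hs.ranked
  have hlN := hs.le_total
  refine Run.seq (t₁ := n * (300 * n + 100) + 30) (t₂ := 10)
    (run_outputPass (b := fun j => s.arr 7 j) (prefixWeight_mono lft W) hPn hB hB' hr.card hr.bound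
      hs.colors ?_ hr.pre fun _ _ => rfl) ?_ (by omega)
  · intro i hi
    have := hr.order ((rank lft).symm ⟨i, hi⟩)
    rw [rankNat_rank_symm] at this
    rw [this, abs_of_nonneg (by positivity)]
    omega
  rintro s' ⟨hF, hL⟩
  have h9 : s'.var 9 = l := (hF.var 9 rfl).trans hs.colors
  have h4 : s'.arr 4 = s.arr 4 := hF.arr 4 rfl
  have hlen := length_pieceList_le (n := n) (P := prefixWeight lft W)
    (c := greedyCut n (prefixWeight lft W) (fun j => s.arr 7 j) C) (2 * n)
  refine Run.assign_seq (t₂ := 4) (v := l) (by simp [AExp.eval, h9]) ?_ ?_ (by decide)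
  · rw [abs_of_nonneg (by positivity)]
    omega
  refine Run.assign (v := (pieceList n (prefixWeight lft W)
    (greedyCut n (prefixWeight lft W) (fun j => s.arr 7 j) C) (2 * n)).length) ?_ ?_ (by decide)
    ⟨l, hs.isLeast, ?_⟩
  · simp [AExp.eval, hL.1]
  · rw [abs_of_nonneg (by positivity)]
    omega
  rcases hs.greedy with ⟨rfl, hW0⟩ | ⟨d, rfl, hcut, hreach⟩
  · refine ⟨SplitColoring.empty hW0, by simp, ?_, fun j => Fin.elim0 j⟩
    have : pieceList n (prefixWeight lft W)
        (greedyCut n (prefixWeight lft W) (fun j => s.arr 7 j) C) (2 * n) = [] := by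
      rw [List.eq_nil_iff_forall_not_mem]
      intro x hx
      obtain ⟨-, h2, h3⟩ := mem_pieceList.mp hx
      have h5 := prefixWeight_mono lft W (show x.2 + 1 ≤ n from h2)
      rw [hPn, Finset.sum_eq_zero fun v _ => hW0 v] at h5
      unfold overlap at h3
      omega
    simp [this, SplitColoring.empty]
  -- Here the bound `W v ≤ C` matters: it makes `2 * n` greedy blocks reach the end, so the output
  -- loop has listed everything.
  · have hNC : ∑ v, W v ≤ n * C := by
      simpa using Finset.sum_le_card_nsmul Finset.univ W C fun v _ => hW v
    have hm : greedyCut n (prefixWeight lft W) (fun j => s.arr 7 j) C (2 * n) = ∑ v, W v := by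
      have h1 := hreach n
      rw [min_eq_left hNC] at h1
      exact le_antisymm (hcut.le _) h1
    refine ⟨hcut.splitColoring hrep hm, hcut.holds_splitColoring hrep hm (by simp) (by simp) ?_ ?_⟩
    · simpa [h4] using hr.order
    · simpa using hL.2

theorem four_mul_le_wordBound {c : ℕ} (hc : 3 ≤ c) :
    ((4 * (n + C + ∑ v, W v + 2) : ℕ) : ℤ) ≤ wordBound W C c := by
  unfold wordBound
  set M := n + C + ∑ v, W v + 2 with hM
  have h1 : M ^ 3 ≤ M ^ c := Nat.pow_le_pow_right (by omega) hc
  have h2 : 2 * 2 * M ≤ M * M * M :=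
    Nat.mul_le_mul_right M (Nat.mul_le_mul (by omega) (by omega))
  rw [pow_succ, pow_two] at h1
  exact_mod_cast (by omega : 4 * M ≤ M ^ c)

/-- Needed for the indices of the up to `2 * n * n` listed copies. -/
theorem two_mul_sq_lt_wordBound {c : ℕ} (hc : 3 ≤ c) :
    ((2 * n * n + 1 : ℕ) : ℤ) ≤ wordBound W C c := by
  unfold wordBound
  set M := n + C + ∑ v, W v + 2 with hM
  have h1 : M ^ 3 ≤ M ^ c := Nat.pow_le_pow_right (by omega) hc
  have h2 : 2 * (n + 2) * (n + 2) ≤ M * M * M :=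
    Nat.mul_le_mul (Nat.mul_le_mul (by omega) (by omega)) (by omega)
  rw [pow_succ, pow_two] at h1
  have h3 : 2 * n * n + 1 ≤ 2 * (n + 2) * (n + 2) := by ring_nf; omega
  exact_mod_cast h3.trans (h2.trans h1)

end Main

end SplitColor

theorem theorem2 :
    -- Weights at most `C`: a split coloring with the least number of colors is constructed.
    (∃ P : SplitColor.Cmd, SplitColor.SolvesInQuadraticTime P
      (fun W C => ∀ v, W v ≤ C)
      (fun G W C s => ∃ l : ℕ, IsLeast {l' | SplitColor.SplitColorable G W C l'} l ∧
        ∃ K : SplitColor.SplitColoring G W C l, SplitColor.Holds s K)) ∧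
    -- Unrestricted weights: the least number of colors is computed.
    (∃ P : SplitColor.Cmd, SplitColor.SolvesInQuadraticTime P
      (fun _ _ => True)
      (fun G W C s => ∃ l : ℕ, IsLeast {l' | SplitColor.SplitColorable G W C l'} l ∧
        s.var 0 = l)) := by
  -- The value `1000` generously covers the coefficients of both time bounds, linear terms being
  -- absorbed by `n ≤ n * n`. As word exponent, any value from `3` on would do.
  refine ⟨⟨SplitColor.splitColorCmd, 1000, fun n G lft rgt W C hrep hC hW => ?_⟩,
    ⟨SplitColor.countColorsCmd, 1000, fun n G lft rgt W C hrep hC _ => ?_⟩⟩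
  · refine (SplitColor.run_splitColorCmd hrep hC hW
      (SplitColor.four_mul_le_wordBound (by norm_num))
      (SplitColor.two_mul_sq_lt_wordBound (by norm_num))).mono ?_ fun _ h => h
    nlinarith [Nat.le_mul_self n]
  · refine (SplitColor.run_countColorsCmd hrep hC
      (SplitColor.four_mul_le_wordBound (by norm_num))).mono ?_ fun _ h => h
    nlinarith [Nat.le_mul_self n]
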